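/- All vector spaces are over $\mathbb C$. A super vector space is $W=W_0\oplus W_1$ (indices in $\mathbb Z/2$), and $|w|$ is the parity of a homogeneous $w$; identities containing parities are required for homogeneous elements, and all operations on super vector spaces are multilinear and additive on parities. Let $e,f,h$ be the standard basis of $\mathfrak{sl}_2=\mathfrak{sl}_2(\mathbb C)$ ($[e,f]=h$, $[h,e]=2e$, $[h,f]=-2f$), $\kappa(x,y)=4\operatorname{tr}(xy)$, let $V=\mathbb C^2$ be the natural module with standard basis $e_1,e_2$, $\det$ the determinant form on $V$, and $\odot:V\otimes V\to\mathfrak{sl}_2$ the bilinear map with $e_1\odot e_1=e$, $e_1\odot e_2=e_2\odot e_1=-\tfrac12h$, $e_2\odot e_2=-f$. Both $\mathfrak{sl}_2$ and $V$ are even. **Short $\mathfrak{sl}_2$-Lie superalgebras.** A Lie superalgebra is a super vector space with a bracket satisfying $[x,y]=-(-1)^{|x||y|}[y,x]$ and $[[x,y],z]+(-1)^{|x|(|y|+|z|)}[[y,z],x]+(-1)^{|z|(|x|+|y|)}[[z,x],y]=0$. A short $\mathfrak{sl}_2$-Lie superalgebra is a Lie superalgebra $\mathfrak g$ on which $\mathfrak{sl}_2$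 acts by even derivations and which, as a super $\mathfrak{sl}_2$-module, is isomorphic to $\mathfrak{sl}_2\otimes J\oplus V\otimes M\oplus D$ for super vector spaces $J,M,D$ with trivial action. Morphisms are the even $\mathfrak{sl}_2$-linear maps that preserve brackets. This is the category $\mathfrak{sl}_2\text{-}\mathbf{supSS}$. **$\mathfrak J$-ternary superalgebras.** A Jordan superalgebra is a super vector space $\mathfrak J$ with a product such that $a\cdot b=(-1)^{|a||b|}b\cdot a$ and $$(a\cdot b)\cdot(c\cdot d)+(-1)^{|b||c|}(a\cdot c)\cdot(b\cdot d)+(-1)^{|b||d|+|c||d|}(a\cdot d)\cdot(b\cdot c)$$ $$=((a\cdot b)\cdot c)\cdot d+(-1)^{|b||c|+|b||d|+|c||d|}((a\cdot d)\cdot c)\cdot b+(-1)^{|a||b|+|a||c|+|a||d|+|c||d|}((b\cdot d)\cdot c)\cdot a .$$ A $\mathfrak J$-ternary superalgebra $(\mathfrak J,\mathcal M)$ consists of a Jordan superalgebra $\mathfrak J$, a super vector space $\mathcal M$ and operations $\bullet:\mathfrak J\otimes\mathcal M\to\mathcal M$, $\star:\mathcal M\otimes\mathcal M\to\mathfrak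 J$, $(-,-,-):\mathcal M^{\otimes3}\to\mathcal M$ such that $(a\cdot b)\bullet m=\tfrac12\big(a\bullet(b\bullet m)+(-1)^{|a||b|}b\bullet(a\bullet m)\big)$, $m\star n=-(-1)^{|m||n|}n\star m$, and 1. $a\cdot(m\star n)=\tfrac12\big((a\bullet m)\star n+(-1)^{|a||m|}m\star(a\bullet n)\big)$; 2. $a\bullet(m,n,s)=(a\bullet m,n,s)-(-1)^{|a||m|}(m,a\bullet n,s)+(-1)^{|a|(|m|+|n|)}(m,n,a\bullet s)$; 3. $(m,n,s)=(-1)^{|m|(|n|+|s|)+|n||s|}(s,n,m)-(-1)^{|n||s|}(m\star s)\bullet n$; 4. $(m,n,s)=(-1)^{|m||n|}(n,m,s)+(m\star n)\bullet s$; 5. $(m,n,r)\star s+(-1)^{|r|(|m|+|n|)}r\star(m,n,s)=(-1)^{|n|(|r|+|s|)}m\star((r\star s)\bullet n)$; 6. $(m,n,(r,s,t))=((m,n,r),s,t)+(-1)^{|r|(|m|+|n|)+|m||n|}(r,(n,m,s),t)+(-1)^{(|m|+|n|)(|r|+|s|)}(r,s,(m,n,t))$. Morphisms are pairs of even linear maps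 $\mathfrak J\to\mathfrak J'$, $\mathcal M\to\mathcal M'$ that preserve $\cdot,\bullet,\star$ and the triple product. This is the category $\mathbf{J\text{-}STer}$. **$\operatorname{TAG}$.** For a $\mathfrak J$-ternary superalgebra define maps $\langle a,b\rangle$ and $\partial_{m,n}$ on $\mathfrak J\oplus\mathcal M$ by $\langle a,b\rangle(c)=a\cdot(b\cdot c)-(-1)^{|a||b|}b\cdot(a\cdot c)$, $\ \langle a,b\rangle(m)=\tfrac14\big(a\bullet(b\bullet m)-(-1)^{|a||b|}b\bullet(a\bullet m)\big)$, $\ \partial_{m,n}(a)=\tfrac12\big((-1)^{|a|(|m|+|n|)}(a\bullet m)\star n-(-1)^{|a||n|}m\star(a\bullet n)\big)$, $\ \partial_{m,n}(r)=\tfrac12(m\star n)\bullet r-(m,n,r)$. Let $\mathfrak B^s(\mathfrak J,\mathcal M)$ be the quotient of $\mathfrak J\otimes\mathfrak J\oplus\mathcal M\otimes\mathcal M$ by the span of the elements * $a\otimes b+(-1)^{|a||b|}b\otimes a$ and $m\otimes n-(-1)^{|m||n|}n\otimes m$, * $(-1)^{|a||c|}(a\cdot b)\otimes c+(-1)^{|a||b|}(b\cdot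 c)\otimes a+(-1)^{|b||c|}(c\cdot a)\otimes b$, * $(a\bullet m)\otimes n-(-1)^{|a||m|}m\otimes(a\bullet n)-2(-1)^{|a|(|m|+|n|)}(m\star n)\otimes a$, * $\partial_{m,n}(r)\otimes s+(-1)^{(|m|+|n|)|r|}r\otimes\partial_{m,n}(s)+(-1)^{(|m|+|n|)(|r|+|s|)}\partial_{r,s}(m)\otimes n+(-1)^{(|r|+|s|)|n|}m\otimes\partial_{r,s}(n)$, for homogeneous $a,b,c\in\mathfrak J$, $m,n,r,s\in\mathcal M$; write $\{a\otimes b\}$, $\{m\otimes n\}$ for the classes. Put $$\operatorname{TAG}(\mathfrak J,\mathcal M)=\mathfrak{sl}_2\otimes\mathfrak J\ \oplus\ V\otimes\mathcal M\ \oplus\ \mathfrak B^s(\mathfrak J,\mathcal M),$$ with the induced grading, the evident $\mathfrak{sl}_2$-action (trivial on $\mathfrak B^s(\mathfrak J,\mathcal M)$) and the bracket given, for $D=\{a\otimes b\}$ acting on $\mathfrak J\oplus\mathcal M$ by $\langle a,b\rangle$ or $D=\{m\otimes n\}$ acting by $\partial_{m,n}$, by $[D,\{z_1\otimes z_2\}]=\{D(z_1)\otimes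 z_2\}+(-1)^{|D||z_1|}\{z_1\otimes D(z_2)\}$ (with $z_1,z_2$ both in $\mathfrak J$ or both in $\mathcal M$), $[D,x\otimes c]=x\otimes D(c)$, $[D,v\otimes r]=v\otimes D(r)$, $[x\otimes a,y\otimes b]=[x,y]\otimes a\cdot b+\tfrac12\kappa(x,y)\{a\otimes b\}$, $[x\otimes a,v\otimes m]=x(v)\otimes a\bullet m$, $[v\otimes m,w\otimes n]=(v\odot w)\otimes(m\star n)+\det(v,w)\{m\otimes n\}$, together with super-antisymmetry. A morphism $\eta=(\eta_1,\eta_2)$ is sent to $x\otimes a\mapsto x\otimes\eta_1(a)$, $v\otimes m\mapsto v\otimes\eta_2(m)$, $\{a\otimes b\}\mapsto\{\eta_1(a)\otimes\eta_1(b)\}$, $\{m\otimes n\}\mapsto\{\eta_2(m)\otimes\eta_2(n)\}$. **$\hat{\operatorname T}$.** For a short $\mathfrak{sl}_2$-Lie superalgebra $\mathfrak g$ put $\hat{\operatorname T}(\mathfrak g)=(\mathfrak J(\mathfrak g),\mathcal M(\mathfrak g))$ with $\mathfrak J(\mathfrak g)=\{a\in\mathfrak g: ha=2a\}$, $\mathcal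 M(\mathfrak g)=\{m\in\mathfrak g: hm=m\}$ and $$a\cdot b=\tfrac12[a,fb],\qquad a\bullet m=[a,fm],\qquad m\star n=[m,n],\qquad (m,n,r)=-[[m,fn],r];$$ a morphism of short $\mathfrak{sl}_2$-Lie superalgebras is sent to the pair of its restrictions. **Theorem.** These formulas define functors $\operatorname{TAG}:\mathbf{J\text{-}STer}\to\mathfrak{sl}_2\text{-}\mathbf{supSS}$ and $\hat{\operatorname T}:\mathfrak{sl}_2\text{-}\mathbf{supSS}\to\mathbf{J\text{-}STer}$, and $\operatorname{TAG}$ is left adjoint to $\hat{\operatorname T}$. The adjunction can be chosen so that its counit at $\mathfrak g$ is the canonical morphism $\operatorname{TAG}(\hat{\operatorname T}(\mathfrak g))\to\mathfrak g$ with $$e\otimes a\mapsto a,\qquad e_1\otimes m\mapsto m,\qquad \{a\otimes b\}\mapsto\tfrac14[fa,fb],\qquad \{m\otimes n\}\mapsto\tfrac12\big([m,fn]-[fm,n]\big).$$ -/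

import Mathlib

open scoped TensorProduct Matrix
open CategoryTheory

universe u

noncomputable section

namespace SuperTAG

/-! ## Super vector spaces over the complex numbers -/

/-- A complex super vector space: a vector space with a decomposition into an even part `gr 0`
and an odd part `gr 1`. -/
structure SuperSpace : Type (u + 1) where
  carrier : Type u
  [addCommGroup : AddCommGroup carrier]
  [module : Module ℂ carrier]
  gr : ZMod 2 → Submodule ℂ carrier
  isInternal : DirectSum.IsInternal gr

instance : CoeSort SuperSpace.{u} (Type u) := ⟨SuperSpace.carrier⟩

attribute [instance] SuperSpace.addCommGroup SuperSpace.module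

/-- The sign `(-1)^i` of a parity `i`. -/
def ksign (i : ZMod 2) : ℂ := (-1) ^ i.val

/-! ## The Lie algebra `sl₂`, its natural module, and the invariant pairings -/

/-- The Lie algebra `sl₂(ℂ)` of traceless 2 × 2 matrices. -/
abbrev Sl2 : Type := ↥(LieAlgebra.SpecialLinear.sl (Fin 2) ℂ)

/-- The natural two-dimensional module of `sl₂`; `x` acts on `v` as `x.1 *ᵥ v`. -/
abbrev V2 : Type := Fin 2 → ℂ

def sl2E : Sl2 := ⟨!![0, 1; 0, 0], by
  simp [LieAlgebra.SpecialLinear.sl, Matrix.trace, Fin.sum_univ_two]⟩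

def sl2F : Sl2 := ⟨!![0, 0; 1, 0], by
  simp [LieAlgebra.SpecialLinear.sl, Matrix.trace, Fin.sum_univ_two]⟩

def sl2H : Sl2 := ⟨!![1, 0; 0, -1], by
  simp [LieAlgebra.SpecialLinear.sl, Matrix.trace, Fin.sum_univ_two]⟩

/-- The vector `e₁` of the natural module. -/
def v1 : V2 := ![1, 0]

/-- The Killing form `κ(x, y) = 4 tr(xy)` of `sl₂`. -/
def kappa (x y : Sl2) : ℂ := 4 * Matrix.trace (x.1 * y.1)

/-- The determinant form on the natural module. -/
def detForm (v w : V2) : ℂ := v 0 * w 1 - v 1 * w 0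

/-- The symmetrizer `V ⊗ V → sl₂`, the bilinear map with `e₁ ⊙ e₁ = e`,
`e₁ ⊙ e₂ = e₂ ⊙ e₁ = -h/2` and `e₂ ⊙ e₂ = -f`. -/
def symz (v w : V2) : Sl2 :=
  (v 0 * w 0) • sl2E - ((v 0 * w 1 + v 1 * w 0) / 2) • sl2H - (v 1 * w 1) • sl2F

/-! ## Short `sl₂`-Lie superalgebras -/

/-- `br` is a Lie superbracket on the super vector space `g`. -/
structure IsLieSuper (g : SuperSpace.{u}) (br : g →ₗ[ℂ] g →ₗ[ℂ] g) : Prop where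
  br_mem : ∀ (i j : ZMod 2) (x y : g), x ∈ g.gr i → y ∈ g.gr j → br x y ∈ g.gr (i + j)
  skew : ∀ (i j : ZMod 2) (x y : g), x ∈ g.gr i → y ∈ g.gr j →
    br x y = -(ksign (i * j) • br y x)
  jacobi : ∀ (i j k : ZMod 2) (x y z : g), x ∈ g.gr i → y ∈ g.gr j → z ∈ g.gr k →
    br (br x y) z + ksign (i * (j + k)) • br (br y z) x
      + ksign (k * (i + j)) • br (br z x) y = 0

/-- An `sl₂`-Lie superalgebra: a Lie superalgebra on which `sl₂` acts by even derivations. -/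
structure SL2LieSuper : Type (u + 1) where
  space : SuperSpace.{u}
  br : space →ₗ[ℂ] space →ₗ[ℂ] space
  isLie : IsLieSuper space br
  act : Sl2 →ₗ[ℂ] Module.End ℂ space
  act_lie : ∀ (x y : Sl2) (z : space), act ⁅x, y⁆ z = act x (act y z) - act y (act x z)
  act_even : ∀ (x : Sl2) (i : ZMod 2) (y : space), y ∈ space.gr i → act x y ∈ space.gr i
  act_der : ∀ (x : Sl2) (y z : space), act x (br y z) = br (act x y) z + br y (act x z)

/-- An `sl₂`-Lie superalgebra is short if, as a super `sl₂`-module, it is isomorphic to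
`sl₂ ⊗ J ⊕ V ⊗ M ⊕ D` for super vector spaces `J`, `M`, `D` on which `sl₂` acts trivially. -/
def IsShort (g : SL2LieSuper.{u}) : Prop :=
  ∃ (J M D : SuperSpace.{u}) (Φ : ((Sl2 ⊗[ℂ] J) × (V2 ⊗[ℂ] M) × D) ≃ₗ[ℂ] g.space),
    (∀ (i : ZMod 2) (y : Sl2) (a : J), a ∈ J.gr i → Φ (y ⊗ₜ[ℂ] a, 0, 0) ∈ g.space.gr i) ∧
    (∀ (i : ZMod 2) (v : V2) (m : M), m ∈ M.gr i → Φ (0, v ⊗ₜ[ℂ] m, 0) ∈ g.space.gr i) ∧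
    (∀ (i : ZMod 2) (d : D), d ∈ D.gr i → Φ (0, 0, d) ∈ g.space.gr i) ∧
    (∀ (x y : Sl2) (a : J), g.act x (Φ (y ⊗ₜ[ℂ] a, 0, 0)) = Φ (⁅x, y⁆ ⊗ₜ[ℂ] a, 0, 0)) ∧
    (∀ (x : Sl2) (v : V2) (m : M),
      g.act x (Φ (0, v ⊗ₜ[ℂ] m, 0)) = Φ (0, (x.1 *ᵥ v) ⊗ₜ[ℂ] m, 0)) ∧
    (∀ (x : Sl2) (d : D), g.act x (Φ (0, 0, d)) = 0)

/-- A short `sl₂`-Lie superalgebra. -/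
structure ShortSL2 : Type (u + 1) extends SL2LieSuper.{u} where
  short : IsShort toSL2LieSuper

/-- A morphism of short `sl₂`-Lie superalgebras: an even linear map compatible with the brackets
and with the actions of `sl₂`. -/
@[ext]
structure ShortSL2.Hom (g k : ShortSL2.{u}) : Type u where
  lin : g.space →ₗ[ℂ] k.space
  even : ∀ (i : ZMod 2) (x : g.space), x ∈ g.space.gr i → lin x ∈ k.space.gr i
  map_br : ∀ x y : g.space, lin (g.br x y) = k.br (lin x) (lin y)
  map_act : ∀ (s : Sl2) (x : g.space), lin (g.act s x) = k.act s (lin x)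

/-- The category of short `sl₂`-Lie superalgebras. -/
instance : Category ShortSL2.{u} where
  Hom := ShortSL2.Hom
  id g :=
    { lin := LinearMap.id
      even := fun _ _ hx => hx
      map_br := fun _ _ => rfl
      map_act := fun _ _ => rfl }
  comp φ ψ :=
    { lin := ψ.lin ∘ₗ φ.lin
      even := fun i x hx => ψ.even i _ (φ.even i x hx)
      map_br := fun x y => by simp [φ.map_br, ψ.map_br]
      map_act := fun s x => by simp [φ.map_act, ψ.map_act] }

/-! ## `J`-ternary superalgebras -/

/-- `dot` makes the super vector space `J` a Jordan superalgebra. -/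
structure IsJordanSuper (J : SuperSpace.{u}) (dot : J →ₗ[ℂ] J →ₗ[ℂ] J) : Prop where
  dot_mem : ∀ (i j : ZMod 2) (a b : J), a ∈ J.gr i → b ∈ J.gr j → dot a b ∈ J.gr (i + j)
  dot_comm : ∀ (i j : ZMod 2) (a b : J), a ∈ J.gr i → b ∈ J.gr j →
    dot a b = ksign (i * j) • dot b a
  jordan : ∀ (i j k l : ZMod 2) (a b c d : J),
    a ∈ J.gr i → b ∈ J.gr j → c ∈ J.gr k → d ∈ J.gr l →
    dot (dot a b) (dot c d) + ksign (j * k) • dot (dot a c) (dot b d)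
        + ksign (j * l + k * l) • dot (dot a d) (dot b c)
      = dot (dot (dot a b) c) d
        + ksign (j * k + j * l + k * l) • dot (dot (dot a d) c) b
        + ksign (i * j + i * k + i * l + k * l) • dot (dot (dot b d) c) a

/-- `bul` makes `M` a special supermodule of the Jordan superalgebra `(J, dot)`: the map
`a ↦ bul a` is a morphism of Jordan superalgebras from `J` to the space of endomorphisms of `M`
with the product `S · T = (ST + (-1)^{|S||T|} TS) / 2`. -/
structure IsSpecialSupermodule (J M : SuperSpace.{u}) (dot : J →ₗ[ℂ] J →ₗ[ℂ] J)
    (bul : J →ₗ[ℂ] M →ₗ[ℂ] M) : Prop where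
  bul_mem : ∀ (i j : ZMod 2) (a : J) (m : M), a ∈ J.gr i → m ∈ M.gr j → bul a m ∈ M.gr (i + j)
  bul_dot : ∀ (i j : ZMod 2) (a b : J), a ∈ J.gr i → b ∈ J.gr j →
    bul (dot a b) = (1 / 2 : ℂ) • (bul a ∘ₗ bul b + ksign (i * j) • (bul b ∘ₗ bul a))

/-- The axioms on `star` and on the triple product `tri` of a `J`-ternary superalgebra. -/
structure IsTernary (J M : SuperSpace.{u}) (dot : J →ₗ[ℂ] J →ₗ[ℂ] J)
    (bul : J →ₗ[ℂ] M →ₗ[ℂ] M) (star : M →ₗ[ℂ] M →ₗ[ℂ] J)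
    (tri : M →ₗ[ℂ] M →ₗ[ℂ] M →ₗ[ℂ] M) : Prop where
  star_mem : ∀ (i j : ZMod 2) (m n : M), m ∈ M.gr i → n ∈ M.gr j → star m n ∈ J.gr (i + j)
  star_anticomm : ∀ (i j : ZMod 2) (m n : M), m ∈ M.gr i → n ∈ M.gr j →
    star m n = -(ksign (i * j) • star n m)
  tri_mem : ∀ (i j k : ZMod 2) (m n r : M), m ∈ M.gr i → n ∈ M.gr j → r ∈ M.gr k →
    tri m n r ∈ M.gr (i + j + k)
  sjt1 : ∀ (i j k : ZMod 2) (a : J) (m n : M), a ∈ J.gr i → m ∈ M.gr j → n ∈ M.gr k →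
    dot a (star m n)
      = (1 / 2 : ℂ) • (star (bul a m) n + ksign (i * j) • star m (bul a n))
  sjt2 : ∀ (i j k l : ZMod 2) (a : J) (m n s : M),
    a ∈ J.gr i → m ∈ M.gr j → n ∈ M.gr k → s ∈ M.gr l →
    bul a (tri m n s)
      = tri (bul a m) n s - ksign (i * j) • tri m (bul a n) s
        + ksign (i * (j + k)) • tri m n (bul a s)
  sjt3 : ∀ (i j k : ZMod 2) (m n s : M), m ∈ M.gr i → n ∈ M.gr j → s ∈ M.gr k →
    tri m n s
      = ksign (i * (j + k) + j * k) • tri s n m - ksign (j * k) • bul (star m s) n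
  sjt4 : ∀ (i j k : ZMod 2) (m n s : M), m ∈ M.gr i → n ∈ M.gr j → s ∈ M.gr k →
    tri m n s = ksign (i * j) • tri n m s + bul (star m n) s
  sjt5 : ∀ (i j k l : ZMod 2) (m n r s : M),
    m ∈ M.gr i → n ∈ M.gr j → r ∈ M.gr k → s ∈ M.gr l →
    star (tri m n r) s + ksign (k * (i + j)) • star r (tri m n s)
      = ksign (j * (k + l)) • star m (bul (star r s) n)
  sjt6 : ∀ (i j k l p : ZMod 2) (m n r s t : M),
    m ∈ M.gr i → n ∈ M.gr j → r ∈ M.gr k → s ∈ M.gr l → t ∈ M.gr p →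
    tri m n (tri r s t)
      = tri (tri m n r) s t + ksign (k * (i + j) + i * j) • tri r (tri n m s) t
        + ksign ((i + j) * (k + l)) • tri r s (tri m n t)

/-- A `J`-ternary superalgebra `(J, M)`. -/
structure JTernary : Type (u + 1) where
  J : SuperSpace.{u}
  M : SuperSpace.{u}
  dot : J →ₗ[ℂ] J →ₗ[ℂ] J
  bul : J →ₗ[ℂ] M →ₗ[ℂ] M
  star : M →ₗ[ℂ] M →ₗ[ℂ] J
  tri : M →ₗ[ℂ] M →ₗ[ℂ] M →ₗ[ℂ] M
  isJordan : IsJordanSuper J dot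
  isSpecial : IsSpecialSupermodule J M dot bul
  isTernary : IsTernary J M dot bul star tri

/-- A morphism of `J`-ternary superalgebras: a pair of even linear maps compatible with all
the operations. -/
@[ext]
structure JTernary.Hom (X Y : JTernary.{u}) : Type u where
  onJ : X.J →ₗ[ℂ] Y.J
  onM : X.M →ₗ[ℂ] Y.M
  evenJ : ∀ (i : ZMod 2) (a : X.J), a ∈ X.J.gr i → onJ a ∈ Y.J.gr i
  evenM : ∀ (i : ZMod 2) (m : X.M), m ∈ X.M.gr i → onM m ∈ Y.M.gr i
  map_dot : ∀ a b : X.J, onJ (X.dot a b) = Y.dot (onJ a) (onJ b)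
  map_bul : ∀ (a : X.J) (m : X.M), onM (X.bul a m) = Y.bul (onJ a) (onM m)
  map_star : ∀ m n : X.M, onJ (X.star m n) = Y.star (onM m) (onM n)
  map_tri : ∀ m n r : X.M, onM (X.tri m n r) = Y.tri (onM m) (onM n) (onM r)

/-- The category of `J`-ternary superalgebras. -/
instance : Category JTernary.{u} where
  Hom := JTernary.Hom
  id X :=
    { onJ := LinearMap.id
      onM := LinearMap.id
      evenJ := fun _ _ h => h
      evenM := fun _ _ h => h
      map_dot := fun _ _ => rfl
      map_bul := fun _ _ => rfl
      map_star := fun _ _ => rfl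
      map_tri := fun _ _ _ => rfl }
  comp φ ψ :=
    { onJ := ψ.onJ ∘ₗ φ.onJ
      onM := ψ.onM ∘ₗ φ.onM
      evenJ := fun i a h => ψ.evenJ i _ (φ.evenJ i a h)
      evenM := fun i m h => ψ.evenM i _ (φ.evenM i m h)
      map_dot := fun a b => by simp [φ.map_dot, ψ.map_dot]
      map_bul := fun a m => by simp [φ.map_bul, ψ.map_bul]
      map_star := fun m n => by simp [φ.map_star, ψ.map_star]
      map_tri := fun m n r => by simp [φ.map_tri, ψ.map_tri] }

/-! ## The space of `TAG(J, M)` -/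

namespace JTernary

variable (X : JTernary.{u})

/-- `⟨a, b⟩(c)` for `a`, `b` of parity `i`, `j` and `c` in `J`. -/
def angleJ (i j : ZMod 2) (a b c : X.J) : X.J :=
  X.dot a (X.dot b c) - ksign (i * j) • X.dot b (X.dot a c)

/-- `⟨a, b⟩(m)` for `a`, `b` of parity `i`, `j` and `m` in `M`. -/
def angleM (i j : ZMod 2) (a b : X.J) (m : X.M) : X.M :=
  (1 / 4 : ℂ) • (X.bul a (X.bul b m) - ksign (i * j) • X.bul b (X.bul a m))

/-- `∂_{m,n}(a)` for `m`, `n` of parity `i`, `j` and `a` in `J` of parity `k`. -/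
def partJ (i j k : ZMod 2) (m n : X.M) (a : X.J) : X.J :=
  (1 / 2 : ℂ) • (ksign (k * (i + j)) • X.star (X.bul a m) n
    - ksign (k * j) • X.star m (X.bul a n))

/-- `∂_{m,n}(r)` for `r` in `M`. -/
def partM (m n r : X.M) : X.M :=
  (1 / 2 : ℂ) • X.bul (X.star m n) r - X.tri m n r

/-- The space `J ⊗ J ⊕ M ⊗ M`. -/
abbrev PreB : Type u := (X.J ⊗[ℂ] X.J) × (X.M ⊗[ℂ] X.M)

/-- The generators of the space of relations in `J ⊗ J ⊕ M ⊗ M`. -/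
inductive Relator : X.PreB → Prop
  | ab (i j : ZMod 2) (a b : X.J) (ha : a ∈ X.J.gr i) (hb : b ∈ X.J.gr j) :
      Relator (a ⊗ₜ[ℂ] b + ksign (i * j) • (b ⊗ₜ[ℂ] a), 0)
  | mn (i j : ZMod 2) (m n : X.M) (hm : m ∈ X.M.gr i) (hn : n ∈ X.M.gr j) :
      Relator (0, m ⊗ₜ[ℂ] n - ksign (i * j) • (n ⊗ₜ[ℂ] m))
  | abc (i j k : ZMod 2) (a b c : X.J)
      (ha : a ∈ X.J.gr i) (hb : b ∈ X.J.gr j) (hc : c ∈ X.J.gr k) :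
      Relator (ksign (i * k) • (X.dot a b ⊗ₜ[ℂ] c) + ksign (i * j) • (X.dot b c ⊗ₜ[ℂ] a)
        + ksign (j * k) • (X.dot c a ⊗ₜ[ℂ] b), 0)
  | amn (i j k : ZMod 2) (a : X.J) (m n : X.M)
      (ha : a ∈ X.J.gr i) (hm : m ∈ X.M.gr j) (hn : n ∈ X.M.gr k) :
      Relator (-((ksign (i * (j + k)) * 2) • (X.star m n ⊗ₜ[ℂ] a)),
        X.bul a m ⊗ₜ[ℂ] n - ksign (i * j) • (m ⊗ₜ[ℂ] X.bul a n))
  | mnrs (i j k l : ZMod 2) (m n r s : X.M)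
      (hm : m ∈ X.M.gr i) (hn : n ∈ X.M.gr j) (hr : r ∈ X.M.gr k) (hs : s ∈ X.M.gr l) :
      Relator (0, X.partM m n r ⊗ₜ[ℂ] s + ksign ((i + j) * k) • (r ⊗ₜ[ℂ] X.partM m n s)
        + ksign ((i + j) * (k + l)) • (X.partM r s m ⊗ₜ[ℂ] n)
        + ksign ((k + l) * j) • (m ⊗ₜ[ℂ] X.partM r s n))

/-- The space of relations in `J ⊗ J ⊕ M ⊗ M`. -/
def relB : Submodule ℂ X.PreB := Submodule.span ℂ {t | X.Relator t}

/-- The quotient `B(J, M)` of `J ⊗ J ⊕ M ⊗ M` by the space of relations. -/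
abbrev B : Type u := X.PreB ⧸ X.relB

/-- The class `{a ⊗ b}` in `B(J, M)`. -/
def clsJ (a b : X.J) : X.B := X.relB.mkQ (a ⊗ₜ[ℂ] b, 0)

/-- The class `{m ⊗ n}` in `B(J, M)`. -/
def clsM (m n : X.M) : X.B := X.relB.mkQ (0, m ⊗ₜ[ℂ] n)

/-- The space `sl₂ ⊗ J ⊕ V ⊗ M ⊕ B(J, M)`. -/
abbrev TagSpace : Type u := (Sl2 ⊗[ℂ] X.J) × (V2 ⊗[ℂ] X.M) × X.B

/-- `x ⊗ a` in the summand `sl₂ ⊗ J`. -/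
def tagJ (x : Sl2) (a : X.J) : X.TagSpace := (x ⊗ₜ[ℂ] a, 0, 0)

/-- `v ⊗ m` in the summand `V ⊗ M`. -/
def tagM (v : V2) (m : X.M) : X.TagSpace := (0, v ⊗ₜ[ℂ] m, 0)

/-- An element of the summand `B(J, M)`. -/
def tagB (b : X.B) : X.TagSpace := (0, 0, b)

end JTernary

/-- The short `sl₂`-Lie superalgebra `g` is `TAG(X)`: the linear isomorphism `e` identifies `g`
with `sl₂ ⊗ J ⊕ V ⊗ M ⊕ B(J, M)` so that the grading is the one induced by those of `J` and `M`
(with `sl₂` and `V` even), `sl₂` acts through its adjoint module, its natural module `V` and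
trivially on the three summands, and the bracket is given by the ten formulas below. -/
structure IsTag (X : JTernary.{u}) (g : ShortSL2.{u}) (e : X.TagSpace ≃ₗ[ℂ] g.space) :
    Prop where
  gr_J : ∀ (i : ZMod 2) (x : Sl2) (a : X.J), a ∈ X.J.gr i → e (X.tagJ x a) ∈ g.space.gr i
  gr_M : ∀ (i : ZMod 2) (v : V2) (m : X.M), m ∈ X.M.gr i → e (X.tagM v m) ∈ g.space.gr i
  gr_clsJ : ∀ (i j : ZMod 2) (a b : X.J), a ∈ X.J.gr i → b ∈ X.J.gr j →
    e (X.tagB (X.clsJ a b)) ∈ g.space.gr (i + j)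
  gr_clsM : ∀ (i j : ZMod 2) (m n : X.M), m ∈ X.M.gr i → n ∈ X.M.gr j →
    e (X.tagB (X.clsM m n)) ∈ g.space.gr (i + j)
  act_J : ∀ (x y : Sl2) (a : X.J), g.act x (e (X.tagJ y a)) = e (X.tagJ ⁅x, y⁆ a)
  act_M : ∀ (x : Sl2) (v : V2) (m : X.M), g.act x (e (X.tagM v m)) = e (X.tagM (x.1 *ᵥ v) m)
  act_B : ∀ (x : Sl2) (b : X.B), g.act x (e (X.tagB b)) = 0
  br_JJ_JJ : ∀ (i j k l : ZMod 2) (a b c d : X.J),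
    a ∈ X.J.gr i → b ∈ X.J.gr j → c ∈ X.J.gr k → d ∈ X.J.gr l →
    g.br (e (X.tagB (X.clsJ a b))) (e (X.tagB (X.clsJ c d)))
      = e (X.tagB (X.clsJ (X.angleJ i j a b c) d
          + ksign ((i + j) * k) • X.clsJ c (X.angleJ i j a b d)))
  br_JJ_MM : ∀ (i j k l : ZMod 2) (a b : X.J) (m n : X.M),
    a ∈ X.J.gr i → b ∈ X.J.gr j → m ∈ X.M.gr k → n ∈ X.M.gr l →
    g.br (e (X.tagB (X.clsJ a b))) (e (X.tagB (X.clsM m n)))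
      = e (X.tagB (X.clsM (X.angleM i j a b m) n
          + ksign ((i + j) * k) • X.clsM m (X.angleM i j a b n)))
  br_MM_MM : ∀ (i j k l : ZMod 2) (m n r s : X.M),
    m ∈ X.M.gr i → n ∈ X.M.gr j → r ∈ X.M.gr k → s ∈ X.M.gr l →
    g.br (e (X.tagB (X.clsM m n))) (e (X.tagB (X.clsM r s)))
      = e (X.tagB (X.clsM (X.partM m n r) s
          + ksign ((i + j) * k) • X.clsM r (X.partM m n s)))
  br_JJ_J : ∀ (i j : ZMod 2) (a b : X.J) (x : Sl2) (c : X.J),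
    a ∈ X.J.gr i → b ∈ X.J.gr j →
    g.br (e (X.tagB (X.clsJ a b))) (e (X.tagJ x c)) = e (X.tagJ x (X.angleJ i j a b c))
  br_MM_J : ∀ (i j k : ZMod 2) (m n : X.M) (x : Sl2) (c : X.J),
    m ∈ X.M.gr i → n ∈ X.M.gr j → c ∈ X.J.gr k →
    g.br (e (X.tagB (X.clsM m n))) (e (X.tagJ x c)) = e (X.tagJ x (X.partJ i j k m n c))
  br_JJ_M : ∀ (i j : ZMod 2) (a b : X.J) (v : V2) (m : X.M),
    a ∈ X.J.gr i → b ∈ X.J.gr j →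
    g.br (e (X.tagB (X.clsJ a b))) (e (X.tagM v m)) = e (X.tagM v (X.angleM i j a b m))
  br_MM_M : ∀ (m n : X.M) (v : V2) (r : X.M),
    g.br (e (X.tagB (X.clsM m n))) (e (X.tagM v r)) = e (X.tagM v (X.partM m n r))
  br_J_J : ∀ (x y : Sl2) (a b : X.J),
    g.br (e (X.tagJ x a)) (e (X.tagJ y b))
      = e (X.tagJ ⁅x, y⁆ (X.dot a b) + (1 / 2 * kappa x y) • X.tagB (X.clsJ a b))
  br_J_M : ∀ (x : Sl2) (v : V2) (a : X.J) (m : X.M),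
    g.br (e (X.tagJ x a)) (e (X.tagM v m)) = e (X.tagM (x.1 *ᵥ v) (X.bul a m))
  br_M_M : ∀ (v w : V2) (m n : X.M),
    g.br (e (X.tagM v m)) (e (X.tagM w n))
      = e (X.tagJ (symz v w) (X.star m n) + detForm v w • X.tagB (X.clsM m n))

/-- Under the identifications `e` and `e'`, the morphism `ψ` is `TAG(φ)`: it maps
`x ⊗ a ↦ x ⊗ φ a`, `v ⊗ m ↦ v ⊗ φ m`, `{a ⊗ b} ↦ {φ a ⊗ φ b}` and `{m ⊗ n} ↦ {φ m ⊗ φ n}`. -/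
structure IsTagMap {X Y : JTernary.{u}} {g k : ShortSL2.{u}} (e : X.TagSpace ≃ₗ[ℂ] g.space)
    (e' : Y.TagSpace ≃ₗ[ℂ] k.space) (φ : JTernary.Hom X Y) (ψ : ShortSL2.Hom g k) : Prop where
  map_J : ∀ (x : Sl2) (a : X.J), ψ.lin (e (X.tagJ x a)) = e' (Y.tagJ x (φ.onJ a))
  map_M : ∀ (v : V2) (m : X.M), ψ.lin (e (X.tagM v m)) = e' (Y.tagM v (φ.onM m))
  map_clsJ : ∀ a b : X.J,
    ψ.lin (e (X.tagB (X.clsJ a b))) = e' (Y.tagB (Y.clsJ (φ.onJ a) (φ.onJ b)))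
  map_clsM : ∀ m n : X.M,
    ψ.lin (e (X.tagB (X.clsM m n))) = e' (Y.tagB (Y.clsM (φ.onM m) (φ.onM n)))

/-! ## The extended Tits functor -/

/-- The eigenspace of `h` on `g` for the eigenvalue `c`. -/
def wt (g : ShortSL2.{u}) (c : ℂ) : Submodule ℂ g.space := Module.End.eigenspace (g.act sl2H) c

/-- The `J`-ternary superalgebra `X` is `T̂(g)`: its two components are identified by `p` and `q`
with the eigenspaces of `h` of weight 2 and 1, with the gradings induced by that of `g`, and
`2 a·b = [a, fb]`, `a • m = [a, fm]`, `m ⋆ n = [m, n]`, `(m, n, r) = -[[m, fn], r]`. -/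
structure IsTits (g : ShortSL2.{u}) (X : JTernary.{u}) (p : X.J ≃ₗ[ℂ] wt g 2)
    (q : X.M ≃ₗ[ℂ] wt g 1) : Prop where
  gr_J : ∀ (i : ZMod 2) (a : X.J), a ∈ X.J.gr i ↔ (p a : g.space) ∈ g.space.gr i
  gr_M : ∀ (i : ZMod 2) (m : X.M), m ∈ X.M.gr i ↔ (q m : g.space) ∈ g.space.gr i
  dot_eq : ∀ a b : X.J,
    (2 : ℂ) • (p (X.dot a b) : g.space) = g.br (p a) (g.act sl2F (p b))
  bul_eq : ∀ (a : X.J) (m : X.M), (q (X.bul a m) : g.space) = g.br (p a) (g.act sl2F (q m))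
  star_eq : ∀ m n : X.M, (p (X.star m n) : g.space) = g.br (q m) (q n)
  tri_eq : ∀ m n r : X.M,
    (q (X.tri m n r) : g.space) = -g.br (g.br (q m) (g.act sl2F (q n))) (q r)

/-- Under the identifications with eigenspaces, the morphism `ψ` is `T̂(φ)`, the pair of
restrictions of `φ` to the eigenspaces of weight 2 and 1. -/
structure IsTitsMap {g k : ShortSL2.{u}} {X Y : JTernary.{u}}
    (p : X.J ≃ₗ[ℂ] wt g 2) (q : X.M ≃ₗ[ℂ] wt g 1)
    (p' : Y.J ≃ₗ[ℂ] wt k 2) (q' : Y.M ≃ₗ[ℂ] wt k 1)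
    (φ : ShortSL2.Hom g k) (ψ : JTernary.Hom X Y) : Prop where
  map_J : ∀ a : X.J, (p' (ψ.onJ a) : k.space) = φ.lin (p a)
  map_M : ∀ m : X.M, (q' (ψ.onM m) : k.space) = φ.lin (q m)

/-- The morphism `φ : TAG(T̂(g)) → g` is the canonical one, which maps
`e ⊗ a ↦ a`, `e₁ ⊗ m ↦ m`, `{a ⊗ b} ↦ [fa, fb] / 4` and
`{m ⊗ n} ↦ ([m, fn] - [fm, n]) / 2`. Here `k` stands for `TAG(T̂(g))` and `X` for `T̂(g)`. -/
structure IsCanonical {g k : ShortSL2.{u}} {X : JTernary.{u}} (e : X.TagSpace ≃ₗ[ℂ] k.space)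
    (p : X.J ≃ₗ[ℂ] wt g 2) (q : X.M ≃ₗ[ℂ] wt g 1) (φ : ShortSL2.Hom k g) : Prop where
  map_J : ∀ a : X.J, φ.lin (e (X.tagJ sl2E a)) = p a
  map_M : ∀ m : X.M, φ.lin (e (X.tagM v1 m)) = q m
  map_clsJ : ∀ a b : X.J, φ.lin (e (X.tagB (X.clsJ a b)))
    = (1 / 4 : ℂ) • g.br (g.act sl2F (p a)) (g.act sl2F (p b))
  map_clsM : ∀ m n : X.M, φ.lin (e (X.tagB (X.clsM m n)))
    = (1 / 2 : ℂ) • (g.br (q m) (g.act sl2F (q n)) - g.br (g.act sl2F (q m)) (q n))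

end SuperTAG

end

open SuperTAG

/-! The space `B(J, M)` is the universal home for the `sl₂`-invariant part of a bracket of two
elements of `sl₂ ⊗ J` or of `V ⊗ M`: its relations are relations that these invariant parts satisfy
in every short `sl₂`-Lie superalgebra. Both functors and the adjunction grow out of this remark.

For `TAG`, the decisive fact is that `⟨a, b⟩` and `∂_{m,n}` are superderivations of all the
operations of `(J, M)` (`isDer_angle`, `isDer_part`). The relations of `B(J, M)` act by zero on `J`
and `M` (`preJ_relator`, `preM_relator`), so `B(J, M)` acts by superderivations. A superderivation,
extended to tensors by the Leibniz rule, preserves the relations (`actPre_relator`), so it also acts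
on `B(J, M)`; this is the bracket `brB`. Its antisymmetry follows from the relations (`cJ_angle`,
`cJ_part`, `cM_part`), and its Jacobi identity from the action being compatible with brackets
(`delJ_brB`, `delM_brB`). On `TAG(J, M)` the Jacobi identity is multilinear and stable under
permutations, so ten types of triples of generators suffice. The six types that involve `B(J, M)`
restate the previous facts; the other four combine the axioms with identities for `sl₂` and `V`:
double brackets expressed by `κ`, the formula `xy + yx = ¼ κ(x, y)` on `V`, and Cramer's rule.

For `T̂`, the action of `h` on a short algebra is annihilated by `t(t² - 1)(t² - 4)` (`opH_five`),
so every vector of a weight other than 0, ±1, ±2 vanishes. Hence `[J, J] = [J, M] = 0`, `f³ = 0` on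
`J`, `f² = 0` on `M`, and all brackets between the strings through `J` and `M` are expressed by the
operations and by the invariant elements `oJ` and `oM`. The ternary axioms become instances of the
super Jacobi identity. The main relations between the invariant elements (`oJ_cyclic`, `oM_bul`)
come from splitting a Jacobi identity of weight 0 into its part in `f J` and its invariant part,
which are independent because `ef = 2` on `J`. Bracketing `oJ_cyclic` with a fourth vector yields
the Jordan identity (`isJordanSuper_of_cyclic`).

The same relations make the counit well defined on `B(J, M)`. It preserves all brackets as soon as
it does so away from pairs in `B(J, M)`, since a class is itself a bracket of generators up to an
element of `sl₂ ⊗ J` (`map_tagBr`). The unit is `a ↦ e ⊗ a`, `m ↦ e₁ ⊗ m`, and the triangle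
identities hold on generators. -/

set_option linter.unusedSimpArgs false

namespace SuperTAG

/-! ## Signs -/

theorem zmod2_cases (i : ZMod 2) : i = 0 ∨ i = 1 := by
  revert i; decide

theorem zmod2_one_add_one : (1 : ZMod 2) + 1 = 0 := by decide

theorem ksign_zero : ksign 0 = 1 := by simp [ksign]

theorem ksign_one : ksign 1 = -1 := by simp [ksign, ZMod.val_one]

theorem ksign_add (i j : ZMod 2) : ksign (i + j) = ksign i * ksign j := by
  rcases zmod2_cases i with rfl | rfl <;> rcases zmod2_cases j with rfl | rfl <;>
    simp [zmod2_one_add_one, ksign_zero, ksign_one]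

theorem ksign_mul_self (i : ZMod 2) : ksign i * ksign i = 1 := by
  rcases zmod2_cases i with rfl | rfl <;> simp [ksign_zero, ksign_one]

theorem ksign_smul_smul {W : Type*} [AddCommGroup W] [Module ℂ W] (i : ZMod 2) (x : W) :
    ksign i • ksign i • x = x := by
  rw [smul_smul, ksign_mul_self, one_smul]

/-! ## Gradings defined by an involution -/

section Involution

variable {W : Type*} [AddCommGroup W] [Module ℂ W]

/-- The part of parity `i` of the grading defined by an involution `s`. -/
def grOf (s : W →ₗ[ℂ] W) (i : ZMod 2) : Submodule ℂ W := LinearMap.ker (s - ksign i • LinearMap.id)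

theorem mem_grOf {s : W →ₗ[ℂ] W} {i : ZMod 2} {x : W} : x ∈ grOf s i ↔ s x = ksign i • x := by
  simp [grOf, sub_eq_zero]

/-- The projection to the part of parity `i`. -/
noncomputable def prOf (s : W →ₗ[ℂ] W) (i : ZMod 2) : W →ₗ[ℂ] W :=
  (1 / 2 : ℂ) • (LinearMap.id + ksign i • s)

theorem prOf_apply (s : W →ₗ[ℂ] W) (i : ZMod 2) (x : W) :
    prOf s i x = (1 / 2 : ℂ) • (x + ksign i • s x) := rfl

theorem prOf_add (s : W →ₗ[ℂ] W) (x : W) : prOf s 0 x + prOf s 1 x = x := by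
  simp only [prOf_apply, ksign_zero, ksign_one]; module

theorem prOf_mem {s : W →ₗ[ℂ] W} (hs : ∀ x, s (s x) = x) (i : ZMod 2) (x : W) :
    prOf s i x ∈ grOf s i := by
  rw [mem_grOf, prOf_apply, map_smul, map_add, map_smul, hs, smul_comm, smul_add (ksign i),
    ksign_smul_smul, add_comm]

theorem prOf_of_mem {s : W →ₗ[ℂ] W} {i : ZMod 2} {x : W} (hx : x ∈ grOf s i) :
    prOf s i x = x := by
  rw [mem_grOf] at hx
  rw [prOf_apply, hx, ksign_smul_smul]; module

theorem prOf_of_mem_ne {s : W →ₗ[ℂ] W} {i j : ZMod 2} {x : W} (hx : x ∈ grOf s i) (h : j ≠ i) :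
    prOf s j x = 0 := by
  rw [mem_grOf] at hx
  rw [prOf_apply, hx]
  rcases zmod2_cases i with rfl | rfl <;> rcases zmod2_cases j with rfl | rfl <;>
    simp_all [ksign_zero, ksign_one]

/-- The two projections `½(1 ± s)` split the space into eigenspaces. Gradings are given in this form
below because an involution passes easily to tensor products, weight spaces and quotients. -/
theorem isInternal_grOf {s : W →ₗ[ℂ] W} (hs : ∀ x, s (s x) = x) :
    DirectSum.IsInternal (grOf s) := by
  rw [DirectSum.isInternal_submodule_iff_isCompl (grOf s) (i := 0) (j := 1) (by decide)
    (by ext i; simpa using zmod2_cases i)]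
  constructor
  · rw [Submodule.disjoint_def]
    intro x h0 h1
    rw [← prOf_of_mem h1, prOf_of_mem_ne h0 (by decide)]
  · rw [codisjoint_iff, Submodule.eq_top_iff']
    intro x
    rw [← prOf_add s x]
    exact Submodule.add_mem_sup (prOf_mem hs 0 x) (prOf_mem hs 1 x)

end Involution

/-! ## Parity involution and projections of a super vector space -/

namespace SuperSpace

variable (W : SuperSpace.{u})

theorem isCompl_gr : IsCompl (W.gr 0) (W.gr 1) :=
  (DirectSum.isInternal_submodule_iff_isCompl W.gr (i := 0) (j := 1) (by decide)
    (by ext i; simpa using zmod2_cases i)).1 W.isInternal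

/-- The parity involution of a super vector space. -/
noncomputable def par : W →ₗ[ℂ] W :=
  (W.gr 0).subtype ∘ₗ (W.gr 0).projectionOnto (W.gr 1) W.isCompl_gr
    - (W.gr 1).subtype ∘ₗ (W.gr 1).projectionOnto (W.gr 0) W.isCompl_gr.symm

variable {W}

theorem par_of_mem {i : ZMod 2} {x : W} (hx : x ∈ W.gr i) : W.par x = ksign i • x := by
  rcases zmod2_cases i with rfl | rfl
  · have h := Submodule.projectionOnto_apply_left W.isCompl_gr ⟨x, hx⟩
    have h' := Submodule.projectionOnto_apply_of_mem_right W.isCompl_gr.symm hx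
    simp_all [par, ksign_zero]
  · have h := Submodule.projectionOnto_apply_left W.isCompl_gr.symm ⟨x, hx⟩
    have h' := Submodule.projectionOnto_apply_of_mem_right W.isCompl_gr hx
    simp_all [par, ksign_one]

theorem exists_decomp (x : W) : ∃ y ∈ W.gr 0, ∃ z ∈ W.gr 1, y + z = x :=
  Submodule.mem_sup.1 (W.isCompl_gr.sup_eq_top ▸ Submodule.mem_top)

theorem par_par (x : W) : W.par (W.par x) = x := by
  obtain ⟨y, hy, z, hz, rfl⟩ := exists_decomp x
  simp [par_of_mem hy, par_of_mem hz, ksign_zero, ksign_one]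

/-- Every super grading comes from its parity involution, so homogeneity can always be read as an
eigenvector equation. -/
theorem gr_eq_grOf : W.gr = grOf W.par := by
  funext i
  ext x
  rw [mem_grOf]
  refine ⟨par_of_mem, fun h => ?_⟩
  obtain ⟨y, hy, z, hz, rfl⟩ := exists_decomp x
  rw [map_add, par_of_mem hy, par_of_mem hz] at h
  rcases zmod2_cases i with rfl | rfl
  · have hz0 : z = 0 := by
      simp only [ksign_zero, ksign_one] at h
      have h2 : (2 : ℂ) • z = 0 := by linear_combination (norm := module) -h
      simpa using h2
    simpa [hz0] using hy
  · have hy0 : y = 0 := by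
      simp only [ksign_zero, ksign_one] at h
      have h2 : (2 : ℂ) • y = 0 := by linear_combination (norm := module) h
      simpa using h2
    simpa [hy0] using hz

theorem mem_gr_iff {i : ZMod 2} {x : W} : x ∈ W.gr i ↔ W.par x = ksign i • x := by
  rw [gr_eq_grOf, mem_grOf]

variable (W)

/-- The projection of a super vector space to its part of parity `i`. -/
noncomputable def proj (i : ZMod 2) : W →ₗ[ℂ] W := prOf W.par i

/-- The linear map that multiplies elements of parity `i` by `(-1)^(p i)`. -/
noncomputable def sgn (p : ZMod 2) : W →ₗ[ℂ] W := W.proj 0 + ksign p • W.proj 1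

variable {W}

theorem proj_mem (i : ZMod 2) (x : W) : W.proj i x ∈ W.gr i := by
  rw [gr_eq_grOf]; exact prOf_mem par_par i x

theorem proj_of_mem {i : ZMod 2} {x : W} (hx : x ∈ W.gr i) : W.proj i x = x :=
  prOf_of_mem (gr_eq_grOf (W := W) ▸ hx)

theorem proj_of_mem_ne {i j : ZMod 2} {x : W} (hx : x ∈ W.gr i) (h : j ≠ i) : W.proj j x = 0 :=
  prOf_of_mem_ne (gr_eq_grOf (W := W) ▸ hx) h

theorem proj_add (x : W) : W.proj 0 x + W.proj 1 x = x := prOf_add W.par x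

/-- This realizes the sign rule by a linear operator: formulas whose signs depend on the parity of
an argument, such as `∂_{m,n}(a)` or the super Leibniz rule, become linear in that argument. -/
theorem sgn_of_mem {p i : ZMod 2} {x : W} (hx : x ∈ W.gr i) : W.sgn p x = ksign (p * i) • x := by
  rcases zmod2_cases i with rfl | rfl
  · simp [sgn, proj_of_mem hx, proj_of_mem_ne hx (j := 1) (by decide), ksign_zero]
  · simp [sgn, proj_of_mem hx, proj_of_mem_ne hx (j := 0) (by decide)]

theorem hom_ext {Z : Type*} [AddCommGroup Z] [Module ℂ Z] {f g : W →ₗ[ℂ] Z}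
    (h : ∀ i, ∀ x ∈ W.gr i, f x = g x) : f = g := by
  ext x
  rw [← proj_add x, map_add, map_add, h _ _ (proj_mem 0 x), h _ _ (proj_mem 1 x)]

end SuperSpace

/-! ## Gluing bilinear maps along parities -/

section Glue

variable {U W : SuperSpace.{u}} {Z : Type*} [AddCommGroup Z] [Module ℂ Z]

/-- The bilinear map that agrees with `f i j` on elements of parities `i` and `j`. -/
noncomputable def glue (f : ZMod 2 → ZMod 2 → U →ₗ[ℂ] W →ₗ[ℂ] Z) : U →ₗ[ℂ] W →ₗ[ℂ] Z :=
  (f 0 0).compl₁₂ (U.proj 0) (W.proj 0) + (f 0 1).compl₁₂ (U.proj 0) (W.proj 1)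
    + (f 1 0).compl₁₂ (U.proj 1) (W.proj 0) + (f 1 1).compl₁₂ (U.proj 1) (W.proj 1)

theorem glue_apply (f : ZMod 2 → ZMod 2 → U →ₗ[ℂ] W →ₗ[ℂ] Z) {i j : ZMod 2} {x : U} {y : W}
    (hx : x ∈ U.gr i) (hy : y ∈ W.gr j) : glue f x y = f i j x y := by
  rcases zmod2_cases i with rfl | rfl <;> rcases zmod2_cases j with rfl | rfl <;>
    simp [glue, SuperSpace.proj_of_mem hx, SuperSpace.proj_of_mem hy,
      SuperSpace.proj_of_mem_ne hx (j := 0), SuperSpace.proj_of_mem_ne hx (j := 1),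
      SuperSpace.proj_of_mem_ne hy (j := 0), SuperSpace.proj_of_mem_ne hy (j := 1)]

theorem bilin_ext {f g : U →ₗ[ℂ] W →ₗ[ℂ] Z}
    (h : ∀ i j, ∀ x ∈ U.gr i, ∀ y ∈ W.gr j, f x y = g x y) : f = g :=
  SuperSpace.hom_ext fun i x hx => SuperSpace.hom_ext fun j y hy => h i j x hx y hy

end Glue

namespace JTernary

variable {X : JTernary.{u}}

/-! ## The operators `⟨a, b⟩` and `∂_{m,n}` as linear maps -/

/-- The map `(a, b) ↦ T a T b - s T b T a` for a family of operators `T`. -/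
noncomputable def opComm {A W : Type*} [AddCommGroup A] [Module ℂ A] [AddCommGroup W] [Module ℂ W]
    (s : ℂ) (T : A →ₗ[ℂ] Module.End ℂ W) : A →ₗ[ℂ] A →ₗ[ℂ] Module.End ℂ W :=
  (LinearMap.mul ℂ (Module.End ℂ W)).compl₁₂ T T
    - s • ((LinearMap.mul ℂ (Module.End ℂ W)).compl₁₂ T T).flip

variable (X)

/-- The operator `⟨a, b⟩` on `J` for `a`, `b` of parity `i`, `j`. -/
noncomputable def angJ (i j : ZMod 2) : X.J →ₗ[ℂ] X.J →ₗ[ℂ] Module.End ℂ X.J :=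
  opComm (ksign (i * j)) X.dot

/-- The operator `⟨a, b⟩` on `M` for `a`, `b` of parity `i`, `j`. -/
noncomputable def angM (i j : ZMod 2) : X.J →ₗ[ℂ] X.J →ₗ[ℂ] Module.End ℂ X.M :=
  (1 / 4 : ℂ) • opComm (ksign (i * j)) X.bul

/-- The operator `∂_{m,n}` on `J` for `m`, `n` of parity `i`, `j`. -/
noncomputable def parJ (i j : ZMod 2) : X.M →ₗ[ℂ] X.M →ₗ[ℂ] Module.End ℂ X.J :=
  LinearMap.mk₂ ℂ (fun m n => (1 / 2 : ℂ) •
      (X.star.flip n ∘ₗ X.bul.flip m ∘ₗ X.J.sgn (i + j) - X.star m ∘ₗ X.bul.flip n ∘ₗ X.J.sgn j))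
    (fun m m' n => by ext; simp; module) (fun s m n => by ext; simp; module)
    (fun m n n' => by ext; simp; module) (fun s m n => by ext; simp; module)

/-- The operator `∂_{m,n}` on `M`. -/
noncomputable def parM : X.M →ₗ[ℂ] X.M →ₗ[ℂ] Module.End ℂ X.M :=
  LinearMap.mk₂ ℂ (fun m n => (1 / 2 : ℂ) • X.bul (X.star m n) - X.tri m n)
    (fun m m' n => by ext; simp; module) (fun s m n => by ext; simp; module)
    (fun m n n' => by ext; simp; module) (fun s m n => by ext; simp; module)

variable {X}

theorem angJ_apply (i j : ZMod 2) (a b c : X.J) : X.angJ i j a b c = X.angleJ i j a b c := rfl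

theorem angM_apply (i j : ZMod 2) (a b : X.J) (m : X.M) :
    X.angM i j a b m = X.angleM i j a b m := rfl

theorem parM_apply (m n r : X.M) : X.parM m n r = X.partM m n r := rfl

theorem parJ_apply (i j : ZMod 2) {k : ZMod 2} (m n : X.M) {a : X.J} (ha : a ∈ X.J.gr k) :
    X.parJ i j m n a = X.partJ i j k m n a := by
  simp only [parJ, partJ, LinearMap.mk₂_apply, LinearMap.smul_apply, LinearMap.sub_apply,
    LinearMap.comp_apply, SuperSpace.sgn_of_mem ha, map_smul, LinearMap.flip_apply, mul_comm k]

/-! ## Parities of the operations -/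

theorem dot_mem {i j k : ZMod 2} {a b : X.J} (ha : a ∈ X.J.gr i) (hb : b ∈ X.J.gr j)
    (h : i + j = k := by ring) : X.dot a b ∈ X.J.gr k :=
  h ▸ X.isJordan.dot_mem _ _ _ _ ha hb

theorem bul_mem {i j k : ZMod 2} {a : X.J} {m : X.M} (ha : a ∈ X.J.gr i) (hm : m ∈ X.M.gr j)
    (h : i + j = k := by ring) : X.bul a m ∈ X.M.gr k :=
  h ▸ X.isSpecial.bul_mem _ _ _ _ ha hm

theorem star_mem {i j k : ZMod 2} {m n : X.M} (hm : m ∈ X.M.gr i) (hn : n ∈ X.M.gr j)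
    (h : i + j = k := by ring) : X.star m n ∈ X.J.gr k :=
  h ▸ X.isTernary.star_mem _ _ _ _ hm hn

theorem tri_mem {i j k l : ZMod 2} {m n r : X.M} (hm : m ∈ X.M.gr i) (hn : n ∈ X.M.gr j)
    (hr : r ∈ X.M.gr k) (h : i + j + k = l := by ring) : X.tri m n r ∈ X.M.gr l :=
  h ▸ X.isTernary.tri_mem _ _ _ _ _ _ hm hn hr

theorem angleJ_mem {i j k : ZMod 2} {a b c : X.J} (ha : a ∈ X.J.gr i) (hb : b ∈ X.J.gr j)
    (hc : c ∈ X.J.gr k) : X.angleJ i j a b c ∈ X.J.gr (i + j + k) :=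
  sub_mem (dot_mem ha (dot_mem hb hc rfl))
    (Submodule.smul_mem _ _ (dot_mem hb (dot_mem ha hc rfl)))

theorem angleM_mem {i j k : ZMod 2} {a b : X.J} {m : X.M} (ha : a ∈ X.J.gr i) (hb : b ∈ X.J.gr j)
    (hm : m ∈ X.M.gr k) : X.angleM i j a b m ∈ X.M.gr (i + j + k) :=
  Submodule.smul_mem _ _ (sub_mem (bul_mem ha (bul_mem hb hm rfl))
    (Submodule.smul_mem _ _ (bul_mem hb (bul_mem ha hm rfl))))

theorem partJ_mem {i j k : ZMod 2} {m n : X.M} {a : X.J} (hm : m ∈ X.M.gr i) (hn : n ∈ X.M.gr j)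
    (ha : a ∈ X.J.gr k) : X.partJ i j k m n a ∈ X.J.gr (i + j + k) :=
  Submodule.smul_mem _ _ (sub_mem (Submodule.smul_mem _ _ (star_mem (bul_mem ha hm rfl) hn))
    (Submodule.smul_mem _ _ (star_mem hm (bul_mem ha hn rfl))))

theorem partM_mem {i j k : ZMod 2} {m n r : X.M} (hm : m ∈ X.M.gr i) (hn : n ∈ X.M.gr j)
    (hr : r ∈ X.M.gr k) : X.partM m n r ∈ X.M.gr (i + j + k) :=
  sub_mem (Submodule.smul_mem _ _ (bul_mem (star_mem hm hn rfl) hr)) (tri_mem hm hn hr)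

/-! ## The axioms with implicit parities -/

theorem dot_comm {i j : ZMod 2} {a b : X.J} (ha : a ∈ X.J.gr i) (hb : b ∈ X.J.gr j) :
    X.dot a b = ksign (i * j) • X.dot b a :=
  X.isJordan.dot_comm _ _ _ _ ha hb

theorem bul_dot {i j : ZMod 2} {a b : X.J} (ha : a ∈ X.J.gr i) (hb : b ∈ X.J.gr j) (m : X.M) :
    X.bul (X.dot a b) m
      = (1 / 2 : ℂ) • (X.bul a (X.bul b m) + ksign (i * j) • X.bul b (X.bul a m)) := by
  rw [X.isSpecial.bul_dot _ _ _ _ ha hb]; rfl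

theorem star_comm {i j : ZMod 2} {m n : X.M} (hm : m ∈ X.M.gr i) (hn : n ∈ X.M.gr j) :
    X.star m n = -(ksign (i * j) • X.star n m) :=
  X.isTernary.star_anticomm _ _ _ _ hm hn

theorem dot_star {i j k : ZMod 2} {a : X.J} {m n : X.M} (ha : a ∈ X.J.gr i) (hm : m ∈ X.M.gr j)
    (hn : n ∈ X.M.gr k) : X.dot a (X.star m n)
      = (1 / 2 : ℂ) • (X.star (X.bul a m) n + ksign (i * j) • X.star m (X.bul a n)) :=
  X.isTernary.sjt1 _ _ _ _ _ _ ha hm hn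

theorem bul_tri {i j k l : ZMod 2} {a : X.J} {m n s : X.M} (ha : a ∈ X.J.gr i)
    (hm : m ∈ X.M.gr j) (hn : n ∈ X.M.gr k) (hs : s ∈ X.M.gr l) : X.bul a (X.tri m n s)
      = X.tri (X.bul a m) n s - ksign (i * j) • X.tri m (X.bul a n) s
        + ksign (i * (j + k)) • X.tri m n (X.bul a s) :=
  X.isTernary.sjt2 _ _ _ _ _ _ _ _ ha hm hn hs

theorem tri_swap {i j k : ZMod 2} {m n s : X.M} (hm : m ∈ X.M.gr i) (hn : n ∈ X.M.gr j)
    (hs : s ∈ X.M.gr k) : X.tri m n s = ksign (i * j) • X.tri n m s + X.bul (X.star m n) s :=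
  X.isTernary.sjt4 _ _ _ _ _ _ hm hn hs

/-- Turns a right-nested product into the left-nested form in which the Jordan identity is stated.
-/
theorem dot_dot_comm {i j k : ZMod 2} {a b c : X.J}
    (ha : a ∈ X.J.gr i) (hb : b ∈ X.J.gr j) (hc : c ∈ X.J.gr k) :
    X.dot a (X.dot b c) = ksign (i * j + i * k + j * k) • X.dot (X.dot c b) a := by
  rw [dot_comm ha (dot_mem hb hc rfl), dot_comm hb hc, map_smul, LinearMap.smul_apply, smul_smul,
    ← ksign_add]
  ring_nf

/-! ## Superderivations of a `J`-ternary superalgebra -/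

/-- `(dJ, dM)` is a superderivation of parity `p` of all the operations of `X`. -/
structure IsDer (p : ZMod 2) (dJ : Module.End ℂ X.J) (dM : Module.End ℂ X.M) : Prop where
  memJ : ∀ {i : ZMod 2} {a : X.J}, a ∈ X.J.gr i → dJ a ∈ X.J.gr (p + i)
  memM : ∀ {i : ZMod 2} {m : X.M}, m ∈ X.M.gr i → dM m ∈ X.M.gr (p + i)
  dot : ∀ {i j : ZMod 2} {a b : X.J}, a ∈ X.J.gr i → b ∈ X.J.gr j →
    dJ (X.dot a b) = X.dot (dJ a) b + ksign (p * i) • X.dot a (dJ b)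
  bul : ∀ {i j : ZMod 2} {a : X.J} {m : X.M}, a ∈ X.J.gr i → m ∈ X.M.gr j →
    dM (X.bul a m) = X.bul (dJ a) m + ksign (p * i) • X.bul a (dM m)
  star : ∀ {i j : ZMod 2} {m n : X.M}, m ∈ X.M.gr i → n ∈ X.M.gr j →
    dJ (X.star m n) = X.star (dM m) n + ksign (p * i) • X.star m (dM n)
  tri : ∀ {i j k : ZMod 2} {m n r : X.M}, m ∈ X.M.gr i → n ∈ X.M.gr j → r ∈ X.M.gr k →
    dM (X.tri m n r) = X.tri (dM m) n r + ksign (p * i) • X.tri m (dM n) r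
      + ksign (p * (i + j)) • X.tri m n (dM r)

/-- The classical fact that commutators of multiplications of a Jordan algebra are derivations. The
linearized identity has a left side symmetric in its arguments, so exchanging `a` and `b` and
subtracting leaves only nested products, which are the terms of the Leibniz rule. -/
theorem angleJ_dot {i j k l : ZMod 2} {a b c d : X.J}
    (ha : a ∈ X.J.gr i) (hb : b ∈ X.J.gr j) (hc : c ∈ X.J.gr k) (hd : d ∈ X.J.gr l) :
    X.angleJ i j a b (X.dot c d)
      = X.dot (X.angleJ i j a b c) d + ksign ((i + j) * k) • X.dot c (X.angleJ i j a b d) := by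
  have h1 := X.isJordan.jordan k l j i c d b a hc hd hb ha
  have h2 := X.isJordan.jordan k l i j c d a b hc hd ha hb
  have h3 := congrArg (X.dot (X.dot c d)) (dot_comm ha hb)
  have e1 := dot_dot_comm ha hb (dot_mem hc hd rfl)
  have e2 := dot_dot_comm hb ha (dot_mem hc hd rfl)
  have e3 := congrArg (fun x => X.dot x d) (dot_dot_comm ha hb hc)
  have e4 := congrArg (fun x => X.dot x d) (dot_dot_comm hb ha hc)
  have e5 := dot_comm hc (dot_mem ha (dot_mem hb hd rfl) rfl)
  have e6 := dot_comm hc (dot_mem hb (dot_mem ha hd rfl) rfl)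
  have e7 := congrArg (fun x => X.dot x c) (dot_dot_comm ha hb hd)
  have e8 := congrArg (fun x => X.dot x c) (dot_dot_comm hb ha hd)
  linear_combination (norm := skip) e1 - ksign (i * j) • e2 - e3 + ksign (i * j) • e4
    - ksign ((i + j) * k) • (e5 - ksign (i * j) • e6)
    - ksign (k * l) • e7 + ksign (k * l) • ksign (i * j) • e8
    - ksign (k * j + k * i + l * j + l * i + j * i) • h1
    + ksign (k * j + k * i + l * j + l * i) • (h2 - h3)
  simp only [angleJ, map_sub, map_add, map_neg, map_smul, LinearMap.sub_apply, LinearMap.add_apply,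
    LinearMap.neg_apply, LinearMap.smul_apply, smul_sub, smul_add, smul_neg]
  -- After expansion into monomials, comparing coefficients leaves identities between signs, which
  -- are checked for every choice of parities. The same method ends most of the computations below.
  match_scalars
  all_goals
    rcases zmod2_cases i with h_i | h_i <;> rcases zmod2_cases j with h_j | h_j <;>
    rcases zmod2_cases k with h_k | h_k <;> rcases zmod2_cases l with h_l | h_l <;>
    (try simp only [h_i, h_j, h_k, h_l, mul_zero, zero_mul, mul_one, add_zero,
      zero_add, ksign_zero, ksign_one, zmod2_one_add_one]) <;> norm_num

/-- Let `a` act by multiplication on `J` and by `½ a•` on `M`. By axiom 1 this is a superderivation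
of `⋆`, and by axiom 2 it acts on the triple product with sign pattern `+, -, +`. A supercommutator
of two such actions is a superderivation of both, since the minus sign squares away. The two halves
account for the factor `¼` on `M`; it also fits `•`, because in a special supermodule the commutator
of multiplications applied to `c` acts as one quarter of a double commutator. -/
theorem isDer_angle {i j : ZMod 2} {a b : X.J} (ha : a ∈ X.J.gr i) (hb : b ∈ X.J.gr j) :
    IsDer (i + j) (X.angJ i j a b) (X.angM i j a b) where
  memJ hc := angleJ_mem ha hb hc
  memM hm := angleM_mem ha hb hm
  dot hc hd := angleJ_dot ha hb hc hd
  bul {k l c m} hc hm := by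
    simp only [angJ_apply, angM_apply, angleJ, angleM, map_sub, map_add, map_neg, map_smul,
        LinearMap.sub_apply, LinearMap.add_apply,
    LinearMap.neg_apply, LinearMap.smul_apply, smul_sub, smul_add, smul_neg,
      bul_dot ha (dot_mem hb hc rfl), bul_dot hb (dot_mem ha hc rfl), bul_dot hb hc, bul_dot ha hc]
    match_scalars
    all_goals
    rcases zmod2_cases i with h_i | h_i <;> rcases zmod2_cases j with h_j | h_j <;>
    rcases zmod2_cases k with h_k | h_k <;>
    (try simp only [h_i, h_j, h_k, mul_zero, zero_mul, mul_one, add_zero,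
      zero_add, ksign_zero, ksign_one, zmod2_one_add_one]) <;> norm_num
  star {k l m n} hm hn := by
    simp only [angJ_apply, angM_apply, angleJ, angleM, map_sub, map_add, map_neg, map_smul,
        LinearMap.sub_apply, LinearMap.add_apply,
    LinearMap.neg_apply, LinearMap.smul_apply, smul_sub, smul_add, smul_neg, dot_star hb hm hn, dot_star ha hm hn,
      dot_star ha (bul_mem hb hm rfl) hn, dot_star ha hm (bul_mem hb hn rfl),
      dot_star hb (bul_mem ha hm rfl) hn, dot_star hb hm (bul_mem ha hn rfl)]
    match_scalars
    all_goals
    rcases zmod2_cases i with h_i | h_i <;> rcases zmod2_cases j with h_j | h_j <;>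
    rcases zmod2_cases k with h_k | h_k <;>
    (try simp only [h_i, h_j, h_k, mul_zero, zero_mul, mul_one, add_zero,
      zero_add, ksign_zero, ksign_one, zmod2_one_add_one]) <;> norm_num
  tri {k l q m n r} hm hn hr := by
    simp only [angM_apply, angleM, map_sub, map_add, map_neg, map_smul, LinearMap.sub_apply,
        LinearMap.add_apply,
    LinearMap.neg_apply, LinearMap.smul_apply, smul_sub, smul_add, smul_neg, bul_tri hb hm hn hr, bul_tri ha hm hn hr,
      bul_tri ha (bul_mem hb hm rfl) hn hr, bul_tri ha hm (bul_mem hb hn rfl) hr,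
      bul_tri ha hm hn (bul_mem hb hr rfl), bul_tri hb (bul_mem ha hm rfl) hn hr,
      bul_tri hb hm (bul_mem ha hn rfl) hr, bul_tri hb hm hn (bul_mem ha hr rfl)]
    match_scalars
    all_goals
    rcases zmod2_cases i with h_i | h_i <;> rcases zmod2_cases j with h_j | h_j <;>
    rcases zmod2_cases k with h_k | h_k <;> rcases zmod2_cases l with h_l | h_l <;>
    (try simp only [h_i, h_j, h_k, h_l, mul_zero, zero_mul, mul_one, add_zero,
      zero_add, ksign_zero, ksign_one, zmod2_one_add_one]) <;> norm_num

/-- By axiom 4, `∂_{m,n}` is minus half the supersymmetrization of the triple product in its first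
two slots. Symmetrizing axiom 2 in `m` and `n`, the terms where `a` hits `m` or `n` occur as
differences of two triple products, which axiom 4 turns into `⋆`; they add up to `∂_{m,n}(a)`. -/
theorem partM_bul {i j k l : ZMod 2} {m n r : X.M} {a : X.J} (hm : m ∈ X.M.gr i)
    (hn : n ∈ X.M.gr j) (ha : a ∈ X.J.gr k) (hr : r ∈ X.M.gr l) :
    X.partM m n (X.bul a r)
      = X.bul (X.partJ i j k m n a) r + ksign ((i + j) * k) • X.bul a (X.partM m n r) := by
  have h1 := bul_tri ha hm hn hr
  have h2 := bul_tri ha hn hm hr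
  have h3 := congrArg (X.bul a) (tri_swap hm hn hr)
  have h4 := tri_swap hm hn (bul_mem ha hr rfl)
  have h5 := tri_swap (bul_mem ha hm rfl) hn hr
  have h6 := tri_swap hm (bul_mem ha hn rfl) hr
  linear_combination (norm := skip) (1 / 2 : ℂ) • (ksign (k * (i + j)) • h1
    + ksign (k * (i + j) + i * j) • h2 + ksign (k * (i + j)) • h3 - h4
    + ksign (k * (i + j)) • h5 - ksign (k * j) • h6)
  simp only [partM, partJ, map_sub, map_add, map_neg, map_smul, LinearMap.sub_apply,
      LinearMap.add_apply,
    LinearMap.neg_apply, LinearMap.smul_apply, smul_sub, smul_add, smul_neg]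
  match_scalars
  all_goals
    rcases zmod2_cases i with h_i | h_i <;> rcases zmod2_cases j with h_j | h_j <;>
    rcases zmod2_cases k with h_k | h_k <;>
    (try simp only [h_i, h_j, h_k, mul_zero, zero_mul, mul_one, add_zero,
      zero_add, ksign_zero, ksign_one, zmod2_one_add_one]) <;> norm_num

/-- Compatibility with `•` is the preceding symmetrization of axiom 2. Compatibility with the Jordan
product and with `⋆` comes from axiom 1, aided by the special supermodule law and by axiom 5
respectively. Compatibility with the triple product is axiom 6, corrected by axiom 2 for `m ⋆ n`. -/
theorem isDer_part {i j : ZMod 2} {m n : X.M} (hm : m ∈ X.M.gr i) (hn : n ∈ X.M.gr j) :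
    IsDer (i + j) (X.parJ i j m n) (X.parM m n) where
  memJ ha := parJ_apply i j m n ha ▸ partJ_mem hm hn ha
  memM hr := partM_mem hm hn hr
  dot {k l a b} ha hb := by
    have h1 : X.dot (X.star (X.bul a m) n) b
        = ksign ((k + i + j) * l) • X.dot b (X.star (X.bul a m) n) :=
      dot_comm (star_mem (bul_mem ha hm rfl) hn) hb
    have h2 : X.dot (X.star m (X.bul a n)) b
        = ksign ((k + i + j) * l) • X.dot b (X.star m (X.bul a n)) :=
      dot_comm (star_mem hm (bul_mem ha hn rfl)) hb
    simp only [parJ_apply i j m n (dot_mem ha hb rfl), parJ_apply i j m n ha,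
      parJ_apply i j m n hb, partJ, map_sub, map_add, map_neg, map_smul, LinearMap.sub_apply, LinearMap.add_apply,
    LinearMap.neg_apply, LinearMap.smul_apply, smul_sub, smul_add, smul_neg, h1, h2, bul_dot ha hb,
      dot_star hb (bul_mem ha hm rfl) hn, dot_star hb hm (bul_mem ha hn rfl),
      dot_star ha (bul_mem hb hm rfl) hn, dot_star ha hm (bul_mem hb hn rfl)]
    match_scalars
    all_goals
    rcases zmod2_cases i with h_i | h_i <;> rcases zmod2_cases j with h_j | h_j <;>
    rcases zmod2_cases k with h_k | h_k <;> rcases zmod2_cases l with h_l | h_l <;>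
    (try simp only [h_i, h_j, h_k, h_l, mul_zero, zero_mul, mul_one, add_zero,
      zero_add, ksign_zero, ksign_one, zmod2_one_add_one]) <;> norm_num
  bul ha hr := by
    rw [parJ_apply i j m n ha]; exact partM_bul hm hn ha hr
  star {k l r s} hr hs := by
    have h := X.isTernary.sjt5 _ _ _ _ _ _ _ _ hm hn hr hs
    have h1 := dot_star (star_mem hm hn rfl) hr hs
    have h2 := dot_star (star_mem hr hs rfl) hm hn
    -- The product of `m ⋆ n` and `r ⋆ s` is expanded by axiom 1 in both orders: one order produces
    -- the `•` terms of `∂_{m,n}` on `r` and `s`, the other turns the right side of axiom 5 into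
    -- `∂_{m,n}(r ⋆ s)`.
    have h3 := dot_comm (star_mem hm hn rfl) (star_mem hr hs rfl)
    rw [parJ_apply i j m n (star_mem hr hs rfl)]
    linear_combination (norm := skip) h + h1 - ksign ((i + j) * (k + l)) • h2 - h3
    simp only [parM_apply, partJ, partM, map_sub, map_add, map_neg, map_smul, LinearMap.sub_apply,
        LinearMap.add_apply,
    LinearMap.neg_apply, LinearMap.smul_apply, smul_sub, smul_add, smul_neg]
    match_scalars
    all_goals
    rcases zmod2_cases i with h_i | h_i <;> rcases zmod2_cases j with h_j | h_j <;>
    rcases zmod2_cases k with h_k | h_k <;> rcases zmod2_cases l with h_l | h_l <;>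
    (try simp only [h_i, h_j, h_k, h_l, mul_zero, zero_mul, mul_one, add_zero,
      zero_add, ksign_zero, ksign_one, zmod2_one_add_one]) <;> norm_num
  tri {k l q r s t} hr hs ht := by
    have h6 := X.isTernary.sjt6 _ _ _ _ _ _ _ _ _ _ hm hn hr hs ht
    have h2 := bul_tri (star_mem hm hn rfl) hr hs ht
    -- The middle slot of axiom 6 contains `(n, m, s)`, not `(m, n, s)`. The difference is `(m ⋆ n)
    -- • s`, exactly what changes the coefficient `-½` contributed by axiom 2 into the `+½` of
    -- `∂_{m,n}(s)`.
    have h4 := congrArg (fun x => X.tri r x t) (tri_swap hm hn hs)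
    linear_combination (norm := skip) (1 / 2 : ℂ) • h2 - h6 + ksign ((i + j) * k) • h4
    simp only [parM_apply, partM, map_sub, map_add, map_neg, map_smul, LinearMap.sub_apply,
        LinearMap.add_apply,
    LinearMap.neg_apply, LinearMap.smul_apply, smul_sub, smul_add, smul_neg]
    match_scalars
    all_goals
    rcases zmod2_cases i with h_i | h_i <;> rcases zmod2_cases j with h_j | h_j <;>
    rcases zmod2_cases k with h_k | h_k <;> rcases zmod2_cases l with h_l | h_l <;>
    (try simp only [h_i, h_j, h_k, h_l, mul_zero, zero_mul, mul_one, add_zero,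
      zero_add, ksign_zero, ksign_one, zmod2_one_add_one]) <;> norm_num

/-! ## The relations act by zero -/

theorem angleJ_skew (i j : ZMod 2) (a b c : X.J) :
    X.angleJ i j a b c + ksign (i * j) • X.angleJ j i b a c = 0 := by
  simp only [angleJ, map_sub, map_add, map_neg, map_smul, LinearMap.sub_apply, LinearMap.add_apply,
    LinearMap.neg_apply, LinearMap.smul_apply, smul_sub, smul_add, smul_neg]
  match_scalars
  all_goals
    rcases zmod2_cases i with h_i | h_i <;> rcases zmod2_cases j with h_j | h_j <;>
    (try simp only [h_i, h_j, mul_zero, zero_mul, mul_one, add_zero,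
      zero_add, ksign_zero, ksign_one, zmod2_one_add_one]) <;> norm_num

theorem angleM_skew (i j : ZMod 2) (a b : X.J) (m : X.M) :
    X.angleM i j a b m + ksign (i * j) • X.angleM j i b a m = 0 := by
  simp only [angleM, map_sub, map_add, map_neg, map_smul, LinearMap.sub_apply, LinearMap.add_apply,
    LinearMap.neg_apply, LinearMap.smul_apply, smul_sub, smul_add, smul_neg]
  match_scalars
  all_goals
    rcases zmod2_cases i with h_i | h_i <;> rcases zmod2_cases j with h_j | h_j <;>
    (try simp only [h_i, h_j, mul_zero, zero_mul, mul_one, add_zero,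
      zero_add, ksign_zero, ksign_one, zmod2_one_add_one]) <;> norm_num

theorem partJ_symm {i j k : ZMod 2} {m n : X.M} {a : X.J} (hm : m ∈ X.M.gr i)
    (hn : n ∈ X.M.gr j) (ha : a ∈ X.J.gr k) :
    X.partJ i j k m n a - ksign (i * j) • X.partJ j i k n m a = 0 := by
  have h1 := star_comm (bul_mem ha hm rfl) hn
  have h2 := star_comm hm (bul_mem ha hn rfl)
  simp only [partJ, map_sub, map_add, map_neg, map_smul, LinearMap.sub_apply, LinearMap.add_apply,
    LinearMap.neg_apply, LinearMap.smul_apply, smul_sub, smul_add, smul_neg, h1, h2]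
  match_scalars
  all_goals
    rcases zmod2_cases i with h_i | h_i <;> rcases zmod2_cases j with h_j | h_j <;>
    rcases zmod2_cases k with h_k | h_k <;>
    (try simp only [h_i, h_j, h_k, mul_zero, zero_mul, mul_one, add_zero,
      zero_add, ksign_zero, ksign_one, zmod2_one_add_one]) <;> norm_num

theorem partM_symm {i j k : ZMod 2} {m n r : X.M} (hm : m ∈ X.M.gr i)
    (hn : n ∈ X.M.gr j) (hr : r ∈ X.M.gr k) :
    X.partM m n r - ksign (i * j) • X.partM n m r = 0 := by
  have h1 := congrArg (fun x => X.bul x r) (star_comm hm hn)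
  have h2 := tri_swap hm hn hr
  linear_combination (norm := skip) -h2 - (1 / 2 : ℂ) • h1
  simp only [partM, map_sub, map_add, map_neg, map_smul, LinearMap.sub_apply, LinearMap.add_apply,
    LinearMap.neg_apply, LinearMap.smul_apply, smul_sub, smul_add, smul_neg]
  match_scalars
  all_goals
    rcases zmod2_cases i with h_i | h_i <;> rcases zmod2_cases j with h_j | h_j <;>
    (try simp only [h_i, h_j, mul_zero, zero_mul, mul_one, add_zero,
      zero_add, ksign_zero, ksign_one, zmod2_one_add_one]) <;> norm_num

/-- This is the super Jordan identity up to supercommutativity: the products of two products form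
its left side and the nested products its right side. -/
theorem angleJ_cyclic {i j k l : ZMod 2} {a b c d : X.J}
    (ha : a ∈ X.J.gr i) (hb : b ∈ X.J.gr j) (hc : c ∈ X.J.gr k) (hd : d ∈ X.J.gr l) :
    ksign (i * k) • X.angleJ (i + j) k (X.dot a b) c d
      + ksign (i * j) • X.angleJ (j + k) i (X.dot b c) a d
      + ksign (j * k) • X.angleJ (k + i) j (X.dot c a) b d = 0 := by
  -- With `d` in the third place the right side consists of `((ab)d)c` and its analogues, which are
  -- the values at `d` of the composed multiplications.
  have h := X.isJordan.jordan i j l k a b d c ha hb hd hc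
  have c1 := congrArg (X.dot (X.dot a b)) (dot_comm hc hd)
  have c2 := dot_comm (dot_mem hb hc rfl) (dot_mem ha hd rfl)
  have c3 := congrArg (fun x => X.dot x (X.dot b d)) (dot_comm hc ha)
  have c4 := dot_comm hc (dot_mem (dot_mem ha hb rfl) hd rfl)
  have c5 := dot_comm ha (dot_mem (dot_mem hb hc rfl) hd rfl)
  have c6 := dot_comm hb (dot_mem (dot_mem hc ha rfl) hd rfl)
  have c7 := congrArg (fun x => X.dot (X.dot x d) b) (dot_comm hc ha)
  linear_combination (norm := skip) ksign (i * k) • (ksign (k * l) • h + c1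
    + ksign (i * (j + k)) • c2 + ksign (k * (i + j)) • c3 - ksign ((i + j) * k) • c4 - c5
    - ksign (k * i + i * j) • c6 - ksign (k * i + i * j + j * (k + i + l)) • c7)
  simp only [angleJ, map_sub, map_add, map_neg, map_smul, LinearMap.sub_apply, LinearMap.add_apply,
    LinearMap.neg_apply, LinearMap.smul_apply, smul_sub, smul_add, smul_neg]
  match_scalars
  all_goals
    rcases zmod2_cases i with h_i | h_i <;> rcases zmod2_cases j with h_j | h_j <;>
    rcases zmod2_cases k with h_k | h_k <;> rcases zmod2_cases l with h_l | h_l <;>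
    (try simp only [h_i, h_j, h_k, h_l, mul_zero, zero_mul, mul_one, add_zero,
      zero_add, ksign_zero, ksign_one, zmod2_one_add_one]) <;> norm_num

/-- In any associative superalgebra the cyclic sum of the supercommutators of `½(ab ± ba)` with `c`
vanishes, so the special supermodule law suffices. -/
theorem angleM_cyclic {i j k : ZMod 2} {a b c : X.J}
    (ha : a ∈ X.J.gr i) (hb : b ∈ X.J.gr j) (hc : c ∈ X.J.gr k) (m : X.M) :
    ksign (i * k) • X.angleM (i + j) k (X.dot a b) c m
      + ksign (i * j) • X.angleM (j + k) i (X.dot b c) a m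
      + ksign (j * k) • X.angleM (k + i) j (X.dot c a) b m = 0 := by
  simp only [angleM, map_sub, map_add, map_neg, map_smul, LinearMap.sub_apply, LinearMap.add_apply,
    LinearMap.neg_apply, LinearMap.smul_apply, smul_sub, smul_add, smul_neg, bul_dot ha hb, bul_dot hb hc, bul_dot hc ha]
  match_scalars
  all_goals
    rcases zmod2_cases i with h_i | h_i <;> rcases zmod2_cases j with h_j | h_j <;>
    rcases zmod2_cases k with h_k | h_k <;>
    (try simp only [h_i, h_j, h_k, mul_zero, zero_mul, mul_one, add_zero,
      zero_add, ksign_zero, ksign_one, zmod2_one_add_one]) <;> norm_num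

theorem partJ_bul {i j k l : ZMod 2} {a c : X.J} {m n : X.M} (ha : a ∈ X.J.gr i)
    (hm : m ∈ X.M.gr j) (hn : n ∈ X.M.gr k) (hc : c ∈ X.J.gr l) :
    X.partJ (i + j) k l (X.bul a m) n c - ksign (i * j) • X.partJ j (i + k) l m (X.bul a n) c
      = (ksign (i * (j + k)) * 2) • X.angleJ (j + k) i (X.star m n) a c := by
  simp only [partJ, angleJ, map_sub, map_add, map_neg, map_smul, LinearMap.sub_apply,
      LinearMap.add_apply,
    LinearMap.neg_apply, LinearMap.smul_apply, smul_sub, smul_add, smul_neg, dot_comm (star_mem hm hn rfl) (dot_mem ha hc rfl),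
    dot_comm (star_mem hm hn rfl) hc, dot_star (dot_mem ha hc rfl) hm hn, dot_star hc hm hn,
    dot_star ha (bul_mem hc hm rfl) hn, dot_star ha hm (bul_mem hc hn rfl), bul_dot ha hc]
  match_scalars
  all_goals
    rcases zmod2_cases i with h_i | h_i <;> rcases zmod2_cases j with h_j | h_j <;>
    rcases zmod2_cases k with h_k | h_k <;> rcases zmod2_cases l with h_l | h_l <;>
    (try simp only [h_i, h_j, h_k, h_l, mul_zero, zero_mul, mul_one, add_zero,
      zero_add, ksign_zero, ksign_one, zmod2_one_add_one]) <;> norm_num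

/-- The companion of `partM_bul`: axiom 2 is now antisymmetrized in `m` and `n`. The terms with `a`
on `m` or `n` become values of `∂`, while the others combine into the supercommutator of `(m ⋆ n) •`
and `a •`. -/
theorem partM_bul_sub {i j k l : ZMod 2} {a : X.J} {m n r : X.M} (ha : a ∈ X.J.gr i)
    (hm : m ∈ X.M.gr j) (hn : n ∈ X.M.gr k) (hr : r ∈ X.M.gr l) :
    X.partM (X.bul a m) n r - ksign (i * j) • X.partM m (X.bul a n) r
      = (ksign (i * (j + k)) * 2) • X.angleM (j + k) i (X.star m n) a r := by
  have h1 := bul_tri ha hm hn hr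
  have h2 := bul_tri ha hn hm hr
  have h3 := congrArg (X.bul a) (tri_swap hm hn hr)
  have h4 := tri_swap hm hn (bul_mem ha hr rfl)
  have h5 := tri_swap (bul_mem ha hm rfl) hn hr
  have h6 := tri_swap hm (bul_mem ha hn rfl) hr
  linear_combination (norm := skip) (1 / 2 : ℂ) • (h1 - ksign (j * k) • h2 - h3
    + ksign (i * (j + k)) • h4 - h5 + ksign (i * j) • h6)
  simp only [partM, angleM, map_sub, map_add, map_neg, map_smul, LinearMap.sub_apply,
      LinearMap.add_apply,
    LinearMap.neg_apply, LinearMap.smul_apply, smul_sub, smul_add, smul_neg]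
  match_scalars
  all_goals
    rcases zmod2_cases i with h_i | h_i <;> rcases zmod2_cases j with h_j | h_j <;>
    rcases zmod2_cases k with h_k | h_k <;>
    (try simp only [h_i, h_j, h_k, mul_zero, zero_mul, mul_one, add_zero,
      zero_add, ksign_zero, ksign_one, zmod2_one_add_one]) <;> norm_num

/-! ## Derivations and the operators -/

section

variable {p : ZMod 2} {dJ : Module.End ℂ X.J} {dM : Module.End ℂ X.M}

/-- The operators are built from operations that the superderivation respects, so its
supercommutator with an operator is obtained by differentiating the two labels. This and the three
analogues show that the fourth family of relations acts by zero and that `B(J, M)` acts compatibly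
with its bracket. -/
theorem IsDer.angleJ (D : IsDer p dJ dM) {i j k : ZMod 2} {a b c : X.J}
    (ha : a ∈ X.J.gr i) (hb : b ∈ X.J.gr j) (hc : c ∈ X.J.gr k) :
    X.angleJ (p + i) j (dJ a) b c + ksign (p * i) • X.angleJ i (p + j) a (dJ b) c
      = dJ (X.angleJ i j a b c) - ksign (p * (i + j)) • X.angleJ i j a b (dJ c) := by
  simp only [JTernary.angleJ, map_sub, map_add, map_neg, map_smul, LinearMap.sub_apply,
      LinearMap.add_apply,
    LinearMap.neg_apply, LinearMap.smul_apply, smul_sub, smul_add, smul_neg, D.dot ha (dot_mem hb hc rfl), D.dot hb (dot_mem ha hc rfl),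
    D.dot hb hc, D.dot ha hc]
  match_scalars
  all_goals
    rcases zmod2_cases i with h_i | h_i <;> rcases zmod2_cases j with h_j | h_j <;>
    rcases zmod2_cases p with h_p | h_p <;>
    (try simp only [h_i, h_j, h_p, mul_zero, zero_mul, mul_one, add_zero,
      zero_add, ksign_zero, ksign_one, zmod2_one_add_one]) <;> norm_num

theorem IsDer.angleM (D : IsDer p dJ dM) {i j k : ZMod 2} {a b : X.J} {m : X.M}
    (ha : a ∈ X.J.gr i) (hb : b ∈ X.J.gr j) (hm : m ∈ X.M.gr k) :
    X.angleM (p + i) j (dJ a) b m + ksign (p * i) • X.angleM i (p + j) a (dJ b) m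
      = dM (X.angleM i j a b m) - ksign (p * (i + j)) • X.angleM i j a b (dM m) := by
  simp only [JTernary.angleM, map_sub, map_add, map_neg, map_smul, LinearMap.sub_apply,
      LinearMap.add_apply,
    LinearMap.neg_apply, LinearMap.smul_apply, smul_sub, smul_add, smul_neg, D.bul ha (bul_mem hb hm rfl), D.bul hb (bul_mem ha hm rfl),
    D.bul hb hm, D.bul ha hm]
  match_scalars
  all_goals
    rcases zmod2_cases i with h_i | h_i <;> rcases zmod2_cases j with h_j | h_j <;>
    rcases zmod2_cases p with h_p | h_p <;>
    (try simp only [h_i, h_j, h_p, mul_zero, zero_mul, mul_one, add_zero,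
      zero_add, ksign_zero, ksign_one, zmod2_one_add_one]) <;> norm_num

theorem IsDer.partJ (D : IsDer p dJ dM) {i j k : ZMod 2} {m n : X.M} {a : X.J}
    (hm : m ∈ X.M.gr i) (hn : n ∈ X.M.gr j) (ha : a ∈ X.J.gr k) :
    X.partJ (p + i) j k (dM m) n a + ksign (p * i) • X.partJ i (p + j) k m (dM n) a
      = dJ (X.partJ i j k m n a) - ksign (p * (i + j)) • X.partJ i j (p + k) m n (dJ a) := by
  simp only [JTernary.partJ, map_sub, map_add, map_neg, map_smul, LinearMap.sub_apply,
      LinearMap.add_apply,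
    LinearMap.neg_apply, LinearMap.smul_apply, smul_sub, smul_add, smul_neg, D.star (bul_mem ha hm rfl) hn, D.star hm (bul_mem ha hn rfl),
    D.bul ha hm, D.bul ha hn]
  match_scalars
  all_goals
    rcases zmod2_cases i with h_i | h_i <;> rcases zmod2_cases j with h_j | h_j <;>
    rcases zmod2_cases k with h_k | h_k <;> rcases zmod2_cases p with h_p | h_p <;>
    (try simp only [h_i, h_j, h_k, h_p, mul_zero, zero_mul, mul_one, add_zero,
      zero_add, ksign_zero, ksign_one, zmod2_one_add_one]) <;> norm_num

theorem IsDer.partM (D : IsDer p dJ dM) {i j k : ZMod 2} {m n r : X.M}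
    (hm : m ∈ X.M.gr i) (hn : n ∈ X.M.gr j) (hr : r ∈ X.M.gr k) :
    X.partM (dM m) n r + ksign (p * i) • X.partM m (dM n) r
      = dM (X.partM m n r) - ksign (p * (i + j)) • X.partM m n (dM r) := by
  simp only [JTernary.partM, map_sub, map_add, map_neg, map_smul, LinearMap.sub_apply,
      LinearMap.add_apply,
    LinearMap.neg_apply, LinearMap.smul_apply, smul_sub, smul_add, smul_neg, D.bul (star_mem hm hn rfl) hr, D.star hm hn, D.tri hm hn hr]
  match_scalars
  all_goals
    rcases zmod2_cases i with h_i | h_i <;> rcases zmod2_cases j with h_j | h_j <;>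
    rcases zmod2_cases p with h_p | h_p <;>
    (try simp only [h_i, h_j, h_p, mul_zero, zero_mul, mul_one, add_zero,
      zero_add, ksign_zero, ksign_one, zmod2_one_add_one]) <;> norm_num

end

/-! ## The space `B(J, M)` -/

section Classes

variable (X : JTernary.{u})

/-- The class `{a ⊗ b}` as a bilinear map. -/
noncomputable def cJ : X.J →ₗ[ℂ] X.J →ₗ[ℂ] X.B :=
  (TensorProduct.mk ℂ X.J X.J).compr₂ (X.relB.mkQ ∘ₗ LinearMap.inl ℂ _ _)

/-- The class `{m ⊗ n}` as a bilinear map. -/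
noncomputable def cM : X.M →ₗ[ℂ] X.M →ₗ[ℂ] X.B :=
  (TensorProduct.mk ℂ X.M X.M).compr₂ (X.relB.mkQ ∘ₗ LinearMap.inr ℂ _ _)

variable {X}

theorem cJ_apply (a b : X.J) : X.cJ a b = X.clsJ a b := rfl

theorem cM_apply (m n : X.M) : X.cM m n = X.clsM m n := rfl

theorem mkQ_eq_zero {t : X.PreB} (h : X.Relator t) : X.relB.mkQ t = 0 :=
  (Submodule.Quotient.mk_eq_zero _).2 (Submodule.subset_span h)

theorem mkQ_pair (s : X.J ⊗[ℂ] X.J) (t : X.M ⊗[ℂ] X.M) :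
    X.relB.mkQ (s, t) = TensorProduct.lift X.cJ s + TensorProduct.lift X.cM t := by
  have h1 : TensorProduct.lift X.cJ = X.relB.mkQ ∘ₗ LinearMap.inl ℂ _ _ :=
    TensorProduct.ext' fun _ _ => rfl
  have h2 : TensorProduct.lift X.cM = X.relB.mkQ ∘ₗ LinearMap.inr ℂ _ _ :=
    TensorProduct.ext' fun _ _ => rfl
  rw [h1, h2, LinearMap.comp_apply, LinearMap.comp_apply, ← map_add]
  simp

theorem cJ_skew {i j : ZMod 2} {a b : X.J} (ha : a ∈ X.J.gr i) (hb : b ∈ X.J.gr j) :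
    X.cJ a b = -(ksign (i * j) • X.cJ b a) := by
  have h := mkQ_eq_zero (Relator.ab i j a b ha hb)
  simp only [mkQ_pair, map_sub, map_add, map_neg, map_smul, LinearMap.sub_apply,
      LinearMap.add_apply,
    LinearMap.neg_apply, LinearMap.smul_apply, smul_sub, smul_add, smul_neg, map_zero, add_zero, TensorProduct.lift.tmul] at h
  exact eq_neg_of_add_eq_zero_left h

theorem cM_symm {i j : ZMod 2} {m n : X.M} (hm : m ∈ X.M.gr i) (hn : n ∈ X.M.gr j) :
    X.cM m n = ksign (i * j) • X.cM n m := by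
  have h := mkQ_eq_zero (Relator.mn i j m n hm hn)
  simp only [mkQ_pair, map_sub, map_add, map_neg, map_smul, LinearMap.sub_apply,
      LinearMap.add_apply,
    LinearMap.neg_apply, LinearMap.smul_apply, smul_sub, smul_add, smul_neg, map_zero, zero_add, TensorProduct.lift.tmul] at h
  exact sub_eq_zero.1 h

theorem cJ_cyclic {i j k : ZMod 2} {a b c : X.J} (ha : a ∈ X.J.gr i) (hb : b ∈ X.J.gr j)
    (hc : c ∈ X.J.gr k) :
    ksign (i * k) • X.cJ (X.dot a b) c + ksign (i * j) • X.cJ (X.dot b c) a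
      + ksign (j * k) • X.cJ (X.dot c a) b = 0 := by
  have h := mkQ_eq_zero (Relator.abc i j k a b c ha hb hc)
  simpa only [mkQ_pair, map_sub, map_add, map_neg, map_smul, LinearMap.sub_apply,
      LinearMap.add_apply,
    LinearMap.neg_apply, LinearMap.smul_apply, smul_sub, smul_add, smul_neg, map_zero, add_zero, TensorProduct.lift.tmul] using h

/-- The cyclic relation, solved for one class so that it can serve as a rewriting rule. -/
theorem cJ_dot {i j k : ZMod 2} {a b c : X.J} (ha : a ∈ X.J.gr i) (hb : b ∈ X.J.gr j)
    (hc : c ∈ X.J.gr k) : X.cJ (X.dot a b) c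
      = -(ksign (i * (j + k)) • X.cJ (X.dot b c) a) - ksign (k * (i + j)) • X.cJ (X.dot c a) b := by
  linear_combination (norm := skip) ksign (i * k) • cJ_cyclic ha hb hc
  match_scalars
  all_goals
    rcases zmod2_cases i with h_i | h_i <;> rcases zmod2_cases j with h_j | h_j <;>
    rcases zmod2_cases k with h_k | h_k <;>
    (try simp only [h_i, h_j, h_k, mul_zero, zero_mul, mul_one, add_zero,
      zero_add, ksign_zero, ksign_one, zmod2_one_add_one]) <;> norm_num

theorem cM_bul {i j k : ZMod 2} {a : X.J} {m n : X.M} (ha : a ∈ X.J.gr i) (hm : m ∈ X.M.gr j)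
    (hn : n ∈ X.M.gr k) : X.cM (X.bul a m) n - ksign (i * j) • X.cM m (X.bul a n)
      - (ksign (i * (j + k)) * 2) • X.cJ (X.star m n) a = 0 := by
  have h := mkQ_eq_zero (Relator.amn i j k a m n ha hm hn)
  simp only [mkQ_pair, map_sub, map_add, map_neg, map_smul, LinearMap.sub_apply,
      LinearMap.add_apply,
    LinearMap.neg_apply, LinearMap.smul_apply, smul_sub, smul_add, smul_neg, map_zero, zero_add, TensorProduct.lift.tmul] at h
  rw [← h]; abel

theorem cJ_star {i j k : ZMod 2} {a : X.J} {m n : X.M} (ha : a ∈ X.J.gr i) (hm : m ∈ X.M.gr j)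
    (hn : n ∈ X.M.gr k) : X.cJ (X.star m n) a
      = (1 / 2 * ksign (i * (j + k))) •
        (X.cM (X.bul a m) n - ksign (i * j) • X.cM m (X.bul a n)) := by
  linear_combination (norm := skip) -(1 / 2 * ksign (i * (j + k))) • cM_bul ha hm hn
  match_scalars
  all_goals
    rcases zmod2_cases i with h_i | h_i <;> rcases zmod2_cases j with h_j | h_j <;>
    rcases zmod2_cases k with h_k | h_k <;>
    (try simp only [h_i, h_j, h_k, mul_zero, zero_mul, mul_one, add_zero,
      zero_add, ksign_zero, ksign_one, zmod2_one_add_one]) <;> norm_num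

theorem cM_part {i j k l : ZMod 2} {m n r s : X.M} (hm : m ∈ X.M.gr i) (hn : n ∈ X.M.gr j)
    (hr : r ∈ X.M.gr k) (hs : s ∈ X.M.gr l) :
    X.cM (X.partM m n r) s + ksign ((i + j) * k) • X.cM r (X.partM m n s)
        + ksign ((i + j) * (k + l)) • X.cM (X.partM r s m) n
        + ksign ((k + l) * j) • X.cM m (X.partM r s n) = 0 := by
  have h := mkQ_eq_zero (Relator.mnrs i j k l m n r s hm hn hr hs)
  simpa only [mkQ_pair, map_sub, map_add, map_neg, map_smul, LinearMap.sub_apply,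
      LinearMap.add_apply,
    LinearMap.neg_apply, LinearMap.smul_apply, smul_sub, smul_add, smul_neg, map_zero, zero_add, TensorProduct.lift.tmul] using h

theorem relB_le_ker {Z : Type*} [AddCommGroup Z] [Module ℂ Z] (f : X.PreB →ₗ[ℂ] Z)
    (h : ∀ t, X.Relator t → f t = 0) : X.relB ≤ LinearMap.ker f :=
  Submodule.span_le.2 fun t ht => h t ht

/-! ### The grading of `B(J, M)` -/

variable (X)

/-- The class of the image of an element of `J ⊗ J ⊕ M ⊗ M` under the parity involution. -/
noncomputable def preInv : X.PreB →ₗ[ℂ] X.B :=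
  (TensorProduct.lift (X.cJ.compl₁₂ X.J.par X.J.par)).coprod
    (TensorProduct.lift (X.cM.compl₁₂ X.M.par X.M.par))

variable {X}

/-- Each generator of the relations is homogeneous, so parity descends to the quotient. -/
theorem preInv_relator {t : X.PreB} (h : X.Relator t) : X.preInv t = 0 := by
  cases h with
  | ab i j a b ha hb =>
    simp only [preInv, LinearMap.coprod_apply, map_sub, map_add, map_neg, map_smul,
        LinearMap.sub_apply, LinearMap.add_apply,
    LinearMap.neg_apply, LinearMap.smul_apply, smul_sub, smul_add, smul_neg, map_zero, add_zero, TensorProduct.lift.tmul,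
      LinearMap.compl₁₂_apply, SuperSpace.par_of_mem ha, SuperSpace.par_of_mem hb, cJ_skew ha hb]
    match_scalars
    all_goals
    rcases zmod2_cases i with h_i | h_i <;> rcases zmod2_cases j with h_j | h_j <;>
    (try simp only [h_i, h_j, mul_zero, zero_mul, mul_one, add_zero,
      zero_add, ksign_zero, ksign_one, zmod2_one_add_one]) <;> norm_num
  | mn i j m n hm hn =>
    simp only [preInv, LinearMap.coprod_apply, map_sub, map_add, map_neg, map_smul,
        LinearMap.sub_apply, LinearMap.add_apply,
    LinearMap.neg_apply, LinearMap.smul_apply, smul_sub, smul_add, smul_neg, map_zero, zero_add, TensorProduct.lift.tmul,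
      LinearMap.compl₁₂_apply, SuperSpace.par_of_mem hm, SuperSpace.par_of_mem hn, cM_symm hm hn]
    match_scalars
    all_goals
    rcases zmod2_cases i with h_i | h_i <;> rcases zmod2_cases j with h_j | h_j <;>
    (try simp only [h_i, h_j, mul_zero, zero_mul, mul_one, add_zero,
      zero_add, ksign_zero, ksign_one, zmod2_one_add_one]) <;> norm_num
  | abc i j k a b c ha hb hc =>
    linear_combination (norm := skip) ksign (i + j + k) • cJ_cyclic ha hb hc
    simp only [preInv, LinearMap.coprod_apply, map_sub, map_add, map_neg, map_smul,
        LinearMap.sub_apply, LinearMap.add_apply,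
    LinearMap.neg_apply, LinearMap.smul_apply, smul_sub, smul_add, smul_neg, map_zero, add_zero, TensorProduct.lift.tmul,
      LinearMap.compl₁₂_apply, SuperSpace.par_of_mem ha, SuperSpace.par_of_mem hb,
      SuperSpace.par_of_mem hc, SuperSpace.par_of_mem (dot_mem ha hb rfl),
      SuperSpace.par_of_mem (dot_mem hb hc rfl), SuperSpace.par_of_mem (dot_mem hc ha rfl)]
    match_scalars
    all_goals
    rcases zmod2_cases i with h_i | h_i <;> rcases zmod2_cases j with h_j | h_j <;>
    rcases zmod2_cases k with h_k | h_k <;>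
    (try simp only [h_i, h_j, h_k, mul_zero, zero_mul, mul_one, add_zero,
      zero_add, ksign_zero, ksign_one, zmod2_one_add_one]) <;> norm_num
  | amn i j k a m n ha hm hn =>
    linear_combination (norm := skip) ksign (i + j + k) • cM_bul ha hm hn
    simp only [preInv, LinearMap.coprod_apply, map_sub, map_add, map_neg, map_smul,
        LinearMap.sub_apply, LinearMap.add_apply,
    LinearMap.neg_apply, LinearMap.smul_apply, smul_sub, smul_add, smul_neg, TensorProduct.lift.tmul,
      LinearMap.compl₁₂_apply, SuperSpace.par_of_mem ha, SuperSpace.par_of_mem hm,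
      SuperSpace.par_of_mem hn, SuperSpace.par_of_mem (star_mem hm hn rfl),
      SuperSpace.par_of_mem (bul_mem ha hm rfl), SuperSpace.par_of_mem (bul_mem ha hn rfl)]
    match_scalars
    all_goals
    rcases zmod2_cases i with h_i | h_i <;> rcases zmod2_cases j with h_j | h_j <;>
    rcases zmod2_cases k with h_k | h_k <;>
    (try simp only [h_i, h_j, h_k, mul_zero, zero_mul, mul_one, add_zero,
      zero_add, ksign_zero, ksign_one, zmod2_one_add_one]) <;> norm_num
  | mnrs i j k l m n r s hm hn hr hs =>
    linear_combination (norm := skip) ksign (i + j + k + l) • cM_part hm hn hr hs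
    simp only [preInv, LinearMap.coprod_apply, map_sub, map_add, map_neg, map_smul,
        LinearMap.sub_apply, LinearMap.add_apply,
    LinearMap.neg_apply, LinearMap.smul_apply, smul_sub, smul_add, smul_neg, map_zero, zero_add, TensorProduct.lift.tmul,
      LinearMap.compl₁₂_apply, SuperSpace.par_of_mem hm, SuperSpace.par_of_mem hn,
      SuperSpace.par_of_mem hr, SuperSpace.par_of_mem hs, SuperSpace.par_of_mem (partM_mem hm hn hr),
      SuperSpace.par_of_mem (partM_mem hm hn hs), SuperSpace.par_of_mem (partM_mem hr hs hm),
      SuperSpace.par_of_mem (partM_mem hr hs hn)]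
    match_scalars
    all_goals
    rcases zmod2_cases i with h_i | h_i <;> rcases zmod2_cases j with h_j | h_j <;>
    rcases zmod2_cases k with h_k | h_k <;> rcases zmod2_cases l with h_l | h_l <;>
    (try simp only [h_i, h_j, h_k, h_l, mul_zero, zero_mul, mul_one, add_zero,
      zero_add, ksign_zero, ksign_one, zmod2_one_add_one]) <;> norm_num

variable (X)

/-- The parity involution of `B(J, M)`. -/
noncomputable def bInv : X.B →ₗ[ℂ] X.B :=
  X.relB.liftQ X.preInv (relB_le_ker _ fun _ h => preInv_relator h)

variable {X}

theorem bInv_cJ (a b : X.J) : X.bInv (X.cJ a b) = X.cJ (X.J.par a) (X.J.par b) := by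
  simp [bInv, cJ, preInv]

theorem bInv_cM (m n : X.M) : X.bInv (X.cM m n) = X.cM (X.M.par m) (X.M.par n) := by
  simp [bInv, cM, preInv]

theorem B_ext {Z : Type*} [AddCommGroup Z] [Module ℂ Z] {f g : X.B →ₗ[ℂ] Z}
    (hJ : ∀ i j, ∀ a ∈ X.J.gr i, ∀ b ∈ X.J.gr j, f (X.cJ a b) = g (X.cJ a b))
    (hM : ∀ i j, ∀ m ∈ X.M.gr i, ∀ n ∈ X.M.gr j, f (X.cM m n) = g (X.cM m n)) : f = g := by
  have h1 : X.cJ.compr₂ f = X.cJ.compr₂ g := bilin_ext hJ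
  have h2 : X.cM.compr₂ f = X.cM.compr₂ g := bilin_ext hM
  refine Submodule.linearMap_qext _ (LinearMap.prod_ext ?_ ?_)
  · exact TensorProduct.ext' fun a b => LinearMap.congr_fun₂ h1 a b
  · exact TensorProduct.ext' fun a b => LinearMap.congr_fun₂ h2 a b

theorem bInv_bInv (b : X.B) : X.bInv (X.bInv b) = b := by
  have h : X.bInv ∘ₗ X.bInv = LinearMap.id := B_ext
    (fun i j a _ b _ => by simp [bInv_cJ, SuperSpace.par_par])
    (fun i j a _ b _ => by simp [bInv_cM, SuperSpace.par_par])
  exact LinearMap.congr_fun h b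

theorem cJ_mem {i j : ZMod 2} {a b : X.J} (ha : a ∈ X.J.gr i) (hb : b ∈ X.J.gr j) :
    X.cJ a b ∈ grOf X.bInv (i + j) := by
  rw [mem_grOf, bInv_cJ, SuperSpace.par_of_mem ha, SuperSpace.par_of_mem hb, map_smul, map_smul,
    LinearMap.smul_apply, smul_smul, ksign_add, mul_comm]

theorem cM_mem {i j : ZMod 2} {m n : X.M} (hm : m ∈ X.M.gr i) (hn : n ∈ X.M.gr j) :
    X.cM m n ∈ grOf X.bInv (i + j) := by
  rw [mem_grOf, bInv_cM, SuperSpace.par_of_mem hm, SuperSpace.par_of_mem hn, map_smul, map_smul,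
    LinearMap.smul_apply, smul_smul, ksign_add, mul_comm]

/-- A homogeneous element may be represented by inhomogeneous tensors. The property is therefore
proved for the component of parity `p` of an arbitrary element: taking this component is additive,
and it fixes or kills the class of a pair of homogeneous elements. -/
theorem B_induction {p : ZMod 2} {P : X.B → Prop} (zero : P 0)
    (add : ∀ b b', P b → P b' → P (b + b'))
    (hJ : ∀ i j, i + j = p → ∀ a ∈ X.J.gr i, ∀ b ∈ X.J.gr j, P (X.cJ a b))
    (hM : ∀ i j, i + j = p → ∀ m ∈ X.M.gr i, ∀ n ∈ X.M.gr j, P (X.cM m n))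
    {b : X.B} (hb : b ∈ grOf X.bInv p) : P b := by
  have key : ∀ q, ∀ b ∈ grOf X.bInv q, (q = p → P b) → P (prOf X.bInv p b) := by
    intro q b hq h
    by_cases hqp : q = p
    · subst hqp; rw [prOf_of_mem hq]; exact h rfl
    · rw [prOf_of_mem_ne hq (Ne.symm hqp)]; exact zero
  suffices h : ∀ b, P (prOf X.bInv p b) by rw [← prOf_of_mem hb]; exact h b
  clear hb b
  intro b
  obtain ⟨⟨s, t⟩, rfl⟩ := X.relB.mkQ_surjective b
  rw [mkQ_pair, map_add]
  refine add _ _ ?_ ?_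
  · induction s with
    | zero => simpa using zero
    | add x y hx hy => rw [map_add, map_add]; exact add _ _ hx hy
    | tmul a b =>
      rw [TensorProduct.lift.tmul, ← SuperSpace.proj_add a, ← SuperSpace.proj_add b]
      simp only [map_add, LinearMap.add_apply]
      refine add _ _ (add _ _ ?_ ?_) (add _ _ ?_ ?_) <;>
      exact key _ _ (cJ_mem (SuperSpace.proj_mem _ _) (SuperSpace.proj_mem _ _)) fun h =>
        hJ _ _ h _ (SuperSpace.proj_mem _ _) _ (SuperSpace.proj_mem _ _)
  · induction t with
    | zero => simpa using zero
    | add x y hx hy => rw [map_add, map_add]; exact add _ _ hx hy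
    | tmul a b =>
      rw [TensorProduct.lift.tmul, ← SuperSpace.proj_add a, ← SuperSpace.proj_add b]
      simp only [map_add, LinearMap.add_apply]
      refine add _ _ (add _ _ ?_ ?_) (add _ _ ?_ ?_) <;>
      exact key _ _ (cM_mem (SuperSpace.proj_mem _ _) (SuperSpace.proj_mem _ _)) fun h =>
        hM _ _ h _ (SuperSpace.proj_mem _ _) _ (SuperSpace.proj_mem _ _)

end Classes

/-! ### The action of `B(J, M)` on `J` and `M` -/

section Action

variable (X : JTernary.{u})

/-- The action of `J ⊗ J ⊕ M ⊗ M` on `J`. -/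
noncomputable def preJ : X.PreB →ₗ[ℂ] Module.End ℂ X.J :=
  (TensorProduct.lift (glue X.angJ)).coprod (TensorProduct.lift (glue X.parJ))

/-- The action of `J ⊗ J ⊕ M ⊗ M` on `M`. -/
noncomputable def preM : X.PreB →ₗ[ℂ] Module.End ℂ X.M :=
  (TensorProduct.lift (glue X.angM)).coprod (TensorProduct.lift X.parM)

variable {X}

theorem preJ_relator {t : X.PreB} (h : X.Relator t) : X.preJ t = 0 := by
  refine SuperSpace.hom_ext fun q c hc => ?_
  cases h with
  | ab i j a b ha hb =>
    have h := angleJ_skew i j a b c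
    simpa only [preJ, angJ_apply, LinearMap.zero_apply, LinearMap.coprod_apply, map_sub, map_add,
        map_neg, map_smul, LinearMap.sub_apply, LinearMap.add_apply,
    LinearMap.neg_apply, LinearMap.smul_apply, smul_sub, smul_add, smul_neg, map_zero, add_zero, TensorProduct.lift.tmul,
      glue_apply _ ha hb, glue_apply _ hb ha] using h
  | mn i j m n hm hn =>
    have h := partJ_symm hm hn hc
    simpa only [preJ, angJ_apply, LinearMap.zero_apply, LinearMap.coprod_apply, map_sub, map_add,
        map_neg, map_smul, LinearMap.sub_apply, LinearMap.add_apply,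
    LinearMap.neg_apply, LinearMap.smul_apply, smul_sub, smul_add, smul_neg, map_zero, zero_add, TensorProduct.lift.tmul,
      glue_apply _ hm hn, glue_apply _ hn hm, parJ_apply _ _ _ _ hc] using h
  | abc i j k a b c ha hb hc' =>
    have h := angleJ_cyclic ha hb hc' hc
    simpa only [preJ, angJ_apply, LinearMap.zero_apply, LinearMap.coprod_apply, map_sub, map_add,
        map_neg, map_smul, LinearMap.sub_apply, LinearMap.add_apply,
    LinearMap.neg_apply, LinearMap.smul_apply, smul_sub, smul_add, smul_neg, map_zero, add_zero, TensorProduct.lift.tmul,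
      glue_apply _ (dot_mem ha hb rfl) hc', glue_apply _ (dot_mem hb hc' rfl) ha,
      glue_apply _ (dot_mem hc' ha rfl) hb] using h
  | amn i j k a m n ha hm hn =>
    have h := partJ_bul ha hm hn hc
    simp only [preJ, LinearMap.coprod_apply, map_sub, map_add, map_neg, map_smul,
        LinearMap.sub_apply, LinearMap.add_apply,
    LinearMap.neg_apply, LinearMap.smul_apply, smul_sub, smul_add, smul_neg, map_zero, add_zero, TensorProduct.lift.tmul,
      glue_apply _ (bul_mem ha hm rfl) hn, glue_apply _ hm (bul_mem ha hn rfl),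
      glue_apply _ (star_mem hm hn rfl) ha, parJ_apply _ _ _ _ hc, h]
    exact neg_add_cancel _
  | mnrs i j k l m n r s hm hn hr hs =>
    -- The first two terms of the relation act as the supercommutator of `∂_{m,n}` with `∂_{r,s}`,
    -- the last two as the one in the opposite order, and these cancel.
    have h1 := (isDer_part hm hn).partJ hr hs hc
    have h2 := (isDer_part hr hs).partJ hm hn hc
    simp only [preJ, LinearMap.coprod_apply, map_sub, map_add, map_neg, map_smul,
        LinearMap.sub_apply, LinearMap.add_apply,
    LinearMap.neg_apply, LinearMap.smul_apply, smul_sub, smul_add, smul_neg, map_zero, zero_add, TensorProduct.lift.tmul,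
      glue_apply _ (partM_mem hm hn hr) hs, glue_apply _ hr (partM_mem hm hn hs),
      glue_apply _ (partM_mem hr hs hm) hn, glue_apply _ hm (partM_mem hr hs hn),
      parJ_apply _ _ _ _ hc, LinearMap.zero_apply]
    rw [parJ_apply _ _ _ _ hc, parJ_apply _ _ _ _ (partJ_mem hr hs hc)] at h1
    rw [parJ_apply _ _ _ _ hc, parJ_apply _ _ _ _ (partJ_mem hm hn hc)] at h2
    simp only [parM_apply] at h1 h2
    linear_combination (norm := skip) h1 + ksign ((i + j) * (k + l)) • h2
    simp only [map_sub, map_add, map_neg, map_smul, LinearMap.sub_apply, LinearMap.add_apply,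
    LinearMap.neg_apply, LinearMap.smul_apply, smul_sub, smul_add, smul_neg]
    match_scalars
    all_goals
    rcases zmod2_cases i with h_i | h_i <;> rcases zmod2_cases j with h_j | h_j <;>
    rcases zmod2_cases k with h_k | h_k <;> rcases zmod2_cases l with h_l | h_l <;>
    (try simp only [h_i, h_j, h_k, h_l, mul_zero, zero_mul, mul_one, add_zero,
      zero_add, ksign_zero, ksign_one, zmod2_one_add_one]) <;> norm_num

theorem preM_relator {t : X.PreB} (h : X.Relator t) : X.preM t = 0 := by
  refine SuperSpace.hom_ext fun q c hc => ?_
  cases h with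
  | ab i j a b ha hb =>
    have h := angleM_skew i j a b c
    simpa only [preM, angM_apply, parM_apply, LinearMap.zero_apply, LinearMap.coprod_apply,
        map_sub, map_add, map_neg, map_smul, LinearMap.sub_apply, LinearMap.add_apply,
    LinearMap.neg_apply, LinearMap.smul_apply, smul_sub, smul_add, smul_neg, map_zero, add_zero, TensorProduct.lift.tmul,
      glue_apply _ ha hb, glue_apply _ hb ha] using h
  | mn i j m n hm hn =>
    have h := partM_symm hm hn hc
    simpa only [preM, angM_apply, parM_apply, LinearMap.zero_apply, LinearMap.coprod_apply,
        map_sub, map_add, map_neg, map_smul, LinearMap.sub_apply, LinearMap.add_apply,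
    LinearMap.neg_apply, LinearMap.smul_apply, smul_sub, smul_add, smul_neg, map_zero, zero_add, TensorProduct.lift.tmul]
      using h
  | abc i j k a b c' ha hb hc' =>
    have h := angleM_cyclic ha hb hc' c
    simpa only [preM, angM_apply, parM_apply, LinearMap.zero_apply, LinearMap.coprod_apply,
        map_sub, map_add, map_neg, map_smul, LinearMap.sub_apply, LinearMap.add_apply,
    LinearMap.neg_apply, LinearMap.smul_apply, smul_sub, smul_add, smul_neg, map_zero, add_zero, TensorProduct.lift.tmul,
      glue_apply _ (dot_mem ha hb rfl) hc', glue_apply _ (dot_mem hb hc' rfl) ha,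
      glue_apply _ (dot_mem hc' ha rfl) hb] using h
  | amn i j k a m n ha hm hn =>
    have h := partM_bul_sub ha hm hn hc
    simp only [preM, LinearMap.coprod_apply, map_sub, map_add, map_neg, map_smul,
        LinearMap.sub_apply, LinearMap.add_apply,
    LinearMap.neg_apply, LinearMap.smul_apply, smul_sub, smul_add, smul_neg, map_zero, add_zero, TensorProduct.lift.tmul,
      glue_apply _ (star_mem hm hn rfl) ha, parM_apply, h]
    exact neg_add_cancel _
  | mnrs i j k l m n r s hm hn hr hs =>
    have h1 := (isDer_part hm hn).partM hr hs hc
    have h2 := (isDer_part hr hs).partM hm hn hc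
    simp only [preM, LinearMap.coprod_apply, map_sub, map_add, map_neg, map_smul,
        LinearMap.sub_apply, LinearMap.add_apply,
    LinearMap.neg_apply, LinearMap.smul_apply, smul_sub, smul_add, smul_neg, map_zero, zero_add, TensorProduct.lift.tmul,
      parM_apply, LinearMap.zero_apply]
    simp only [parM_apply] at h1 h2
    linear_combination (norm := skip) h1 + ksign ((i + j) * (k + l)) • h2
    simp only [map_sub, map_add, map_neg, map_smul, LinearMap.sub_apply, LinearMap.add_apply,
    LinearMap.neg_apply, LinearMap.smul_apply, smul_sub, smul_add, smul_neg]
    match_scalars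
    all_goals
    rcases zmod2_cases i with h_i | h_i <;> rcases zmod2_cases j with h_j | h_j <;>
    rcases zmod2_cases k with h_k | h_k <;> rcases zmod2_cases l with h_l | h_l <;>
    (try simp only [h_i, h_j, h_k, h_l, mul_zero, zero_mul, mul_one, add_zero,
      zero_add, ksign_zero, ksign_one, zmod2_one_add_one]) <;> norm_num

variable (X)

/-- The action of `B(J, M)` on `J`. -/
noncomputable def delJ : X.B →ₗ[ℂ] Module.End ℂ X.J :=
  X.relB.liftQ X.preJ (relB_le_ker _ fun _ h => preJ_relator h)

/-- The action of `B(J, M)` on `M`. -/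
noncomputable def delM : X.B →ₗ[ℂ] Module.End ℂ X.M :=
  X.relB.liftQ X.preM (relB_le_ker _ fun _ h => preM_relator h)

variable {X}

theorem delJ_cJ {i j : ZMod 2} {a b : X.J} (ha : a ∈ X.J.gr i) (hb : b ∈ X.J.gr j) :
    X.delJ (X.cJ a b) = X.angJ i j a b := by
  simp [delJ, cJ, preJ, glue_apply _ ha hb]

theorem delM_cJ {i j : ZMod 2} {a b : X.J} (ha : a ∈ X.J.gr i) (hb : b ∈ X.J.gr j) :
    X.delM (X.cJ a b) = X.angM i j a b := by
  simp [delM, cJ, preM, glue_apply _ ha hb]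

theorem delJ_cM {i j : ZMod 2} {m n : X.M} (hm : m ∈ X.M.gr i) (hn : n ∈ X.M.gr j) :
    X.delJ (X.cM m n) = X.parJ i j m n := by
  simp [delJ, cM, preJ, glue_apply _ hm hn]

theorem delM_cM (m n : X.M) : X.delM (X.cM m n) = X.parM m n := by
  simp [delM, cM, preM]

variable (X)

/-- The space of superderivations of parity `p` of `X`. -/
def derSub (p : ZMod 2) : Submodule ℂ (Module.End ℂ X.J × Module.End ℂ X.M) where
  carrier := {D | IsDer p D.1 D.2}
  zero_mem' := by constructor <;> simp
  add_mem' {D D'} h h' := {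
    memJ := fun ha => add_mem (h.memJ ha) (h'.memJ ha)
    memM := fun ha => add_mem (h.memM ha) (h'.memM ha)
    dot := fun ha hb => by simp [h.dot ha hb, h'.dot ha hb]; module
    bul := fun ha hb => by simp [h.bul ha hb, h'.bul ha hb]; module
    star := fun ha hb => by simp [h.star ha hb, h'.star ha hb]; module
    tri := fun ha hb hc => by simp [h.tri ha hb hc, h'.tri ha hb hc]; module }
  smul_mem' s D h := {
    memJ := fun ha => Submodule.smul_mem _ s (h.memJ ha)
    memM := fun ha => Submodule.smul_mem _ s (h.memM ha)
    dot := fun ha hb => by simp [h.dot ha hb]; module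
    bul := fun ha hb => by simp [h.bul ha hb]; module
    star := fun ha hb => by simp [h.star ha hb]; module
    tri := fun ha hb hc => by simp [h.tri ha hb hc]; module }

variable {X}

theorem isDer_del {p : ZMod 2} {b : X.B} (hb : b ∈ grOf X.bInv p) :
    IsDer p (X.delJ b) (X.delM b) := by
  refine B_induction (P := fun b => (X.delJ b, X.delM b) ∈ X.derSub p) ?_ ?_ ?_ ?_ hb
  · rw [map_zero, map_zero]
    exact zero_mem (X.derSub p)
  · intro b b' h h'
    rw [map_add, map_add]
    exact add_mem h h'
  · rintro i j rfl a ha b hb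
    rw [delJ_cJ ha hb, delM_cJ ha hb]
    exact isDer_angle ha hb
  · rintro i j rfl m hm n hn
    rw [delJ_cM hm hn, delM_cM]
    exact isDer_part hm hn

variable (X)

/-- The action of a pair of operators of parity `p` on `J ⊗ J ⊕ M ⊗ M`. -/
noncomputable def actPre (p : ZMod 2) (D : Module.End ℂ X.J × Module.End ℂ X.M) :
    X.PreB →ₗ[ℂ] X.B :=
  (TensorProduct.lift (X.cJ ∘ₗ D.1 + X.cJ.compl₁₂ (X.J.sgn p) D.1)).coprod
    (TensorProduct.lift (X.cM ∘ₗ D.2 + X.cM.compl₁₂ (X.M.sgn p) D.2))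

variable {X}

/-- Applying a superderivation to a relation gives the signed sum of the relations in which one
argument is replaced by its image. For the fourth family the arguments also occur as labels of `∂`;
there the formula for the supercommutator with `∂` accounts for the extra terms. -/
theorem actPre_relator {p : ZMod 2} {D : Module.End ℂ X.J × Module.End ℂ X.M}
    (hD : IsDer p D.1 D.2) {t : X.PreB} (h : X.Relator t) : X.actPre p D t = 0 := by
  obtain ⟨dJ, dM⟩ := D
  simp only at hD
  cases h with
  | ab i j a b ha hb =>
    simp only [actPre, LinearMap.coprod_apply, map_sub, map_add, map_neg, map_smul,
        LinearMap.sub_apply, LinearMap.add_apply,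
    LinearMap.neg_apply, LinearMap.smul_apply, smul_sub, smul_add, smul_neg, map_zero, add_zero, TensorProduct.lift.tmul,
      LinearMap.comp_apply, LinearMap.compl₁₂_apply, SuperSpace.sgn_of_mem ha,
      SuperSpace.sgn_of_mem hb, cJ_skew (hD.memJ ha) hb, cJ_skew ha (hD.memJ hb)]
    match_scalars
    all_goals
    rcases zmod2_cases i with h_i | h_i <;> rcases zmod2_cases j with h_j | h_j <;>
    rcases zmod2_cases p with h_p | h_p <;>
    (try simp only [h_i, h_j, h_p, mul_zero, zero_mul, mul_one, add_zero,
      zero_add, ksign_zero, ksign_one, zmod2_one_add_one]) <;> norm_num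
  | mn i j m n hm hn =>
    simp only [actPre, LinearMap.coprod_apply, map_sub, map_add, map_neg, map_smul,
        LinearMap.sub_apply, LinearMap.add_apply,
    LinearMap.neg_apply, LinearMap.smul_apply, smul_sub, smul_add, smul_neg, map_zero, zero_add, TensorProduct.lift.tmul,
      LinearMap.comp_apply, LinearMap.compl₁₂_apply, SuperSpace.sgn_of_mem hm,
      SuperSpace.sgn_of_mem hn, cM_symm (hD.memM hm) hn, cM_symm hm (hD.memM hn)]
    match_scalars
    all_goals
    rcases zmod2_cases i with h_i | h_i <;> rcases zmod2_cases j with h_j | h_j <;>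
    rcases zmod2_cases p with h_p | h_p <;>
    (try simp only [h_i, h_j, h_p, mul_zero, zero_mul, mul_one, add_zero,
      zero_add, ksign_zero, ksign_one, zmod2_one_add_one]) <;> norm_num
  | abc i j k a b c ha hb hc =>
    have h1 := cJ_cyclic (hD.memJ ha) hb hc
    have h2 := cJ_cyclic ha (hD.memJ hb) hc
    have h3 := cJ_cyclic ha hb (hD.memJ hc)
    linear_combination (norm := skip) ksign (i * k) • (ksign ((p + i) * k) • h1
      + ksign (p * i + i * k) • h2 + ksign (p * (i + j) + i * (k + p)) • h3)
    simp only [actPre, LinearMap.coprod_apply, map_sub, map_add, map_neg, map_smul,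
        LinearMap.sub_apply, LinearMap.add_apply,
    LinearMap.neg_apply, LinearMap.smul_apply, smul_sub, smul_add, smul_neg, map_zero, add_zero, TensorProduct.lift.tmul,
      LinearMap.comp_apply, LinearMap.compl₁₂_apply, SuperSpace.sgn_of_mem ha,
      SuperSpace.sgn_of_mem hb, SuperSpace.sgn_of_mem hc, SuperSpace.sgn_of_mem (dot_mem ha hb rfl),
      SuperSpace.sgn_of_mem (dot_mem hb hc rfl), SuperSpace.sgn_of_mem (dot_mem hc ha rfl),
      hD.dot ha hb, hD.dot hb hc, hD.dot hc ha]
    match_scalars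
    all_goals
    rcases zmod2_cases i with h_i | h_i <;> rcases zmod2_cases j with h_j | h_j <;>
    rcases zmod2_cases k with h_k | h_k <;> rcases zmod2_cases p with h_p | h_p <;>
    (try simp only [h_i, h_j, h_k, h_p, mul_zero, zero_mul, mul_one, add_zero,
      zero_add, ksign_zero, ksign_one, zmod2_one_add_one]) <;> norm_num
  | amn i j k a m n ha hm hn =>
    have h1 := cM_bul (hD.memJ ha) hm hn
    have h2 := cM_bul ha (hD.memM hm) hn
    have h3 := cM_bul ha hm (hD.memM hn)
    linear_combination (norm := skip) h1 + ksign (p * i) • h2 + ksign (p * (i + j)) • h3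
    simp only [actPre, LinearMap.coprod_apply, map_sub, map_add, map_neg, map_smul,
        LinearMap.sub_apply, LinearMap.add_apply,
    LinearMap.neg_apply, LinearMap.smul_apply, smul_sub, smul_add, smul_neg, TensorProduct.lift.tmul,
      LinearMap.comp_apply, LinearMap.compl₁₂_apply, SuperSpace.sgn_of_mem ha,
      SuperSpace.sgn_of_mem hm, SuperSpace.sgn_of_mem hn, SuperSpace.sgn_of_mem (bul_mem ha hm rfl),
      SuperSpace.sgn_of_mem (bul_mem ha hn rfl), SuperSpace.sgn_of_mem (star_mem hm hn rfl),
      hD.bul ha hm, hD.bul ha hn, hD.star hm hn]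
    match_scalars
    all_goals
    rcases zmod2_cases i with h_i | h_i <;> rcases zmod2_cases j with h_j | h_j <;>
    rcases zmod2_cases k with h_k | h_k <;> rcases zmod2_cases p with h_p | h_p <;>
    (try simp only [h_i, h_j, h_k, h_p, mul_zero, zero_mul, mul_one, add_zero,
      zero_add, ksign_zero, ksign_one, zmod2_one_add_one]) <;> norm_num
  | mnrs i j k l m n r s hm hn hr hs =>
    have h1 := cM_part (hD.memM hm) hn hr hs
    have h2 := cM_part hm (hD.memM hn) hr hs
    have h3 := cM_part hm hn (hD.memM hr) hs
    have h4 := cM_part hm hn hr (hD.memM hs)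
    have e1 := eq_add_of_sub_eq (hD.partM hm hn hr).symm
    have e2 := eq_add_of_sub_eq (hD.partM hm hn hs).symm
    have e3 := eq_add_of_sub_eq (hD.partM hr hs hm).symm
    have e4 := eq_add_of_sub_eq (hD.partM hr hs hn).symm
    linear_combination (norm := skip) h1 + ksign (p * i) • h2 + ksign (p * (i + j)) • h3
      + ksign (p * (i + j + k)) • h4
    simp only [actPre, LinearMap.coprod_apply, map_sub, map_add, map_neg, map_smul,
        LinearMap.sub_apply, LinearMap.add_apply,
    LinearMap.neg_apply, LinearMap.smul_apply, smul_sub, smul_add, smul_neg, map_zero, zero_add, TensorProduct.lift.tmul,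
      LinearMap.comp_apply, LinearMap.compl₁₂_apply, SuperSpace.sgn_of_mem hm,
      SuperSpace.sgn_of_mem hn, SuperSpace.sgn_of_mem hr, SuperSpace.sgn_of_mem hs,
      SuperSpace.sgn_of_mem (partM_mem hm hn hr), SuperSpace.sgn_of_mem (partM_mem hm hn hs),
      SuperSpace.sgn_of_mem (partM_mem hr hs hm), SuperSpace.sgn_of_mem (partM_mem hr hs hn),
      e1, e2, e3, e4]
    match_scalars
    all_goals
    rcases zmod2_cases i with h_i | h_i <;> rcases zmod2_cases j with h_j | h_j <;>
    rcases zmod2_cases k with h_k | h_k <;> rcases zmod2_cases l with h_l | h_l <;>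
    rcases zmod2_cases p with h_p | h_p <;>
    (try simp only [h_i, h_j, h_k, h_l, h_p, mul_zero, zero_mul, mul_one, add_zero,
      zero_add, ksign_zero, ksign_one, zmod2_one_add_one]) <;> norm_num

variable (X)

/-- The action of the superderivations of parity `p` on `B(J, M)`. -/
noncomputable def actB (p : ZMod 2) : X.derSub p →ₗ[ℂ] Module.End ℂ X.B where
  toFun D := X.relB.liftQ (X.actPre p D.1) (relB_le_ker _ fun _ h => actPre_relator D.2 h)
  map_add' D D' := by
    refine Submodule.linearMap_qext _ (LinearMap.prod_ext ?_ ?_) <;>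
    refine TensorProduct.ext' fun a b => ?_ <;> simp [actPre] <;> abel
  map_smul' s D := by
    refine Submodule.linearMap_qext _ (LinearMap.prod_ext ?_ ?_) <;>
    refine TensorProduct.ext' fun a b => ?_ <;> simp [actPre]

/-- The component of parity `p` of an element of `B(J, M)`, as a superderivation. -/
noncomputable def toDer (p : ZMod 2) : X.B →ₗ[ℂ] X.derSub p :=
  LinearMap.codRestrict (X.derSub p) ((X.delJ.prod X.delM) ∘ₗ prOf X.bInv p)
    fun b => isDer_del (prOf_mem bInv_bInv p b)

/-- The bracket of `B(J, M)`. -/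
noncomputable def brB : X.B →ₗ[ℂ] X.B →ₗ[ℂ] X.B :=
  X.actB 0 ∘ₗ X.toDer 0 + X.actB 1 ∘ₗ X.toDer 1

variable {X}

theorem coe_toDer (p : ZMod 2) (b : X.B) : (X.toDer p b : Module.End ℂ X.J × Module.End ℂ X.M)
    = (X.delJ (prOf X.bInv p b), X.delM (prOf X.bInv p b)) := rfl

theorem brB_of_mem {p : ZMod 2} {b : X.B} (hb : b ∈ grOf X.bInv p) :
    X.brB b = X.actB p ⟨(X.delJ b, X.delM b), isDer_del hb⟩ := by
  have h1 : X.toDer p b = ⟨(X.delJ b, X.delM b), isDer_del hb⟩ :=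
    Subtype.ext (by rw [coe_toDer, prOf_of_mem hb])
  have h2 : ∀ q, q ≠ p → X.toDer q b = 0 := fun q hq =>
    Subtype.ext (by rw [coe_toDer, prOf_of_mem_ne hb hq, map_zero, map_zero]; rfl)
  rcases zmod2_cases p with rfl | rfl
  · simp [brB, h1, h2 1 (by decide)]
  · simp [brB, h1, h2 0 (by decide)]

theorem brB_cJ {p i : ZMod 2} {b : X.B} (hb : b ∈ grOf X.bInv p) {a : X.J} (ha : a ∈ X.J.gr i)
    (c : X.J) :
    X.brB b (X.cJ a c) = X.cJ (X.delJ b a) c + ksign (p * i) • X.cJ a (X.delJ b c) := by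
  rw [brB_of_mem hb]
  simp [actB, actPre, cJ, SuperSpace.sgn_of_mem ha]

theorem brB_cM {p i : ZMod 2} {b : X.B} (hb : b ∈ grOf X.bInv p) {m : X.M} (hm : m ∈ X.M.gr i)
    (n : X.M) :
    X.brB b (X.cM m n) = X.cM (X.delM b m) n + ksign (p * i) • X.cM m (X.delM b n) := by
  rw [brB_of_mem hb]
  simp [actB, actPre, cM, SuperSpace.sgn_of_mem hm]

theorem delJ_mem {p i : ZMod 2} {b : X.B} (hb : b ∈ grOf X.bInv p) {a : X.J} (ha : a ∈ X.J.gr i) :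
    X.delJ b a ∈ X.J.gr (p + i) := (isDer_del hb).memJ ha

theorem delM_mem {p i : ZMod 2} {b : X.B} (hb : b ∈ grOf X.bInv p) {m : X.M} (hm : m ∈ X.M.gr i) :
    X.delM b m ∈ X.M.gr (p + i) := (isDer_del hb).memM hm

theorem brB_mem {p q : ZMod 2} {b b' : X.B} (hb : b ∈ grOf X.bInv p) (hb' : b' ∈ grOf X.bInv q) :
    X.brB b b' ∈ grOf X.bInv (p + q) := by
  refine B_induction (P := fun b' => X.brB b b' ∈ grOf X.bInv (p + q)) ?_ ?_ ?_ ?_ hb'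
  · simp
  · intro c c' h h'
    rw [map_add]; exact add_mem h h'
  · rintro i j rfl a ha c hc
    rw [brB_cJ hb ha]
    refine add_mem ?_ (Submodule.smul_mem _ _ ?_)
    · rw [← add_assoc]; exact cJ_mem (delJ_mem hb ha) hc
    · rw [add_left_comm]; exact cJ_mem ha (delJ_mem hb hc)
  · rintro i j rfl a ha c hc
    rw [brB_cM hb ha]
    refine add_mem ?_ (Submodule.smul_mem _ _ ?_)
    · rw [← add_assoc]; exact cM_mem (delM_mem hb ha) hc
    · rw [add_left_comm]; exact cM_mem ha (delM_mem hb hc)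

/-- Antisymmetry of the bracket on classes from `J ⊗ J`; the Jordan identity is not needed. The
cyclic relation moves `a` and `b` alone into the second slot. The classes of two products, such as
`{da ⊗ bc}` and `{bc ⊗ ad}`, cancel by skew-symmetry, and what remains is `⟨c, d⟩` acting on `{a ⊗
b}`. -/
theorem cJ_angle {i j k l : ZMod 2} {a b c d : X.J} (ha : a ∈ X.J.gr i) (hb : b ∈ X.J.gr j)
    (hc : c ∈ X.J.gr k) (hd : d ∈ X.J.gr l) :
    X.cJ (X.angleJ i j a b c) d + ksign ((i + j) * k) • X.cJ c (X.angleJ i j a b d)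
      = -(ksign ((i + j) * (k + l)) • (X.cJ (X.angleJ k l c d a) b
          + ksign ((k + l) * i) • X.cJ a (X.angleJ k l c d b))) := by
  have r1 := cJ_dot ha (dot_mem hb hc rfl) hd
  have r2 := cJ_dot hb (dot_mem ha hc rfl) hd
  have r3 := cJ_skew hc (dot_mem ha (dot_mem hb hd rfl) rfl)
  have r4 := cJ_skew hc (dot_mem hb (dot_mem ha hd rfl) rfl)
  have r5 := cJ_dot ha (dot_mem hb hd rfl) hc
  have r6 := cJ_dot hb (dot_mem ha hd rfl) hc
  have k1 := cJ_skew ha (dot_mem (dot_mem hb hd rfl) hc rfl)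
  have k2 := cJ_skew ha (dot_mem (dot_mem hb hc rfl) hd rfl)
  have u1 := cJ_skew (dot_mem hd ha rfl) (dot_mem hb hc rfl)
  rw [dot_comm hd ha, dot_comm hb hc] at u1
  have u2 := cJ_skew (dot_mem hd hb rfl) (dot_mem ha hc rfl)
  rw [dot_comm hd hb, dot_comm ha hc] at u2
  simp only [map_sub, map_add, map_neg, map_smul, LinearMap.sub_apply, LinearMap.add_apply,
    LinearMap.neg_apply, LinearMap.smul_apply, smul_sub, smul_add, smul_neg] at u1 u2
  simp only [angleJ, map_sub, map_add, map_neg, map_smul, LinearMap.sub_apply, LinearMap.add_apply,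
    LinearMap.neg_apply, LinearMap.smul_apply, smul_sub, smul_add, smul_neg]
  simp only [dot_dot_comm hc hd ha, dot_dot_comm hd hc ha, dot_dot_comm hc hd hb,
    dot_dot_comm hd hc hb, r1, r2, r3, r4, r5, r6, map_sub, map_add, map_neg, map_smul, LinearMap.sub_apply, LinearMap.add_apply,
    LinearMap.neg_apply, LinearMap.smul_apply, smul_sub, smul_add, smul_neg, k1, k2]
  simp only [dot_comm hd ha, dot_comm hb hc, dot_comm hd hb, dot_comm ha hc, map_sub, map_add,
      map_neg, map_smul, LinearMap.sub_apply, LinearMap.add_apply,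
    LinearMap.neg_apply, LinearMap.smul_apply, smul_sub, smul_add, smul_neg, u1, u2]
  match_scalars
  all_goals
    rcases zmod2_cases i with h_i | h_i <;> rcases zmod2_cases j with h_j | h_j <;>
    rcases zmod2_cases k with h_k | h_k <;> rcases zmod2_cases l with h_l | h_l <;>
    (try simp only [h_i, h_j, h_k, h_l, mul_zero, zero_mul, mul_one, add_zero,
      zero_add, ksign_zero, ksign_one, zmod2_one_add_one]) <;> norm_num

/-- The mixed case of antisymmetry. Expanding every class `{(· ⋆ ·) ⊗ b}` into classes from `M ⊗ M`,
the terms with `a` and `b` on different factors cancel. Those with both on the same factor form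
commutators, with coefficient `½ · ½`, the `¼` in `⟨a, b⟩` on `M`. -/
theorem cJ_part {i j k l : ZMod 2} {m n : X.M} {a b : X.J} (hm : m ∈ X.M.gr i) (hn : n ∈ X.M.gr j)
    (ha : a ∈ X.J.gr k) (hb : b ∈ X.J.gr l) :
    X.cJ (X.partJ i j k m n a) b + ksign ((i + j) * k) • X.cJ a (X.partJ i j l m n b)
      = -(ksign ((i + j) * (k + l)) • (X.cM (X.angleM k l a b m) n
          + ksign ((k + l) * i) • X.cM m (X.angleM k l a b n))) := by
  simp only [partJ, angleM, map_sub, map_add, map_neg, map_smul, LinearMap.sub_apply,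
      LinearMap.add_apply,
    LinearMap.neg_apply, LinearMap.smul_apply, smul_sub, smul_add, smul_neg, cJ_star hb (bul_mem ha hm rfl) hn,
    cJ_star hb hm (bul_mem ha hn rfl), cJ_skew ha (star_mem (bul_mem hb hm rfl) hn rfl),
    cJ_skew ha (star_mem hm (bul_mem hb hn rfl) rfl), cJ_star ha (bul_mem hb hm rfl) hn,
    cJ_star ha hm (bul_mem hb hn rfl)]
  match_scalars
  all_goals
    rcases zmod2_cases i with h_i | h_i <;> rcases zmod2_cases j with h_j | h_j <;>
    rcases zmod2_cases k with h_k | h_k <;> rcases zmod2_cases l with h_l | h_l <;>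
    (try simp only [h_i, h_j, h_k, h_l, mul_zero, zero_mul, mul_one, add_zero,
      zero_add, ksign_zero, ksign_one, zmod2_one_add_one]) <;> norm_num

theorem brB_skew {p q : ZMod 2} {b b' : X.B} (hb : b ∈ grOf X.bInv p) (hb' : b' ∈ grOf X.bInv q) :
    X.brB b b' = -(ksign (p * q) • X.brB b' b) := by
  refine B_induction (P := fun b => X.brB b b' = -(ksign (p * q) • X.brB b' b)) ?_ ?_ ?_ ?_ hb
  · simp
  · intro c c' h h'
    simp only [map_add, LinearMap.add_apply, h, h']; module
  · rintro i j rfl a ha b hb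
    refine B_induction (P := fun b' => X.brB (X.cJ a b) b'
      = -(ksign ((i + j) * q) • X.brB b' (X.cJ a b))) ?_ ?_ ?_ ?_ hb'
    · simp
    · intro c c' h h'
      simp only [map_add, LinearMap.add_apply, h, h']; module
    · rintro k l rfl c hc d hd
      rw [brB_cJ (cJ_mem ha hb) hc, brB_cJ (cJ_mem hc hd) ha, delJ_cJ ha hb, delJ_cJ hc hd]
      exact cJ_angle ha hb hc hd
    · rintro k l rfl m hm n hn
      rw [brB_cM (cJ_mem ha hb) hm, brB_cJ (cM_mem hm hn) ha, delM_cJ ha hb, delJ_cM hm hn,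
        -- The mixed identity serves both orders of the arguments; in this one the sign it brings
        -- cancels against the one in the goal.
        parJ_apply _ _ _ _ ha, parJ_apply _ _ _ _ hb, cJ_part hm hn ha hb, mul_comm (k + l) (i + j),
        smul_neg, ksign_smul_smul, neg_neg]
      rfl
  · rintro i j rfl m hm n hn
    refine B_induction (P := fun b' => X.brB (X.cM m n) b'
      = -(ksign ((i + j) * q) • X.brB b' (X.cM m n))) ?_ ?_ ?_ ?_ hb'
    · simp
    · intro c c' h h'
      simp only [map_add, LinearMap.add_apply, h, h']; module
    · rintro k l rfl a ha b hb
      rw [brB_cJ (cM_mem hm hn) ha, brB_cM (cJ_mem ha hb) hm, delM_cJ ha hb, delJ_cM hm hn,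
        parJ_apply _ _ _ _ ha, parJ_apply _ _ _ _ hb, cJ_part hm hn ha hb]
      rfl
    · rintro k l rfl r hr s hs
      have h := cM_part hm hn hr hs
      rw [brB_cM (cM_mem hm hn) hr, brB_cM (cM_mem hr hs) hm, delM_cM, delM_cM]
      simp only [parM_apply]
      linear_combination (norm := skip) h
      match_scalars
      all_goals
    rcases zmod2_cases i with h_i | h_i <;> rcases zmod2_cases j with h_j | h_j <;>
    rcases zmod2_cases k with h_k | h_k <;> rcases zmod2_cases l with h_l | h_l <;>
    (try simp only [h_i, h_j, h_k, h_l, mul_zero, zero_mul, mul_one, add_zero,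
      zero_add, ksign_zero, ksign_one, zmod2_one_add_one]) <;> norm_num

/-- The bracket differentiates the two labels of a class, and differentiating the labels of `⟨a, b⟩`
or `∂_{m,n}` is the same as taking the supercommutator with the operator. -/
theorem delJ_brB {p q r : ZMod 2} {b b' : X.B} {c : X.J} (hb : b ∈ grOf X.bInv p)
    (hb' : b' ∈ grOf X.bInv q) (hc : c ∈ X.J.gr r) :
    X.delJ (X.brB b b') c
      = X.delJ b (X.delJ b' c) - ksign (p * q) • X.delJ b' (X.delJ b c) := by
  have D := isDer_del hb
  refine B_induction (P := fun b' => X.delJ (X.brB b b') c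
      = X.delJ b (X.delJ b' c) - ksign (p * q) • X.delJ b' (X.delJ b c)) ?_ ?_ ?_ ?_ hb'
  · simp
  · intro c c' h h'
    simp only [map_add, LinearMap.add_apply, h, h']; module
  · rintro i j rfl a ha d hd
    rw [brB_cJ hb ha, map_add, map_smul, delJ_cJ ha hd, delJ_cJ (D.memJ ha) hd,
      delJ_cJ ha (D.memJ hd)]
    exact D.angleJ ha hd hc
  · rintro i j rfl m hm n hn
    rw [brB_cM hb hm, map_add, map_smul, delJ_cM hm hn, delJ_cM (D.memM hm) hn,
      delJ_cM hm (D.memM hn), LinearMap.add_apply, LinearMap.smul_apply, parJ_apply _ _ _ _ hc,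
      parJ_apply _ _ _ _ hc, parJ_apply _ _ _ _ hc, parJ_apply _ _ _ _ (D.memJ hc)]
    exact D.partJ hm hn hc

theorem delM_brB {p q r : ZMod 2} {b b' : X.B} {c : X.M} (hb : b ∈ grOf X.bInv p)
    (hb' : b' ∈ grOf X.bInv q) (hc : c ∈ X.M.gr r) :
    X.delM (X.brB b b') c
      = X.delM b (X.delM b' c) - ksign (p * q) • X.delM b' (X.delM b c) := by
  have D := isDer_del hb
  refine B_induction (P := fun b' => X.delM (X.brB b b') c
      = X.delM b (X.delM b' c) - ksign (p * q) • X.delM b' (X.delM b c)) ?_ ?_ ?_ ?_ hb'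
  · simp
  · intro c c' h h'
    simp only [map_add, LinearMap.add_apply, h, h']; module
  · rintro i j rfl a ha d hd
    rw [brB_cJ hb ha, map_add, map_smul, delM_cJ ha hd, delM_cJ (D.memJ ha) hd,
      delM_cJ ha (D.memJ hd)]
    exact D.angleM ha hd hc
  · rintro i j rfl m hm n hn
    rw [brB_cM hb hm, map_add, map_smul, delM_cM, delM_cM, delM_cM]
    exact D.partM hm hn hc

end Action

end JTernary

/-! ## Identities for `sl₂` and its natural module -/

section Sl2

theorem sl2_coords (x : Sl2) : ∃ a b c : ℂ, x.1 = !![a, b; c, -a] := by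
  refine ⟨x.1 0 0, x.1 0 1, x.1 1 0, ?_⟩
  have h : Matrix.trace x.1 = 0 := by simpa using LinearMap.mem_ker.1 x.2
  rw [Matrix.trace_fin_two] at h
  rw [← eq_neg_of_add_eq_zero_right h]
  exact Matrix.eta_fin_two x.1

theorem coe_lie (x y : Sl2) : (⁅x, y⁆ : Sl2).1 = x.1 * y.1 - y.1 * x.1 := rfl

theorem sl2_coe_add (x y : Sl2) : (x + y).1 = x.1 + y.1 := rfl

theorem sl2_coe_sub (x y : Sl2) : (x - y).1 = x.1 - y.1 := rfl

theorem sl2_coe_smul (c : ℂ) (x : Sl2) : (c • x).1 = c • x.1 := rfl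

theorem sl2_eq (x : Sl2) : x = x.1 0 0 • sl2H + x.1 0 1 • sl2E + x.1 1 0 • sl2F := by
  obtain ⟨a, b, c, h⟩ := sl2_coords x
  apply Subtype.ext
  simp only [sl2_coe_add, sl2_coe_smul, sl2H, sl2E, sl2F, h]
  ext i j
  fin_cases i <;> fin_cases j <;> simp

/-- Special to `sl₂`: a double bracket is a combination of its arguments with coefficients from the
invariant form. Triple brackets in `sl₂ ⊗ J` can then be compared coefficientwise. -/
theorem lie_lie_eq (x y z : Sl2) :
    ⁅⁅x, y⁆, z⁆ = (1 / 2 * kappa y z) • x - (1 / 2 * kappa x z) • y := by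
  obtain ⟨a, b, c, hx⟩ := sl2_coords x
  obtain ⟨a', b', c', hy⟩ := sl2_coords y
  obtain ⟨a'', b'', c'', hz⟩ := sl2_coords z
  apply Subtype.ext
  simp only [sl2_coe_sub, sl2_coe_smul, coe_lie, kappa, hx, hy, hz]
  ext i j
  fin_cases i <;> fin_cases j <;>
    simp [Matrix.mul_apply, Fin.sum_univ_two, Matrix.trace_fin_two] <;> ring

theorem kappa_comm (x y : Sl2) : kappa x y = kappa y x := by
  rw [kappa, kappa, Matrix.trace_mul_comm]

theorem kappa_lie (x y z : Sl2) : kappa x ⁅y, z⁆ = kappa ⁅x, y⁆ z := by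
  simp only [kappa, coe_lie, mul_sub, sub_mul, Matrix.trace_sub]
  rw [← Matrix.mul_assoc, ← Matrix.mul_assoc, Matrix.trace_mul_comm (x.1 * z.1) y.1,
    Matrix.mul_assoc]
  simp [Matrix.mul_assoc]

theorem lie_mulVec (x y : Sl2) (v : V2) :
    (⁅x, y⁆ : Sl2).1 *ᵥ v = x.1 *ᵥ (y.1 *ᵥ v) - y.1 *ᵥ (x.1 *ᵥ v) := by
  rw [coe_lie, Matrix.sub_mulVec, Matrix.mulVec_mulVec, Matrix.mulVec_mulVec]

/-- The polarized Cayley–Hamilton theorem: traceless 2 × 2 matrices satisfy `xy + yx = tr(xy)`. -/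
theorem mulVec_mulVec_eq (x y : Sl2) (v : V2) :
    y.1 *ᵥ (x.1 *ᵥ v) = (1 / 4 * kappa x y) • v - x.1 *ᵥ (y.1 *ᵥ v) := by
  obtain ⟨a, b, c, hx⟩ := sl2_coords x
  obtain ⟨a', b', c', hy⟩ := sl2_coords y
  simp only [kappa, hx, hy]
  ext i
  fin_cases i <;>
    simp [Matrix.mulVec, dotProduct, Matrix.mul_apply, Fin.sum_univ_two, Matrix.trace_fin_two] <;>
    ring

/-- Used to bring the `sl₂`-factors of a bracket of types `J`, `M`, `M` to the normal form spanned
by `(xv) ⊙ w` and `det(v, w) x`. -/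
theorem symz_mulVec_right (x : Sl2) (v w : V2) :
    symz v (x.1 *ᵥ w) = symz (x.1 *ᵥ v) w + detForm v w • x := by
  obtain ⟨a, b, c, hx⟩ := sl2_coords x
  apply Subtype.ext
  simp only [symz, detForm, sl2_coe_sub, sl2_coe_add, sl2_coe_smul,
    sl2E, sl2F, sl2H, hx]
  ext i j
  fin_cases i <;> fin_cases j <;> simp [Matrix.mulVec, dotProduct, Fin.sum_univ_two] <;> ring

theorem lie_symz (x : Sl2) (v w : V2) :
    ⁅x, symz v w⁆ = symz (x.1 *ᵥ v) w + symz v (x.1 *ᵥ w) := by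
  obtain ⟨a, b, c, hx⟩ := sl2_coords x
  apply Subtype.ext
  simp only [symz, coe_lie, sl2_coe_sub, sl2_coe_add, sl2_coe_smul,
    sl2E, sl2F, sl2H, hx]
  ext i j
  fin_cases i <;> fin_cases j <;>
    simp [Matrix.mul_apply, Matrix.mulVec, dotProduct, Fin.sum_univ_two] <;> ring

theorem detForm_mulVec_right (x : Sl2) (v w : V2) :
    detForm v (x.1 *ᵥ w) = -detForm (x.1 *ᵥ v) w := by
  obtain ⟨a, b, c, hx⟩ := sl2_coords x
  simp [detForm, hx, Matrix.mulVec, dotProduct, Fin.sum_univ_two]; ring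

theorem kappa_symz (x : Sl2) (v w : V2) : kappa x (symz v w) = -4 * detForm (x.1 *ᵥ v) w := by
  obtain ⟨a, b, c, hx⟩ := sl2_coords x
  simp [kappa, symz, detForm, hx, sl2E, sl2F, sl2H, Matrix.mulVec, dotProduct, Fin.sum_univ_two,
    Matrix.trace_fin_two, Matrix.mul_apply]
  ring

theorem symz_mulVec (u v w : V2) :
    (symz u v).1 *ᵥ w = (1 / 2 : ℂ) • (detForm v w • u + detForm u w • v) := by
  ext i
  fin_cases i <;> simp [symz, detForm, sl2E, sl2F, sl2H, Matrix.mulVec, dotProduct,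
    Fin.sum_univ_two] <;> ring

/-- Cramer's rule: three vectors of a plane are dependent, with their determinants as coefficients.
-/
theorem detForm_smul_cyclic (u v w : V2) :
    detForm u v • w + detForm v w • u - detForm u w • v = 0 := by
  ext i
  fin_cases i <;> simp [detForm] <;> ring

theorem detForm_swap (v w : V2) : detForm w v = -detForm v w := by simp [detForm]; ring

theorem symz_comm (v w : V2) : symz v w = symz w v := by
  simp only [symz]; congr 2 <;> ring_nf

/-- The bracket of `sl₂` as a bilinear map. -/
noncomputable def lieL : Sl2 →ₗ[ℂ] Sl2 →ₗ[ℂ] Sl2 :=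
  LinearMap.mk₂ ℂ (fun x y => ⁅x, y⁆) (by simp) (by simp) (by simp) (by simp)

/-- The action of `sl₂` on the natural module as a bilinear map. -/
noncomputable def actV : Sl2 →ₗ[ℂ] V2 →ₗ[ℂ] V2 :=
  LinearMap.mk₂ ℂ (fun x v => x.1 *ᵥ v) (by simp [Matrix.add_mulVec])
    (by simp [Matrix.smul_mulVec]) (by simp [Matrix.mulVec_add]) (by simp [Matrix.mulVec_smul])

/-- The Killing form as a bilinear map. -/
noncomputable def kappaL : Sl2 →ₗ[ℂ] Sl2 →ₗ[ℂ] ℂ :=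
  LinearMap.mk₂ ℂ kappa (by simp [kappa, add_mul, mul_add]) (by simp [kappa]; intros; ring)
    (by simp [kappa, mul_add]) (by simp [kappa]; intros; ring)

theorem kappaL_apply (x y : Sl2) : kappaL x y = kappa x y := rfl

/-- The map `⊙` as a bilinear map. -/
noncomputable def symzL : V2 →ₗ[ℂ] V2 →ₗ[ℂ] Sl2 :=
  LinearMap.mk₂ ℂ symz (by intros; simp [symz]; module) (by intros; simp [symz]; module)
    (by intros; simp [symz]; module) (by intros; simp [symz]; module)

/-- The determinant form as a bilinear map. -/
noncomputable def detL : V2 →ₗ[ℂ] V2 →ₗ[ℂ] ℂ :=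
  LinearMap.mk₂ ℂ detForm (by intros; simp [detForm]; ring) (by intros; simp [detForm]; ring)
    (by intros; simp [detForm]; ring) (by intros; simp [detForm]; ring)

end Sl2

namespace JTernary

/-! ## The bracket of `TAG(J, M)` -/

section Bracket

variable (X : JTernary.{u})

/-- The parity involution of `TAG(J, M)`. -/
noncomputable def tagInv : X.TagSpace →ₗ[ℂ] X.TagSpace :=
  (X.J.par.lTensor Sl2).prodMap ((X.M.par.lTensor V2).prodMap X.bInv)

theorem tagInv_tagInv (t : X.TagSpace) : X.tagInv (X.tagInv t) = t := by
  have h1 : X.J.par ∘ₗ X.J.par = LinearMap.id := LinearMap.ext SuperSpace.par_par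
  have h2 : X.M.par ∘ₗ X.M.par = LinearMap.id := LinearMap.ext SuperSpace.par_par
  obtain ⟨s, t, b⟩ := t
  simp only [tagInv, LinearMap.prodMap_apply, bInv_bInv]
  rw [← LinearMap.comp_apply, ← LinearMap.lTensor_comp, ← LinearMap.comp_apply,
    ← LinearMap.lTensor_comp, h1, h2, LinearMap.lTensor_id, LinearMap.lTensor_id]
  rfl

/-- The super vector space `TAG(J, M)`. -/
noncomputable def tagSp : SuperSpace.{u} := ⟨X.TagSpace, grOf X.tagInv, isInternal_grOf X.tagInv_tagInv⟩

/-- The identification of `TAG(J, M)` with its underlying space. -/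
noncomputable def tagE : X.TagSpace ≃ₗ[ℂ] X.tagSp := LinearEquiv.refl ℂ X.TagSpace

/-- The inclusion of `sl₂ ⊗ J`. -/
noncomputable def inJ : Sl2 ⊗[ℂ] X.J →ₗ[ℂ] X.tagSp := X.tagE.toLinearMap ∘ₗ LinearMap.inl ℂ _ _

/-- The inclusion of `V ⊗ M`. -/
noncomputable def inM : V2 ⊗[ℂ] X.M →ₗ[ℂ] X.tagSp :=
  X.tagE.toLinearMap ∘ₗ LinearMap.inr ℂ _ _ ∘ₗ LinearMap.inl ℂ _ _

/-- The inclusion of `B(J, M)`. -/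
noncomputable def tB : X.B →ₗ[ℂ] X.tagSp :=
  X.tagE.toLinearMap ∘ₗ LinearMap.inr ℂ _ _ ∘ₗ LinearMap.inr ℂ _ _

/-- The projection to `sl₂ ⊗ J`. -/
noncomputable def prJ : X.tagSp →ₗ[ℂ] Sl2 ⊗[ℂ] X.J :=
  LinearMap.fst ℂ _ _ ∘ₗ X.tagE.symm.toLinearMap

/-- The projection to `V ⊗ M`. -/
noncomputable def prM : X.tagSp →ₗ[ℂ] V2 ⊗[ℂ] X.M :=
  LinearMap.fst ℂ _ _ ∘ₗ LinearMap.snd ℂ _ _ ∘ₗ X.tagE.symm.toLinearMap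

/-- The projection to `B(J, M)`. -/
noncomputable def prB : X.tagSp →ₗ[ℂ] X.B :=
  LinearMap.snd ℂ _ _ ∘ₗ LinearMap.snd ℂ _ _ ∘ₗ X.tagE.symm.toLinearMap

/-- The inclusion of `sl₂ ⊗ J` as a bilinear map. -/
noncomputable def tJ : Sl2 →ₗ[ℂ] X.J →ₗ[ℂ] X.tagSp := (TensorProduct.mk ℂ Sl2 X.J).compr₂ X.inJ

/-- The inclusion of `V ⊗ M` as a bilinear map. -/
noncomputable def tM : V2 →ₗ[ℂ] X.M →ₗ[ℂ] X.tagSp := (TensorProduct.mk ℂ V2 X.M).compr₂ X.inM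

variable {X}

theorem tagE_tagJ (x : Sl2) (a : X.J) : X.tagE (X.tagJ x a) = X.tJ x a := rfl
theorem tagE_tagM (v : V2) (m : X.M) : X.tagE (X.tagM v m) = X.tM v m := rfl
theorem tagE_tagB (b : X.B) : X.tagE (X.tagB b) = X.tB b := rfl
theorem inJ_tmul (x : Sl2) (a : X.J) : X.inJ (x ⊗ₜ a) = X.tJ x a := rfl
theorem inM_tmul (v : V2) (m : X.M) : X.inM (v ⊗ₜ m) = X.tM v m := rfl
theorem prJ_tJ (x : Sl2) (a : X.J) : X.prJ (X.tJ x a) = x ⊗ₜ a := rfl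
theorem prM_tJ (x : Sl2) (a : X.J) : X.prM (X.tJ x a) = 0 := rfl
theorem prB_tJ (x : Sl2) (a : X.J) : X.prB (X.tJ x a) = 0 := rfl
theorem prJ_tM (v : V2) (m : X.M) : X.prJ (X.tM v m) = 0 := rfl
theorem prM_tM (v : V2) (m : X.M) : X.prM (X.tM v m) = v ⊗ₜ m := rfl
theorem prB_tM (v : V2) (m : X.M) : X.prB (X.tM v m) = 0 := rfl
theorem prJ_tB (b : X.B) : X.prJ (X.tB b) = 0 := rfl
theorem prM_tB (b : X.B) : X.prM (X.tB b) = 0 := rfl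
theorem prB_tB (b : X.B) : X.prB (X.tB b) = b := rfl

theorem inJ_add_inM_add_tB (t : X.tagSp) :
    X.inJ (X.prJ t) + (X.inM (X.prM t) + X.tB (X.prB t)) = t := by
  have h : ∀ t : X.TagSpace,
      ((t.1, 0, 0) + ((0, t.2.1, 0) + (0, 0, t.2.2)) : X.TagSpace) = t := fun t => by
    refine Prod.ext ?_ (Prod.ext ?_ ?_) <;> simp
  exact h (X.tagE.symm t)

theorem tag_ext {Z : Type*} [AddCommGroup Z] [Module ℂ Z] {f g : X.tagSp →ₗ[ℂ] Z}
    (hJ : ∀ x a, f (X.tJ x a) = g (X.tJ x a)) (hM : ∀ v m, f (X.tM v m) = g (X.tM v m))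
    (hB : ∀ b, f (X.tB b) = g (X.tB b)) : f = g := by
  have h1 : f ∘ₗ X.inJ = g ∘ₗ X.inJ := TensorProduct.ext' hJ
  have h2 : f ∘ₗ X.inM = g ∘ₗ X.inM := TensorProduct.ext' hM
  ext t
  rw [← inJ_add_inM_add_tB t, map_add, map_add, map_add, map_add, hB]
  congr 1
  · exact LinearMap.congr_fun h1 _
  · congr 1
    exact LinearMap.congr_fun h2 _

theorem tJ_mem {i : ZMod 2} (x : Sl2) {a : X.J} (ha : a ∈ X.J.gr i) :
    X.tJ x a ∈ X.tagSp.gr i := by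
  refine mem_grOf.2 ?_
  change X.tagInv (X.tagJ x a) = ksign i • X.tagJ x a
  simp [tagInv, tagJ, SuperSpace.par_of_mem ha]

theorem tM_mem {i : ZMod 2} (v : V2) {m : X.M} (hm : m ∈ X.M.gr i) :
    X.tM v m ∈ X.tagSp.gr i := by
  refine mem_grOf.2 ?_
  change X.tagInv (X.tagM v m) = ksign i • X.tagM v m
  simp [tagInv, tagM, SuperSpace.par_of_mem hm]

theorem tB_mem {i : ZMod 2} {b : X.B} (hb : b ∈ grOf X.bInv i) : X.tB b ∈ X.tagSp.gr i := by
  refine mem_grOf.2 ?_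
  change X.tagInv (X.tagB b) = ksign i • X.tagB b
  simp [tagInv, tagB, mem_grOf.1 hb]

theorem proj_tJ (i : ZMod 2) (x : Sl2) (a : X.J) :
    X.tagSp.proj i (X.tJ x a) = X.tJ x (X.J.proj i a) := by
  have h : X.tagSp.proj i ∘ₗ X.tJ x = X.tJ x ∘ₗ X.J.proj i := by
    refine SuperSpace.hom_ext fun j a ha => ?_
    rw [LinearMap.comp_apply, LinearMap.comp_apply]
    by_cases hij : i = j
    · subst hij
      rw [SuperSpace.proj_of_mem ha, SuperSpace.proj_of_mem (tJ_mem x ha)]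
    · rw [SuperSpace.proj_of_mem_ne ha hij, SuperSpace.proj_of_mem_ne (tJ_mem x ha) hij, map_zero]
  exact LinearMap.congr_fun h a

theorem proj_tM (i : ZMod 2) (v : V2) (m : X.M) :
    X.tagSp.proj i (X.tM v m) = X.tM v (X.M.proj i m) := by
  have h : X.tagSp.proj i ∘ₗ X.tM v = X.tM v ∘ₗ X.M.proj i := by
    refine SuperSpace.hom_ext fun j a ha => ?_
    rw [LinearMap.comp_apply, LinearMap.comp_apply]
    by_cases hij : i = j
    · subst hij
      rw [SuperSpace.proj_of_mem ha, SuperSpace.proj_of_mem (tM_mem v ha)]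
    · rw [SuperSpace.proj_of_mem_ne ha hij, SuperSpace.proj_of_mem_ne (tM_mem v ha) hij, map_zero]
  exact LinearMap.congr_fun h m

theorem proj_tB (i : ZMod 2) (b : X.B) : X.tagSp.proj i (X.tB b) = X.tB (prOf X.bInv i b) := by
  rw [← prOf_add X.bInv b, map_add, map_add, map_add, map_add]
  congr 1
  · by_cases hi : i = 0
    · subst hi
      rw [SuperSpace.proj_of_mem (tB_mem (prOf_mem bInv_bInv _ _)),
        prOf_of_mem (prOf_mem bInv_bInv _ _)]
    · rw [SuperSpace.proj_of_mem_ne (tB_mem (prOf_mem bInv_bInv _ _)) hi,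
        prOf_of_mem_ne (prOf_mem bInv_bInv _ _) hi, map_zero]
  · by_cases hi : i = 1
    · subst hi
      rw [SuperSpace.proj_of_mem (tB_mem (prOf_mem bInv_bInv _ _)),
        prOf_of_mem (prOf_mem bInv_bInv _ _)]
    · rw [SuperSpace.proj_of_mem_ne (tB_mem (prOf_mem bInv_bInv _ _)) hi,
        prOf_of_mem_ne (prOf_mem bInv_bInv _ _) hi, map_zero]

theorem tag_induction {i : ZMod 2} {P : X.tagSp → Prop} (zero : P 0)
    (add : ∀ s t, P s → P t → P (s + t)) (hJ : ∀ x, ∀ a ∈ X.J.gr i, P (X.tJ x a))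
    (hM : ∀ v, ∀ m ∈ X.M.gr i, P (X.tM v m)) (hB : ∀ b ∈ grOf X.bInv i, P (X.tB b))
    {t : X.tagSp} (ht : t ∈ X.tagSp.gr i) : P t := by
  suffices h : ∀ t, P (X.tagSp.proj i t) by rw [← SuperSpace.proj_of_mem ht]; exact h t
  clear ht t
  intro t
  rw [← inJ_add_inM_add_tB t, map_add, map_add]
  generalize X.prJ t = s
  generalize X.prM t = r
  refine add _ _ ?_ (add _ _ ?_ ?_)
  · induction s with
    | zero => rw [map_zero, map_zero]; exact zero
    | add x y hx hy => rw [map_add, map_add]; exact add _ _ hx hy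
    | tmul x a => exact inJ_tmul x a ▸ proj_tJ i x a ▸ hJ x _ (SuperSpace.proj_mem _ _)
  · induction r with
    | zero => rw [map_zero, map_zero]; exact zero
    | add x y hx hy => rw [map_add, map_add]; exact add _ _ hx hy
    | tmul x a => exact inM_tmul x a ▸ proj_tM i x a ▸ hM x _ (SuperSpace.proj_mem _ _)
  · rw [proj_tB]
    exact hB _ (prOf_mem bInv_bInv _ _)

variable (X)

/-- The part of the bracket of `TAG(J, M)` on `sl₂ ⊗ J × V ⊗ M` and on `B(J, M) × (sl₂ ⊗ J ⊕
V ⊗ M)`. -/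
noncomputable def brHalf : X.tagSp →ₗ[ℂ] X.tagSp →ₗ[ℂ] X.tagSp :=
  ((TensorProduct.map₂ actV X.bul).compl₁₂ X.prJ X.prM).compr₂ X.inM
    + ((LinearMap.lTensorHom Sl2 ∘ₗ X.delJ).compl₁₂ X.prB X.prJ).compr₂ X.inJ
    + ((LinearMap.lTensorHom V2 ∘ₗ X.delM).compl₁₂ X.prB X.prM).compr₂ X.inM

/-- The part of the bracket of `TAG(J, M)` on `sl₂ ⊗ J`, on `V ⊗ M` and on `B(J, M)`. -/
noncomputable def brDiag : X.tagSp →ₗ[ℂ] X.tagSp →ₗ[ℂ] X.tagSp :=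
  ((TensorProduct.map₂ lieL X.dot).compl₁₂ X.prJ X.prJ).compr₂ X.inJ
    + ((TensorProduct.map₂ ((1 / 2 : ℂ) • kappaL) X.cJ).compl₁₂ X.prJ X.prJ).compr₂
      (X.tB ∘ₗ (TensorProduct.lid ℂ X.B).toLinearMap)
    + ((TensorProduct.map₂ symzL X.star).compl₁₂ X.prM X.prM).compr₂ X.inJ
    + ((TensorProduct.map₂ detL X.cM).compl₁₂ X.prM X.prM).compr₂
      (X.tB ∘ₗ (TensorProduct.lid ℂ X.B).toLinearMap)
    + (X.brB.compl₁₂ X.prB X.prB).compr₂ X.tB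

/-- The bracket of `TAG(J, M)`. -/
noncomputable def tagBr : X.tagSp →ₗ[ℂ] X.tagSp →ₗ[ℂ] X.tagSp :=
  X.brHalf - glue (fun i j => ksign (i * j) • X.brHalf.flip) + X.brDiag

variable {X}

theorem tagBr_of_mem {i j : ZMod 2} {s t : X.tagSp} (hs : s ∈ X.tagSp.gr i)
    (ht : t ∈ X.tagSp.gr j) :
    X.tagBr s t = X.brHalf s t - ksign (i * j) • X.brHalf t s + X.brDiag s t := by
  simp only [tagBr, LinearMap.add_apply, LinearMap.sub_apply, glue_apply _ hs ht,
    LinearMap.smul_apply, LinearMap.flip_apply]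

/-- The antisymmetrized half of the bracket has a sign depending on parities. Where that half
vanishes, the bracket formulas hold for all elements, homogeneous or not. -/
theorem tagBr_of_half {s t : X.tagSp}
    (h : ∀ i j, X.brHalf (X.tagSp.proj i t) (X.tagSp.proj j s) = 0) :
    X.tagBr s t = X.brHalf s t + X.brDiag s t := by
  simp [tagBr, glue, h]

theorem brHalf_JJ (x y : Sl2) (a b : X.J) : X.brHalf (X.tJ x a) (X.tJ y b) = 0 := by
  simp [brHalf, prJ_tJ, prM_tJ, prB_tJ]
theorem brHalf_JM (x : Sl2) (v : V2) (a : X.J) (m : X.M) :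
    X.brHalf (X.tJ x a) (X.tM v m) = X.tM (x.1 *ᵥ v) (X.bul a m) := by
  simp [brHalf, prJ_tJ, prB_tJ, prM_tM, prJ_tM, actV, inM_tmul]
theorem brHalf_JB (x : Sl2) (a : X.J) (b : X.B) : X.brHalf (X.tJ x a) (X.tB b) = 0 := by
  simp [brHalf, prB_tJ, prJ_tB, prM_tB]
theorem brHalf_MJ (x : Sl2) (v : V2) (a : X.J) (m : X.M) :
    X.brHalf (X.tM v m) (X.tJ x a) = 0 := by
  simp [brHalf, prM_tJ, prB_tM]
theorem brHalf_MM (v w : V2) (m n : X.M) : X.brHalf (X.tM v m) (X.tM w n) = 0 := by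
  simp [brHalf, prJ_tM, prB_tM]
theorem brHalf_MB (v : V2) (m : X.M) (b : X.B) : X.brHalf (X.tM v m) (X.tB b) = 0 := by
  simp [brHalf, prM_tB, prB_tM]
theorem brHalf_BJ (b : X.B) (x : Sl2) (a : X.J) :
    X.brHalf (X.tB b) (X.tJ x a) = X.tJ x (X.delJ b a) := by
  simp [brHalf, prJ_tJ, prM_tJ, prB_tB, inJ_tmul]
theorem brHalf_BM (b : X.B) (v : V2) (m : X.M) :
    X.brHalf (X.tB b) (X.tM v m) = X.tM v (X.delM b m) := by
  simp [brHalf, prJ_tM, prM_tM, prB_tB, prJ_tB, inM_tmul]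
theorem brHalf_BB (b b' : X.B) : X.brHalf (X.tB b) (X.tB b') = 0 := by
  simp [brHalf, prJ_tB, prM_tB]

theorem brDiag_JJ (x y : Sl2) (a b : X.J) : X.brDiag (X.tJ x a) (X.tJ y b)
    = X.tJ ⁅x, y⁆ (X.dot a b) + (1 / 2 * kappa x y) • X.tB (X.cJ a b) := by
  simp [brDiag, prJ_tJ, prM_tJ, prB_tJ, inJ_tmul, lieL, kappaL_apply]
theorem brDiag_JM (x : Sl2) (v : V2) (a : X.J) (m : X.M) :
    X.brDiag (X.tJ x a) (X.tM v m) = 0 := by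
  simp [brDiag, prM_tJ, prB_tJ, prJ_tM]
theorem brDiag_JB (x : Sl2) (a : X.J) (b : X.B) : X.brDiag (X.tJ x a) (X.tB b) = 0 := by
  simp [brDiag, prM_tJ, prB_tJ, prJ_tB]
theorem brDiag_MJ (x : Sl2) (v : V2) (a : X.J) (m : X.M) :
    X.brDiag (X.tM v m) (X.tJ x a) = 0 := by
  simp [brDiag, prM_tJ, prB_tJ, prJ_tM]
theorem brDiag_MM (v w : V2) (m n : X.M) : X.brDiag (X.tM v m) (X.tM w n)
    = X.tJ (symz v w) (X.star m n) + detForm v w • X.tB (X.cM m n) := by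
  simp [brDiag, prM_tM, prJ_tM, prB_tM, inJ_tmul, symzL, detL]
theorem brDiag_MB (v : V2) (m : X.M) (b : X.B) : X.brDiag (X.tM v m) (X.tB b) = 0 := by
  simp [brDiag, prJ_tM, prB_tM, prM_tB]
theorem brDiag_BJ (b : X.B) (x : Sl2) (a : X.J) : X.brDiag (X.tB b) (X.tJ x a) = 0 := by
  simp [brDiag, prM_tJ, prB_tJ, prJ_tB]
theorem brDiag_BM (b : X.B) (v : V2) (m : X.M) : X.brDiag (X.tB b) (X.tM v m) = 0 := by
  simp [brDiag, prJ_tM, prB_tM, prM_tB]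
theorem brDiag_BB (b b' : X.B) : X.brDiag (X.tB b) (X.tB b') = X.tB (X.brB b b') := by
  simp [brDiag, prJ_tB, prM_tB, prB_tB]

theorem tagBr_JJ (x y : Sl2) (a b : X.J) : X.tagBr (X.tJ x a) (X.tJ y b)
    = X.tJ ⁅x, y⁆ (X.dot a b) + (1 / 2 * kappa x y) • X.tB (X.cJ a b) := by
  rw [tagBr_of_half (fun _ _ => by rw [proj_tJ, proj_tJ, brHalf_JJ]), brHalf_JJ, brDiag_JJ,
    zero_add]
theorem tagBr_JM (x : Sl2) (v : V2) (a : X.J) (m : X.M) :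
    X.tagBr (X.tJ x a) (X.tM v m) = X.tM (x.1 *ᵥ v) (X.bul a m) := by
  rw [tagBr_of_half (fun _ _ => by rw [proj_tJ, proj_tM, brHalf_MJ]), brHalf_JM, brDiag_JM,
    add_zero]
theorem tagBr_MM (v w : V2) (m n : X.M) : X.tagBr (X.tM v m) (X.tM w n)
    = X.tJ (symz v w) (X.star m n) + detForm v w • X.tB (X.cM m n) := by
  rw [tagBr_of_half (fun _ _ => by rw [proj_tM, proj_tM, brHalf_MM]), brHalf_MM, brDiag_MM,
    zero_add]
theorem tagBr_BJ (b : X.B) (x : Sl2) (a : X.J) :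
    X.tagBr (X.tB b) (X.tJ x a) = X.tJ x (X.delJ b a) := by
  rw [tagBr_of_half (fun _ _ => by rw [proj_tJ, proj_tB, brHalf_JB]), brHalf_BJ, brDiag_BJ,
    add_zero]
theorem tagBr_BM (b : X.B) (v : V2) (m : X.M) :
    X.tagBr (X.tB b) (X.tM v m) = X.tM v (X.delM b m) := by
  rw [tagBr_of_half (fun _ _ => by rw [proj_tM, proj_tB, brHalf_MB]), brHalf_BM, brDiag_BM,
    add_zero]
theorem tagBr_BB (b b' : X.B) : X.tagBr (X.tB b) (X.tB b') = X.tB (X.brB b b') := by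
  rw [tagBr_of_half (fun _ _ => by rw [proj_tB, proj_tB, brHalf_BB]), brHalf_BB, brDiag_BB,
    zero_add]

theorem tagBr_MJ {i j : ZMod 2} (v : V2) (x : Sl2) {m : X.M} {a : X.J} (hm : m ∈ X.M.gr i)
    (ha : a ∈ X.J.gr j) :
    X.tagBr (X.tM v m) (X.tJ x a) = -(ksign (i * j) • X.tM (x.1 *ᵥ v) (X.bul a m)) := by
  simp [tagBr_of_mem (tM_mem v hm) (tJ_mem x ha), brHalf_JM, brHalf_MJ, brDiag_MJ]
theorem tagBr_JB {i j : ZMod 2} (x : Sl2) {a : X.J} {b : X.B} (ha : a ∈ X.J.gr i)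
    (hb : b ∈ grOf X.bInv j) :
    X.tagBr (X.tJ x a) (X.tB b) = -(ksign (i * j) • X.tJ x (X.delJ b a)) := by
  simp [tagBr_of_mem (tJ_mem x ha) (tB_mem hb), brHalf_JB, brHalf_BJ, brDiag_JB]
theorem tagBr_MB {i j : ZMod 2} (v : V2) {m : X.M} {b : X.B} (hm : m ∈ X.M.gr i)
    (hb : b ∈ grOf X.bInv j) :
    X.tagBr (X.tM v m) (X.tB b) = -(ksign (i * j) • X.tM v (X.delM b m)) := by
  simp [tagBr_of_mem (tM_mem v hm) (tB_mem hb), brHalf_MB, brHalf_BM, brDiag_MB]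

end Bracket

end JTernary

/-! ## The Jacobi identity in terms of the Leibniz rule -/

section Jacobi

variable {W : SuperSpace.{u}} (br : W →ₗ[ℂ] W →ₗ[ℂ] W)

/-- The super Jacobi identity for elements of parities `i`, `j`, `k`. -/
def Jac (i j k : ZMod 2) (x y z : W) : Prop :=
  br (br x y) z + ksign (i * (j + k)) • br (br y z) x + ksign (k * (i + j)) • br (br z x) y = 0

variable {br}

/-- Together with `Jac.swap` this generates all permutations, so each unordered type of triple needs
to be treated in one order only. -/
theorem Jac.rotate {i j k : ZMod 2} {x y z : W} (h : Jac br i j k x y z) : Jac br j k i y z x := by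
  unfold Jac at *
  linear_combination (norm := skip) ksign (i * (j + k)) • h
  match_scalars
  all_goals
    rcases zmod2_cases i with h_i | h_i <;> rcases zmod2_cases j with h_j | h_j <;>
    rcases zmod2_cases k with h_k | h_k <;>
    (try simp only [h_i, h_j, h_k, mul_zero, zero_mul, mul_one, add_zero,
      zero_add, ksign_zero, ksign_one, zmod2_one_add_one]) <;> norm_num

variable (hmem : ∀ (i j : ZMod 2) (x y : W), x ∈ W.gr i → y ∈ W.gr j → br x y ∈ W.gr (i + j))
  (hskew : ∀ (i j : ZMod 2) (x y : W), x ∈ W.gr i → y ∈ W.gr j →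
    br x y = -(ksign (i * j) • br y x))

include hskew in
theorem Jac.swap {i j k : ZMod 2} {x y z : W} (hx : x ∈ W.gr i) (hy : y ∈ W.gr j) (hz : z ∈ W.gr k)
    (h : Jac br i j k x y z) : Jac br j i k y x z := by
  unfold Jac at *
  linear_combination (norm := skip) -ksign (i * j) • h
  simp only [hskew _ _ x y hx hy, hskew _ _ y z hy hz, hskew _ _ z x hz hx, map_sub, map_add,
      map_neg, map_smul, LinearMap.sub_apply, LinearMap.add_apply,
    LinearMap.neg_apply, LinearMap.smul_apply, smul_sub, smul_add, smul_neg]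
  match_scalars
  all_goals
    rcases zmod2_cases i with h_i | h_i <;> rcases zmod2_cases j with h_j | h_j <;>
    rcases zmod2_cases k with h_k | h_k <;>
    (try simp only [h_i, h_j, h_k, mul_zero, zero_mul, mul_one, add_zero,
      zero_add, ksign_zero, ksign_one, zmod2_one_add_one]) <;> norm_num

include hmem hskew in
theorem jac_of_leibniz {i j k : ZMod 2} {x y z : W} (hx : x ∈ W.gr i) (hy : y ∈ W.gr j)
    (hz : z ∈ W.gr k) (h : br x (br y z) = br (br x y) z + ksign (i * j) • br y (br x z)) :
    Jac br i j k x y z := by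
  unfold Jac
  rw [hskew _ _ x (br y z) hx (hmem _ _ _ _ hy hz), hskew _ _ y (br x z) hy (hmem _ _ _ _ hx hz),
    hskew _ _ x z hx hz] at h
  simp only [map_sub, map_add, map_neg, map_smul, LinearMap.sub_apply, LinearMap.add_apply,
    LinearMap.neg_apply, LinearMap.smul_apply, smul_sub, smul_add, smul_neg] at h
  linear_combination (norm := skip) -h
  match_scalars
  all_goals
    rcases zmod2_cases i with h_i | h_i <;> rcases zmod2_cases j with h_j | h_j <;>
    rcases zmod2_cases k with h_k | h_k <;>
    (try simp only [h_i, h_j, h_k, mul_zero, zero_mul, mul_one, add_zero,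
      zero_add, ksign_zero, ksign_one, zmod2_one_add_one]) <;> norm_num

end Jacobi

/-! ### Further forms of the `sl₂` identities -/

section Sl2

theorem lie_lie_right (x y z : Sl2) :
    ⁅x, ⁅y, z⁆⁆ = (1 / 2 * kappa x y) • z - (1 / 2 * kappa x z) • y := by
  rw [← lie_skew, lie_lie_eq, kappa_comm z x, kappa_comm y x, neg_sub]

theorem kappa_lie_left (x y z : Sl2) : kappa y ⁅x, z⁆ = -kappa ⁅x, y⁆ z := by
  rw [kappa_lie, ← lie_skew, ← kappaL_apply, map_neg, LinearMap.neg_apply, kappaL_apply]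

end Sl2

namespace JTernary

variable {X : JTernary.{u}}

theorem tri_reverse {i j k : ZMod 2} {m n s : X.M} (hm : m ∈ X.M.gr i) (hn : n ∈ X.M.gr j)
    (hs : s ∈ X.M.gr k) : X.tri m n s
      = ksign (i * (j + k) + j * k) • X.tri s n m - ksign (j * k) • X.bul (X.star m s) n :=
  X.isTernary.sjt3 _ _ _ _ _ _ hm hn hs

/-! ## `TAG(J, M)` is a Lie superalgebra -/

theorem tagBr_mem {i j : ZMod 2} {s t : X.tagSp} (hs : s ∈ X.tagSp.gr i) (ht : t ∈ X.tagSp.gr j) :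
    X.tagBr s t ∈ X.tagSp.gr (i + j) := by
  refine tag_induction (P := fun s => X.tagBr s t ∈ X.tagSp.gr (i + j)) ?_ ?_ ?_ ?_ ?_ hs
  · simp
  · intro s s' h h'
    rw [map_add]; exact add_mem h h'
  all_goals
    intros
    refine tag_induction (P := fun t => X.tagBr _ t ∈ X.tagSp.gr (i + j)) ?_ ?_ ?_ ?_ ?_ ht
    · simp
    · intro s s' h h'
      rw [map_add]; exact add_mem h h'
  · intro y b hb
    rename_i x a ha
    rw [tagBr_JJ]
    exact add_mem (tJ_mem _ (dot_mem ha hb rfl)) (Submodule.smul_mem _ _ (tB_mem (cJ_mem ha hb)))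
  · intro v m hm
    rename_i x a ha
    rw [tagBr_JM]
    exact tM_mem _ (bul_mem ha hm rfl)
  · intro b hb
    rename_i x a ha
    rw [tagBr_JB x ha hb, add_comm]
    exact neg_mem (Submodule.smul_mem _ _ (tJ_mem _ (delJ_mem hb ha)))
  · intro x a ha
    rename_i v m hm
    rw [tagBr_MJ v x hm ha, add_comm]
    exact neg_mem (Submodule.smul_mem _ _ (tM_mem _ (bul_mem ha hm rfl)))
  · intro w n hn
    rename_i v m hm
    rw [tagBr_MM]
    exact add_mem (tJ_mem _ (star_mem hm hn rfl)) (Submodule.smul_mem _ _ (tB_mem (cM_mem hm hn)))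
  · intro b hb
    rename_i v m hm
    rw [tagBr_MB v hm hb, add_comm]
    exact neg_mem (Submodule.smul_mem _ _ (tM_mem _ (delM_mem hb hm)))
  · intro x a ha
    rename_i b hb
    rw [tagBr_BJ]
    exact tJ_mem _ (delJ_mem hb ha)
  · intro v m hm
    rename_i b hb
    rw [tagBr_BM]
    exact tM_mem _ (delM_mem hb hm)
  · intro b' hb'
    rename_i b hb
    rw [tagBr_BB]
    exact tB_mem (brB_mem hb hb')

/-- Each component pairs a form with an operation of opposite symmetry: the bracket of `sl₂` with
the Jordan product, `κ` with `{a ⊗ b}`, `⊙` with `⋆`, and `det` with `{m ⊗ n}`. -/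
theorem brDiag_skew {i j : ZMod 2} {s t : X.tagSp} (hs : s ∈ X.tagSp.gr i) (ht : t ∈ X.tagSp.gr j) :
    X.brDiag s t = -(ksign (i * j) • X.brDiag t s) := by
  refine tag_induction (P := fun s => X.brDiag s t = -(ksign (i * j) • X.brDiag t s))
    ?_ ?_ ?_ ?_ ?_ hs
  · simp
  · intro s s' h h'
    simp only [map_add, LinearMap.add_apply, h, h']; module
  all_goals
    intros
    refine tag_induction (P := fun t => X.brDiag _ t = -(ksign (i * j) • X.brDiag t _))
      ?_ ?_ ?_ ?_ ?_ ht
    · simp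
    · intro s s' h h'
      simp only [map_add, LinearMap.add_apply, h, h']; module
    all_goals intros
  · rename_i x a ha y b hb
    rw [brDiag_JJ, brDiag_JJ, dot_comm ha hb, cJ_skew ha hb, kappa_comm x y, ← lie_skew]
    simp only [map_sub, map_add, map_neg, map_smul, LinearMap.sub_apply, LinearMap.add_apply,
    LinearMap.neg_apply, LinearMap.smul_apply, smul_sub, smul_add, smul_neg]
    module
  · rw [brDiag_JM, brDiag_MJ, smul_zero, neg_zero]
  · rw [brDiag_JB, brDiag_BJ, smul_zero, neg_zero]
  · rw [brDiag_JM, brDiag_MJ, smul_zero, neg_zero]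
  · rename_i v m hm w n hn
    rw [brDiag_MM, brDiag_MM, star_comm hm hn, cM_symm hm hn, symz_comm v w, detForm_swap w v]
    simp only [map_sub, map_add, map_neg, map_smul, LinearMap.sub_apply, LinearMap.add_apply,
    LinearMap.neg_apply, LinearMap.smul_apply, smul_sub, smul_add, smul_neg]
    module
  · rw [brDiag_MB, brDiag_BM, smul_zero, neg_zero]
  · rw [brDiag_JB, brDiag_BJ, smul_zero, neg_zero]
  · rw [brDiag_MB, brDiag_BM, smul_zero, neg_zero]
  · rename_i b hb b' hb'
    rw [brDiag_BB, brDiag_BB, brB_skew hb hb', map_neg, map_smul]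

theorem tagBr_skew {i j : ZMod 2} {s t : X.tagSp} (hs : s ∈ X.tagSp.gr i) (ht : t ∈ X.tagSp.gr j) :
    X.tagBr s t = -(ksign (i * j) • X.tagBr t s) := by
  rw [tagBr_of_mem hs ht, tagBr_of_mem ht hs, brDiag_skew hs ht]
  match_scalars
  all_goals
    rcases zmod2_cases i with h_i | h_i <;> rcases zmod2_cases j with h_j | h_j <;>
    (try simp only [h_i, h_j, mul_zero, zero_mul, mul_one, add_zero,
      zero_add, ksign_zero, ksign_one, zmod2_one_add_one]) <;> norm_num

/-! ### The ten types of the Leibniz rule on generators -/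

section Leibniz

variable {i j k : ZMod 2} {x y z : Sl2} {u v w : V2} {a b c : X.J} {m n r : X.M} {d d' d'' : X.B}

/-- In `sl₂ ⊗ J`, double brackets are rewritten as combinations of `x`, `y`, `z`, and the operators
`⟨·,·⟩` supply the matching coefficients. In `B(J, M)` every term carries the invariant `κ([x, y],
z)`, and the cyclic relation remains. -/
theorem leibniz_JJJ (ha : a ∈ X.J.gr i) (hb : b ∈ X.J.gr j) (hc : c ∈ X.J.gr k) :
    X.tagBr (X.tJ x a) (X.tagBr (X.tJ y b) (X.tJ z c))
      = X.tagBr (X.tagBr (X.tJ x a) (X.tJ y b)) (X.tJ z c)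
        + ksign (i * j) • X.tagBr (X.tJ y b) (X.tagBr (X.tJ x a) (X.tJ z c)) := by
  simp only [tagBr_JJ, map_sub, map_add, map_neg, map_smul, LinearMap.sub_apply,
      LinearMap.add_apply,
    LinearMap.neg_apply, LinearMap.smul_apply, smul_sub, smul_add, smul_neg, tagBr_JB x ha (cJ_mem hb hc), tagBr_BJ, delJ_cJ ha hb, delJ_cJ hb hc,
    tagBr_JB y hb (cJ_mem ha hc), delJ_cJ ha hc, angJ_apply, angleJ]
  simp only [lie_lie_right x, lie_lie_right y, lie_lie_eq x y z, kappa_lie x y z,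
    kappa_lie_left x y z, kappa_comm y x, dot_comm (dot_mem ha hb rfl) hc, dot_comm hc ha,
    dot_comm hc hb, dot_comm hb ha, map_sub, map_add, map_neg, map_smul, LinearMap.sub_apply, LinearMap.add_apply,
    LinearMap.neg_apply, LinearMap.smul_apply, smul_sub, smul_add, smul_neg, cJ_skew ha (dot_mem hb hc rfl),
    cJ_skew hb (dot_mem ha hc rfl), cJ_dot ha hb hc]
  match_scalars
  all_goals
    rcases zmod2_cases i with h_i | h_i <;> rcases zmod2_cases j with h_j | h_j <;>
    rcases zmod2_cases k with h_k | h_k <;>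
    (try simp only [h_i, h_j, h_k, mul_zero, zero_mul, mul_one, add_zero,
      zero_add, ksign_zero, ksign_one, zmod2_one_add_one]) <;> ring

/-- On `V ⊗ M` the element `x ⊗ a` acts as a tensor product of operators. Splitting `xy` into half
its commutator and half its anticommutator `¼ κ(x, y)`, the supercommutator becomes `[x, y]` with
the special product `a·b` plus `½ κ(x, y)` times a quarter of the supercommutator of `a•` and `b•`.
This is the reason for the `¼` in `⟨a, b⟩` on `M`. -/
theorem leibniz_JJM (ha : a ∈ X.J.gr i) (hb : b ∈ X.J.gr j) :
    X.tagBr (X.tJ x a) (X.tagBr (X.tJ y b) (X.tM v m))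
      = X.tagBr (X.tagBr (X.tJ x a) (X.tJ y b)) (X.tM v m)
        + ksign (i * j) • X.tagBr (X.tJ y b) (X.tagBr (X.tJ x a) (X.tM v m)) := by
  simp only [tagBr_JJ, map_sub, map_add, map_neg, map_smul, LinearMap.sub_apply,
      LinearMap.add_apply,
    LinearMap.neg_apply, LinearMap.smul_apply, smul_sub, smul_add, smul_neg, tagBr_JM, tagBr_BM, delM_cJ ha hb, angM_apply, angleM, lie_mulVec,
    mulVec_mulVec_eq x y v, bul_dot ha hb]
  match_scalars
  all_goals
    rcases zmod2_cases i with h_i | h_i <;> rcases zmod2_cases j with h_j | h_j <;>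
    (try simp only [h_i, h_j, mul_zero, zero_mul, mul_one, add_zero,
      zero_add, ksign_zero, ksign_one, zmod2_one_add_one]) <;> ring

theorem leibniz_JMM (ha : a ∈ X.J.gr i) (hm : m ∈ X.M.gr j) (hn : n ∈ X.M.gr k) :
    X.tagBr (X.tJ x a) (X.tagBr (X.tM v m) (X.tM w n))
      = X.tagBr (X.tagBr (X.tJ x a) (X.tM v m)) (X.tM w n)
        + ksign (i * j) • X.tagBr (X.tM v m) (X.tagBr (X.tJ x a) (X.tM w n)) := by
  simp only [tagBr_MM, map_sub, map_add, map_neg, map_smul, LinearMap.sub_apply,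
      LinearMap.add_apply,
    LinearMap.neg_apply, LinearMap.smul_apply, smul_sub, smul_add, smul_neg, tagBr_JM, tagBr_JJ, tagBr_JB x ha (cM_mem hm hn), delJ_cM hm hn,
    parJ_apply _ _ _ _ ha, partJ, lie_symz, symz_mulVec_right x v w, detForm_mulVec_right,
    kappa_symz, dot_star ha hm hn, cJ_skew ha (star_mem hm hn rfl), cJ_star ha hm hn]
  match_scalars
  all_goals
    rcases zmod2_cases i with h_i | h_i <;> rcases zmod2_cases j with h_j | h_j <;>
    rcases zmod2_cases k with h_k | h_k <;>
    (try simp only [h_i, h_j, h_k, mul_zero, zero_mul, mul_one, add_zero,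
      zero_add, ksign_zero, ksign_one, zmod2_one_add_one]) <;> ring

theorem leibniz_MMM (hm : m ∈ X.M.gr i) (hn : n ∈ X.M.gr j) (hr : r ∈ X.M.gr k) :
    X.tagBr (X.tM u m) (X.tagBr (X.tM v n) (X.tM w r))
      = X.tagBr (X.tagBr (X.tM u m) (X.tM v n)) (X.tM w r)
        + ksign (i * j) • X.tagBr (X.tM v n) (X.tagBr (X.tM u m) (X.tM w r)) := by
  -- Every term lies in `V ⊗ M`, with `V`-factor one of `u`, `v`, `w` times a determinant of the
  -- other two. Axioms 3 and 4 reduce the triple products to one ordering, and the remaining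
  -- discrepancy is an instance of Cramer's rule tensored with a fixed element of `M`.
  have h : ∀ Y, detForm u v • X.tM w Y + detForm v w • X.tM u Y - detForm u w • X.tM v Y = 0 := by
    intro Y
    have := congrArg (fun t => X.tM t Y) (detForm_smul_cyclic u v w)
    simpa only [map_sub, map_add, map_smul, LinearMap.sub_apply, LinearMap.add_apply,
      LinearMap.smul_apply, map_zero, LinearMap.zero_apply] using this
  linear_combination (norm := skip)
    h ((1 / 2 * ksign (i * (j + k))) • X.bul (X.star n r) m - X.partM m n r
      + (1 / 2 * ksign (j * k)) • X.bul (X.star m r) n)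
  simp only [tagBr_MM, map_sub, map_add, map_neg, map_smul, LinearMap.sub_apply,
      LinearMap.add_apply,
    LinearMap.neg_apply, LinearMap.smul_apply, smul_sub, smul_add, smul_neg, tagBr_MJ _ _ hm (star_mem hn hr rfl), tagBr_MB _ hm (cM_mem hn hr),
    tagBr_JM, tagBr_BM, tagBr_MJ _ _ hn (star_mem hm hr rfl), tagBr_MB _ hn (cM_mem hm hr),
    delM_cM, parM_apply, partM, symz_mulVec, tri_reverse hm hn hr, tri_reverse hm hr hn,
    tri_swap hn hr hm, detForm_swap u v, detForm_swap v w, detForm_swap u w]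
  match_scalars
  all_goals
    rcases zmod2_cases i with h_i | h_i <;> rcases zmod2_cases j with h_j | h_j <;>
    rcases zmod2_cases k with h_k | h_k <;>
    (try simp only [h_i, h_j, h_k, mul_zero, zero_mul, mul_one, add_zero,
      zero_add, ksign_zero, ksign_one, zmod2_one_add_one]) <;> ring

/-- For one element of `B(J, M)` the Leibniz rule is the superderivation property of its action; for
two it is the compatibility of the action with the bracket. -/
theorem leibniz_BJJ (hd : d ∈ grOf X.bInv i) (ha : a ∈ X.J.gr j) (hb : b ∈ X.J.gr k) :
    X.tagBr (X.tB d) (X.tagBr (X.tJ x a) (X.tJ y b))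
      = X.tagBr (X.tagBr (X.tB d) (X.tJ x a)) (X.tJ y b)
        + ksign (i * j) • X.tagBr (X.tJ x a) (X.tagBr (X.tB d) (X.tJ y b)) := by
  simp only [tagBr_JJ, tagBr_BJ, tagBr_BB, map_sub, map_add, map_neg, map_smul,
      LinearMap.sub_apply, LinearMap.add_apply,
    LinearMap.neg_apply, LinearMap.smul_apply, smul_sub, smul_add, smul_neg, (isDer_del hd).dot ha hb, brB_cJ hd ha]
  module

theorem leibniz_BJM (hd : d ∈ grOf X.bInv i) (ha : a ∈ X.J.gr j) (hm : m ∈ X.M.gr k) :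
    X.tagBr (X.tB d) (X.tagBr (X.tJ x a) (X.tM v m))
      = X.tagBr (X.tagBr (X.tB d) (X.tJ x a)) (X.tM v m)
        + ksign (i * j) • X.tagBr (X.tJ x a) (X.tagBr (X.tB d) (X.tM v m)) := by
  simp only [tagBr_JM, tagBr_BJ, tagBr_BM, map_sub, map_add, map_neg, map_smul,
      LinearMap.sub_apply, LinearMap.add_apply,
    LinearMap.neg_apply, LinearMap.smul_apply, smul_sub, smul_add, smul_neg, (isDer_del hd).bul ha hm]

theorem leibniz_BMM (hd : d ∈ grOf X.bInv i) (hm : m ∈ X.M.gr j) (hn : n ∈ X.M.gr k) :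
    X.tagBr (X.tB d) (X.tagBr (X.tM v m) (X.tM w n))
      = X.tagBr (X.tagBr (X.tB d) (X.tM v m)) (X.tM w n)
        + ksign (i * j) • X.tagBr (X.tM v m) (X.tagBr (X.tB d) (X.tM w n)) := by
  simp only [tagBr_MM, tagBr_BJ, tagBr_BM, tagBr_BB, map_sub, map_add, map_neg, map_smul,
      LinearMap.sub_apply, LinearMap.add_apply,
    LinearMap.neg_apply, LinearMap.smul_apply, smul_sub, smul_add, smul_neg, (isDer_del hd).star hm hn, brB_cM hd hm]
  module

theorem leibniz_BBJ (hd : d ∈ grOf X.bInv i) (hd' : d' ∈ grOf X.bInv j) (ha : a ∈ X.J.gr k) :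
    X.tagBr (X.tB d) (X.tagBr (X.tB d') (X.tJ x a))
      = X.tagBr (X.tagBr (X.tB d) (X.tB d')) (X.tJ x a)
        + ksign (i * j) • X.tagBr (X.tB d') (X.tagBr (X.tB d) (X.tJ x a)) := by
  simp only [tagBr_BJ, tagBr_BB, delJ_brB hd hd' ha, map_sub, map_add, map_neg, map_smul,
      LinearMap.sub_apply, LinearMap.add_apply,
    LinearMap.neg_apply, LinearMap.smul_apply, smul_sub, smul_add, smul_neg]
  module

theorem leibniz_BBM (hd : d ∈ grOf X.bInv i) (hd' : d' ∈ grOf X.bInv j) (hm : m ∈ X.M.gr k) :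
    X.tagBr (X.tB d) (X.tagBr (X.tB d') (X.tM v m))
      = X.tagBr (X.tagBr (X.tB d) (X.tB d')) (X.tM v m)
        + ksign (i * j) • X.tagBr (X.tB d') (X.tagBr (X.tB d) (X.tM v m)) := by
  simp only [tagBr_BM, tagBr_BB, delM_brB hd hd' hm, map_sub, map_add, map_neg, map_smul,
      LinearMap.sub_apply, LinearMap.add_apply,
    LinearMap.neg_apply, LinearMap.smul_apply, smul_sub, smul_add, smul_neg]
  module

/-- On a class, both sides differentiate the labels twice. The terms with one derivative on each
label cancel, and the others agree by `delJ_brB` and `delM_brB`. -/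
theorem leibniz_BBB (hd : d ∈ grOf X.bInv i) (hd' : d' ∈ grOf X.bInv j) (hd'' : d'' ∈ grOf X.bInv k) :
    X.tagBr (X.tB d) (X.tagBr (X.tB d') (X.tB d''))
      = X.tagBr (X.tagBr (X.tB d) (X.tB d')) (X.tB d'')
        + ksign (i * j) • X.tagBr (X.tB d') (X.tagBr (X.tB d) (X.tB d'')) := by
  simp only [tagBr_BB]
  rw [← map_smul, ← map_add]
  congr 1
  refine B_induction (P := fun d'' => X.brB d (X.brB d' d'')
    = X.brB (X.brB d d') d'' + ksign (i * j) • X.brB d' (X.brB d d'')) ?_ ?_ ?_ ?_ hd''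
  · simp
  · intro c c' h h'
    simp only [map_add, h, h']; module
  · rintro p q rfl a ha b hb
    simp only [brB_cJ hd ha, brB_cJ hd' ha, brB_cJ (brB_mem hd hd') ha, map_sub, map_add, map_neg,
        map_smul, LinearMap.sub_apply, LinearMap.add_apply,
    LinearMap.neg_apply, LinearMap.smul_apply, smul_sub, smul_add, smul_neg,
      brB_cJ hd (delJ_mem hd' ha), brB_cJ hd' (delJ_mem hd ha), delJ_brB hd hd' ha,
      delJ_brB hd hd' hb]
    match_scalars
    all_goals
    rcases zmod2_cases i with h_i | h_i <;> rcases zmod2_cases j with h_j | h_j <;>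
    rcases zmod2_cases p with h_p | h_p <;> rcases zmod2_cases q with h_q | h_q <;>
    (try simp only [h_i, h_j, h_p, h_q, mul_zero, zero_mul, mul_one, add_zero,
      zero_add, ksign_zero, ksign_one, zmod2_one_add_one]) <;> norm_num
  · rintro p q rfl a ha b hb
    simp only [brB_cM hd ha, brB_cM hd' ha, brB_cM (brB_mem hd hd') ha, map_sub, map_add, map_neg,
        map_smul, LinearMap.sub_apply, LinearMap.add_apply,
    LinearMap.neg_apply, LinearMap.smul_apply, smul_sub, smul_add, smul_neg,
      brB_cM hd (delM_mem hd' ha), brB_cM hd' (delM_mem hd ha), delM_brB hd hd' ha,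
      delM_brB hd hd' hb]
    match_scalars
    all_goals
    rcases zmod2_cases i with h_i | h_i <;> rcases zmod2_cases j with h_j | h_j <;>
    rcases zmod2_cases p with h_p | h_p <;> rcases zmod2_cases q with h_q | h_q <;>
    (try simp only [h_i, h_j, h_p, h_q, mul_zero, zero_mul, mul_one, add_zero,
      zero_add, ksign_zero, ksign_one, zmod2_one_add_one]) <;> norm_num

end Leibniz

/-- The generators of parity `i` of `TAG(J, M)`. -/
inductive IsGen (X : JTernary.{u}) (i : ZMod 2) : X.tagSp → Prop
  | J (x : Sl2) (a : X.J) (ha : a ∈ X.J.gr i) : IsGen X i (X.tJ x a)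
  | M (v : V2) (m : X.M) (hm : m ∈ X.M.gr i) : IsGen X i (X.tM v m)
  | B (b : X.B) (hb : b ∈ grOf X.bInv i) : IsGen X i (X.tB b)

theorem IsGen.mem {i : ZMod 2} {s : X.tagSp} (h : IsGen X i s) : s ∈ X.tagSp.gr i := by
  cases h with
  | J x a ha => exact tJ_mem x ha
  | M v m hm => exact tM_mem v hm
  | B b hb => exact tB_mem hb

theorem gen_induction {i : ZMod 2} {P : X.tagSp → Prop} (zero : P 0)
    (add : ∀ s t, P s → P t → P (s + t)) (gen : ∀ s, IsGen X i s → P s)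
    {t : X.tagSp} (ht : t ∈ X.tagSp.gr i) : P t :=
  tag_induction zero add (fun x a ha => gen _ (.J x a ha)) (fun v m hm => gen _ (.M v m hm))
    (fun b hb => gen _ (.B b hb)) ht

/-- All 27 ordered types of triples reduce to the ten Leibniz rules by rotations and swaps. -/
theorem jac_gen {i j k : ZMod 2} {s t r : X.tagSp} (hs : IsGen X i s) (ht : IsGen X j t)
    (hr : IsGen X k r) : Jac X.tagBr i j k s t r := by
  have L : ∀ {i j k : ZMod 2} {s t r : X.tagSp}, IsGen X i s → IsGen X j t → IsGen X k r →
      X.tagBr s (X.tagBr t r) = X.tagBr (X.tagBr s t) r + ksign (i * j) • X.tagBr t (X.tagBr s r) →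
      Jac X.tagBr i j k s t r := fun hs ht hr h =>
    jac_of_leibniz (fun _ _ _ _ => tagBr_mem) (fun _ _ _ _ => tagBr_skew) hs.mem ht.mem hr.mem h
  have S : ∀ {i j k : ZMod 2} {s t r : X.tagSp}, IsGen X i s → IsGen X j t → IsGen X k r →
      Jac X.tagBr i j k s t r → Jac X.tagBr j i k t s r := fun hs ht hr h =>
    h.swap (fun _ _ _ _ => tagBr_skew) hs.mem ht.mem hr.mem
  have gs := hs
  have gt := ht
  have gr := hr
  cases hs with
  | J x a ha =>
    cases ht with
    | J y b hb =>
      cases hr with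
      | J z c hc => exact L gs gt gr (leibniz_JJJ ha hb hc)
      | M v m hm => exact L gs gt gr (leibniz_JJM ha hb)
      | B d hd => exact (L gr gs gt (leibniz_BJJ hd ha hb)).rotate
    | M v m hm =>
      cases hr with
      | J y b hb => exact (L gr gs gt (leibniz_JJM hb ha)).rotate
      | M w n hn => exact L gs gt gr (leibniz_JMM ha hm hn)
      | B d hd => exact (L gr gs gt (leibniz_BJM hd ha hm)).rotate
    | B d hd =>
      cases hr with
      | J y b hb => exact (L gt gr gs (leibniz_BJJ hd hb ha)).rotate.rotate
      | M v m hm => exact S gt gs gr (L gt gs gr (leibniz_BJM hd ha hm))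
      | B d' hd' => exact (L gt gr gs (leibniz_BBJ hd hd' ha)).rotate.rotate
  | M v m hm =>
    cases ht with
    | J y b hb =>
      cases hr with
      | J z c hc => exact (L gt gr gs (leibniz_JJM hb hc)).rotate.rotate
      | M w n hn => exact (L gt gr gs (leibniz_JMM hb hn hm)).rotate.rotate
      | B d hd => exact (S gr gt gs (L gr gt gs (leibniz_BJM hd hb hm))).rotate.rotate
    | M w n hn =>
      cases hr with
      | J y b hb => exact (L gr gs gt (leibniz_JMM hb hm hn)).rotate
      | M z r hr => exact L gs gt gr (leibniz_MMM hm hn hr)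
      | B d hd => exact (L gr gs gt (leibniz_BMM hd hm hn)).rotate
    | B d hd =>
      cases hr with
      | J y b hb => exact (L gt gr gs (leibniz_BJM hd hb hm)).rotate.rotate
      | M w n hn => exact (L gt gr gs (leibniz_BMM hd hn hm)).rotate.rotate
      | B d' hd' => exact (L gt gr gs (leibniz_BBM hd hd' hm)).rotate.rotate
  | B d hd =>
    cases ht with
    | J y b hb =>
      cases hr with
      | J z c hc => exact L gs gt gr (leibniz_BJJ hd hb hc)
      | M w n hn => exact L gs gt gr (leibniz_BJM hd hb hn)
      | B d' hd' => exact (L gr gs gt (leibniz_BBJ hd' hd hb)).rotate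
    | M w n hn =>
      cases hr with
      | J y b hb => exact (S gs gr gt (L gs gr gt (leibniz_BJM hd hb hn))).rotate
      | M z r hr => exact L gs gt gr (leibniz_BMM hd hn hr)
      | B d' hd' => exact (L gr gs gt (leibniz_BBM hd' hd hn)).rotate
    | B d' hd' =>
      cases hr with
      | J y b hb => exact L gs gt gr (leibniz_BBJ hd hd' hb)
      | M w n hn => exact L gs gt gr (leibniz_BBM hd hd' hn)
      | B d'' hd'' => exact L gs gt gr (leibniz_BBB hd hd' hd'')

theorem jac_tag {i j k : ZMod 2} {s t r : X.tagSp} (hs : s ∈ X.tagSp.gr i) (ht : t ∈ X.tagSp.gr j)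
    (hr : r ∈ X.tagSp.gr k) : Jac X.tagBr i j k s t r := by
  refine gen_induction (P := fun s => Jac X.tagBr i j k s t r) ?_ ?_ (fun s hs => ?_) hs
  · simp [Jac]
  · intro s s' h h'
    simp only [Jac, map_add, LinearMap.add_apply, smul_add] at *
    linear_combination (norm := module) h + h'
  refine gen_induction (P := fun t => Jac X.tagBr i j k s t r) ?_ ?_ (fun t ht => ?_) ht
  · simp [Jac]
  · intro s s' h h'
    simp only [Jac, map_add, LinearMap.add_apply, smul_add] at *
    linear_combination (norm := module) h + h'
  refine gen_induction (P := fun r => Jac X.tagBr i j k s t r) ?_ ?_ (fun r hr => ?_) hr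
  · simp [Jac]
  · intro s s' h h'
    simp only [Jac, map_add, LinearMap.add_apply, smul_add] at *
    linear_combination (norm := module) h + h'
  exact jac_gen hs ht hr

end JTernary

/-- The adjoint form of the Jacobi identity, converse to `jac_of_leibniz`; it is the form used in an
arbitrary short algebra. -/
theorem IsLieSuper.leibniz {g : SuperSpace.{u}} {br : g →ₗ[ℂ] g →ₗ[ℂ] g} (hg : IsLieSuper g br)
    {i j k : ZMod 2} {x y z : g} (hx : x ∈ g.gr i) (hy : y ∈ g.gr j) (hz : z ∈ g.gr k) :
    br x (br y z) = br (br x y) z + ksign (i * j) • br y (br x z) := by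
  have h := hg.jacobi i j k x y z hx hy hz
  rw [hg.skew _ _ x (br y z) hx (hg.br_mem _ _ _ _ hy hz),
    hg.skew _ _ y (br x z) hy (hg.br_mem _ _ _ _ hx hz), hg.skew _ _ x z hx hz]
  linear_combination (norm := skip) -h
  simp only [map_sub, map_add, map_neg, map_smul, LinearMap.sub_apply, LinearMap.add_apply,
    LinearMap.neg_apply, LinearMap.smul_apply, smul_sub, smul_add, smul_neg]
  match_scalars
  all_goals
    rcases zmod2_cases i with h_i | h_i <;> rcases zmod2_cases j with h_j | h_j <;>
    rcases zmod2_cases k with h_k | h_k <;>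
    (try simp only [h_i, h_j, h_k, mul_zero, zero_mul, mul_one, add_zero,
      zero_add, ksign_zero, ksign_one, zmod2_one_add_one]) <;> norm_num

namespace JTernary

variable {X : JTernary.{u}}

theorem isLieSuper_tag (X : JTernary.{u}) : IsLieSuper X.tagSp X.tagBr := by
  refine ⟨fun _ _ _ _ hs ht => tagBr_mem hs ht, fun _ _ _ _ hs ht => tagBr_skew hs ht, ?_⟩
  intro i j k s t r hs ht hr
  have h := jac_tag hs ht hr
  unfold Jac at h
  with_reducible exact h

/-! ## The action of `sl₂` on `TAG(J, M)` -/

variable (X) in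
/-- The action of `sl₂` on `TAG(J, M)`. -/
noncomputable def tagAct : Sl2 →ₗ[ℂ] Module.End ℂ X.tagSp where
  toFun x := X.inJ ∘ₗ (lieL x).rTensor X.J ∘ₗ X.prJ + X.inM ∘ₗ (actV x).rTensor X.M ∘ₗ X.prM
  map_add' x y := by
    simp only [map_add, LinearMap.rTensor_add, LinearMap.add_comp, LinearMap.comp_add]; abel
  map_smul' s x := by
    simp only [map_smul, LinearMap.rTensor_smul, LinearMap.smul_comp, LinearMap.comp_smul,
      smul_add, RingHom.id_apply]

theorem tagAct_J (x y : Sl2) (a : X.J) : X.tagAct x (X.tJ y a) = X.tJ ⁅x, y⁆ a := by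
  simp [tagAct, prJ_tJ, prM_tJ, inJ_tmul, lieL]

theorem tagAct_M (x : Sl2) (v : V2) (m : X.M) : X.tagAct x (X.tM v m) = X.tM (x.1 *ᵥ v) m := by
  simp [tagAct, prJ_tM, prM_tM, inM_tmul, actV]

theorem tagAct_B (x : Sl2) (b : X.B) : X.tagAct x (X.tB b) = 0 := by
  simp [tagAct, prJ_tB, prM_tB]

theorem tagAct_lie (x y : Sl2) (t : X.tagSp) :
    X.tagAct ⁅x, y⁆ t = X.tagAct x (X.tagAct y t) - X.tagAct y (X.tagAct x t) := by
  have h : X.tagAct ⁅x, y⁆ = X.tagAct x ∘ₗ X.tagAct y - X.tagAct y ∘ₗ X.tagAct x := by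
    refine tag_ext ?_ ?_ ?_
    · intro z a
      simp only [LinearMap.sub_apply, LinearMap.comp_apply, tagAct_J, lie_lie, map_sub]
    · intro v m
      simp only [LinearMap.sub_apply, LinearMap.comp_apply, tagAct_M, lie_mulVec, map_sub]
    · intro b
      simp only [LinearMap.sub_apply, LinearMap.comp_apply, tagAct_B, map_zero, sub_zero]
  rw [h]; rfl

theorem tagAct_mem (x : Sl2) {i : ZMod 2} {t : X.tagSp} (ht : t ∈ X.tagSp.gr i) :
    X.tagAct x t ∈ X.tagSp.gr i := by
  refine tag_induction (P := fun t => X.tagAct x t ∈ X.tagSp.gr i) ?_ ?_ ?_ ?_ ?_ ht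
  · simp
  · intro s s' h h'
    rw [map_add]; exact add_mem h h'
  · intro y a ha
    rw [tagAct_J]; exact tJ_mem _ ha
  · intro v m hm
    rw [tagAct_M]; exact tM_mem _ hm
  · intro b hb
    rw [tagAct_B]; exact zero_mem _

/-- The bracket, `κ`, `⊙`, `det` and the action on `V` are all `sl₂`-equivariant, and `B(J, M)` is
invariant. -/
theorem tagAct_gen (x : Sl2) {i j : ZMod 2} {s t : X.tagSp} (hs : IsGen X i s) (ht : IsGen X j t) :
    X.tagAct x (X.tagBr s t) = X.tagBr (X.tagAct x s) t + X.tagBr s (X.tagAct x t) := by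
  cases hs with
  | J y a ha =>
    cases ht with
    | J z c hc =>
      simp only [tagBr_JJ, tagAct_J, tagAct_B, map_add, map_smul, smul_zero, leibniz_lie x y z,
        kappa_lie_left x y z, LinearMap.add_apply]
      module
    | M v m hm =>
      simp only [tagBr_JM, tagAct_M, tagAct_J, lie_mulVec, map_sub, map_add, map_neg, map_smul,
          LinearMap.sub_apply, LinearMap.add_apply,
    LinearMap.neg_apply, LinearMap.smul_apply, smul_sub, smul_add, smul_neg, sub_add_cancel]
    | B d hd =>
      simp only [tagBr_JB _ ha hd, tagAct_J, tagAct_B, map_zero, add_zero, map_neg, map_smul]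
  | M v m hm =>
    cases ht with
    | J y b hb =>
      simp only [tagBr_MJ _ _ hm hb, tagAct_M, tagAct_J, lie_mulVec, map_sub, map_add, map_neg,
          map_smul, LinearMap.sub_apply, LinearMap.add_apply,
    LinearMap.neg_apply, LinearMap.smul_apply, smul_sub, smul_add, smul_neg]
      module
    | M w n hn =>
      simp only [tagBr_MM, tagAct_M, tagAct_J, tagAct_B, map_sub, map_add, map_neg, map_smul,
          LinearMap.sub_apply, LinearMap.add_apply,
    LinearMap.neg_apply, LinearMap.smul_apply, smul_sub, smul_add, smul_neg, lie_symz, detForm_mulVec_right]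
      module
    | B d hd =>
      simp only [tagBr_MB _ hm hd, tagAct_M, tagAct_B, map_zero, add_zero, map_neg, map_smul]
  | B d hd =>
    cases ht with
    | J y b hb =>
      simp only [tagBr_BJ, tagAct_J, tagAct_B, map_zero, LinearMap.zero_apply, zero_add]
    | M w n hn =>
      simp only [tagBr_BM, tagAct_M, tagAct_B, map_zero, LinearMap.zero_apply, zero_add]
    | B d' hd' =>
      simp only [tagBr_BB, tagAct_B, map_zero, LinearMap.zero_apply, zero_add]

theorem tagAct_der (x : Sl2) (s t : X.tagSp) :
    X.tagAct x (X.tagBr s t) = X.tagBr (X.tagAct x s) t + X.tagBr s (X.tagAct x t) := by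
  have h : X.tagBr.compr₂ (X.tagAct x)
      = X.tagBr ∘ₗ X.tagAct x + X.tagBr.compl₁₂ LinearMap.id (X.tagAct x) := by
    refine bilin_ext fun i j s hs t ht => ?_
    simp only [LinearMap.compr₂_apply, LinearMap.add_apply, LinearMap.comp_apply,
      LinearMap.compl₁₂_apply, LinearMap.id_apply]
    refine gen_induction (P := fun s => X.tagAct x (X.tagBr s t)
      = X.tagBr (X.tagAct x s) t + X.tagBr s (X.tagAct x t)) ?_ ?_ (fun s hs => ?_) hs
    · simp
    · intro s s' h h'
      simp only [map_add, LinearMap.add_apply, h, h']; abel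
    refine gen_induction (P := fun t => X.tagAct x (X.tagBr s t)
      = X.tagBr (X.tagAct x s) t + X.tagBr s (X.tagAct x t)) ?_ ?_ (fun t ht => ?_) ht
    · simp
    · intro s s' h h'
      simp only [map_add, LinearMap.add_apply, h, h']; abel
    exact tagAct_gen x hs ht
  exact LinearMap.congr_fun₂ h s t

variable (X) in
/-- The `sl₂`-Lie superalgebra `TAG(J, M)`. -/
noncomputable abbrev tagLie : SL2LieSuper.{u} where
  space := X.tagSp
  br := X.tagBr
  isLie := isLieSuper_tag X
  act := X.tagAct
  act_lie := tagAct_lie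
  act_even x _ _ ht := tagAct_mem x ht
  act_der := tagAct_der

variable (X) in
theorem isShort_tagLie : IsShort X.tagLie :=
  ⟨X.J, X.M, ⟨X.B, grOf X.bInv, isInternal_grOf bInv_bInv⟩, X.tagE,
    fun _ y _ ha => tJ_mem y ha, fun _ v _ hm => tM_mem v hm, fun _ _ hd => tB_mem hd,
    tagAct_J, tagAct_M, tagAct_B⟩

variable (X) in
/-- The short `sl₂`-Lie superalgebra `TAG(J, M)`. -/
noncomputable abbrev tagObj : ShortSL2.{u} := ⟨X.tagLie, X.isShort_tagLie⟩

variable (X) in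
theorem isTag_tagObj : IsTag X X.tagObj X.tagE where
  gr_J _ x _ ha := tJ_mem x ha
  gr_M _ v _ hm := tM_mem v hm
  gr_clsJ _ _ _ _ ha hb := tB_mem (cJ_mem ha hb)
  gr_clsM _ _ _ _ hm hn := tB_mem (cM_mem hm hn)
  act_J := tagAct_J
  act_M := tagAct_M
  act_B := tagAct_B
  br_JJ_JJ i j k l a b c d ha hb hc hd := by
    have h := tagBr_BB (X.cJ a b) (X.cJ c d)
    rw [brB_cJ (cJ_mem ha hb) hc, delJ_cJ ha hb] at h
    simp only [angJ_apply, angM_apply, parM_apply, cJ_apply, cM_apply, ← tagE_tagJ,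
      ← tagE_tagM, ← tagE_tagB] at h
    with_reducible exact h
  br_JJ_MM i j k l a b m n ha hb hm hn := by
    have h := tagBr_BB (X.cJ a b) (X.cM m n)
    rw [brB_cM (cJ_mem ha hb) hm, delM_cJ ha hb] at h
    simp only [angJ_apply, angM_apply, parM_apply, cJ_apply, cM_apply, ← tagE_tagJ,
      ← tagE_tagM, ← tagE_tagB] at h
    with_reducible exact h
  br_MM_MM i j k l m n r s hm hn hr hs := by
    have h := tagBr_BB (X.cM m n) (X.cM r s)
    rw [brB_cM (cM_mem hm hn) hr, delM_cM] at h
    simp only [angJ_apply, angM_apply, parM_apply, cJ_apply, cM_apply, ← tagE_tagJ,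
      ← tagE_tagM, ← tagE_tagB] at h
    with_reducible exact h
  br_JJ_J i j a b x c ha hb := by
    have h := tagBr_BJ (X.cJ a b) x c
    rw [delJ_cJ ha hb] at h
    simp only [angJ_apply, angM_apply, parM_apply, cJ_apply, cM_apply, ← tagE_tagJ,
      ← tagE_tagM, ← tagE_tagB] at h
    with_reducible exact h
  br_MM_J i j k m n x c hm hn hc := by
    have h := tagBr_BJ (X.cM m n) x c
    rw [delJ_cM hm hn, parJ_apply _ _ _ _ hc] at h
    simp only [cM_apply, ← tagE_tagJ, ← tagE_tagB] at h
    with_reducible exact h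
  br_JJ_M i j a b v m ha hb := by
    have h := tagBr_BM (X.cJ a b) v m
    rw [delM_cJ ha hb] at h
    simp only [angJ_apply, angM_apply, parM_apply, cJ_apply, cM_apply, ← tagE_tagJ,
      ← tagE_tagM, ← tagE_tagB] at h
    with_reducible exact h
  br_MM_M m n v r := by
    have h := tagBr_BM (X.cM m n) v r
    rw [delM_cM] at h
    simp only [angJ_apply, angM_apply, parM_apply, cJ_apply, cM_apply, ← tagE_tagJ,
      ← tagE_tagM, ← tagE_tagB] at h
    with_reducible exact h
  br_J_J := tagBr_JJ
  br_J_M := tagBr_JM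
  br_M_M := tagBr_MM

/-! ## Morphisms from `TAG(J, M)` -/

theorem kappa_sl2H : kappa sl2H sl2H = 8 := by
  simp [kappa, sl2H, Matrix.trace_fin_two]; norm_num

/-- The vector `e₂` of the natural module. -/
def v2 : V2 := ![0, 1]

theorem detForm_v1_v2 : detForm v1 v2 = 1 := by simp [detForm, v1, v2]

/-- Since `[h, h] = 0` and `½ κ(h, h) = 4`, the bracket of `h ⊗ a` and `h ⊗ b` is the class alone,
up to the factor 4. -/
theorem tB_cJ (a b : X.J) :
    X.tB (X.cJ a b) = (1 / 4 : ℂ) • X.tagBr (X.tJ sl2H a) (X.tJ sl2H b) := by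
  rw [tagBr_JJ, lie_self, kappa_sl2H, map_zero, LinearMap.zero_apply, zero_add]
  module

theorem tB_cM (m n : X.M) :
    X.tB (X.cM m n) = X.tagBr (X.tM v1 m) (X.tM v2 n) - X.tJ (symz v1 v2) (X.star m n) := by
  rw [tagBr_MM, detForm_v1_v2]; module

/-! ### A criterion for preserving the bracket of `TAG(J, M)` -/

section Hom

variable {g : SuperSpace.{u}} {br : g →ₗ[ℂ] g →ₗ[ℂ] g} (hg : IsLieSuper g br)
  {f : X.tagSp →ₗ[ℂ] g} (hf : ∀ i, ∀ t ∈ X.tagSp.gr i, f t ∈ g.gr i)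
  (JJ : ∀ x y a b, f (X.tagBr (X.tJ x a) (X.tJ y b)) = br (f (X.tJ x a)) (f (X.tJ y b)))
  (JM : ∀ x v a m, f (X.tagBr (X.tJ x a) (X.tM v m)) = br (f (X.tJ x a)) (f (X.tM v m)))
  (MM : ∀ v w m n, f (X.tagBr (X.tM v m) (X.tM w n)) = br (f (X.tM v m)) (f (X.tM w n)))
  (BJ : ∀ b x a, f (X.tJ x (X.delJ b a)) = br (f (X.tB b)) (f (X.tJ x a)))
  (BM : ∀ b v m, f (X.tM v (X.delM b m)) = br (f (X.tB b)) (f (X.tM v m)))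

include hg hf JJ MM BJ BM

/-- A class is a bracket of generators outside `B(J, M)`, up to an element of `sl₂ ⊗ J`. The Leibniz
rules in source and target then reduce this bracket to the ones in the hypotheses. -/
theorem map_tagBr_BB {p q : ZMod 2} {b d : X.B} (hb : b ∈ grOf X.bInv p) (hd : d ∈ grOf X.bInv q) :
    f (X.tagBr (X.tB b) (X.tB d)) = br (f (X.tB b)) (f (X.tB d)) := by
  refine B_induction (P := fun d => f (X.tagBr (X.tB b) (X.tB d)) = br (f (X.tB b)) (f (X.tB d)))
    ?_ ?_ ?_ ?_ hd
  · simp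
  · intro c c' h h'
    simp only [map_add, h, h']
  · intro i j _ a ha c hc
    rw [tB_cJ, map_smul, map_smul, leibniz_BJJ hb ha hc, tagBr_BJ, tagBr_BJ, map_add, map_smul, JJ,
      JJ, BJ, BJ, map_smul, JJ, map_smul,
      hg.leibniz (hf _ _ (tB_mem hb)) (hf _ _ (tJ_mem sl2H ha)) (hf _ _ (tJ_mem sl2H hc))]
  · intro i j _ m hm n hn
    rw [tB_cM, map_sub, map_sub, leibniz_BMM hb hm hn, tagBr_BJ, tagBr_BM, tagBr_BM, map_add,
      map_smul, MM, MM, BJ, BM, BM, map_sub, MM, map_sub,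
      hg.leibniz (hf _ _ (tB_mem hb)) (hf _ _ (tM_mem v1 hm)) (hf _ _ (tM_mem v2 hn))]

include JM

theorem map_tagBr_gen {i j : ZMod 2} {s t : X.tagSp} (hs : IsGen X i s) (ht : IsGen X j t) :
    f (X.tagBr s t) = br (f s) (f t) := by
  have sk : f (X.tagBr t s) = br (f t) (f s) → f (X.tagBr s t) = br (f s) (f t) := fun h => by
    rw [tagBr_skew hs.mem ht.mem, map_neg, map_smul, h,
      ← hg.skew _ _ _ _ (hf _ _ hs.mem) (hf _ _ ht.mem)]
  cases hs with
  | J y a ha =>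
    cases ht with
    | J z c hc => exact JJ _ _ _ _
    | M v m hm => exact JM _ _ _ _
    | B d hd =>
      refine sk ?_
      rw [tagBr_BJ, BJ]
  | M v m hm =>
    cases ht with
    | J y b hb => exact sk (JM _ _ _ _)
    | M w n hn => exact MM _ _ _ _
    | B d hd =>
      refine sk ?_
      rw [tagBr_BM, BM]
  | B d hd =>
    cases ht with
    | J y b hb => rw [tagBr_BJ, BJ]
    | M w n hn => rw [tagBr_BM, BM]
    | B d' hd' => exact map_tagBr_BB hg hf JJ MM BJ BM hd hd'

/-- An even linear map from `TAG(J, M)` preserves the bracket if it does so for the brackets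
of generators other than those of two elements of `B(J, M)`. -/
theorem map_tagBr (s t : X.tagSp) : f (X.tagBr s t) = br (f s) (f t) := by
  have h : X.tagBr.compr₂ f = br.compl₁₂ f f := by
    refine bilin_ext fun i j s hs t ht => ?_
    simp only [LinearMap.compr₂_apply, LinearMap.compl₁₂_apply]
    refine gen_induction (P := fun s => f (X.tagBr s t) = br (f s) (f t)) ?_ ?_ (fun s hs => ?_) hs
    · simp
    · intro s s' h h'
      simp only [map_add, LinearMap.add_apply, h, h']
    refine gen_induction (P := fun t => f (X.tagBr s t) = br (f s) (f t)) ?_ ?_ (fun t ht => ?_) ht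
    · simp
    · intro s s' h h'
      simp only [map_add, LinearMap.add_apply, h, h']
    exact map_tagBr_gen hg hf JJ JM MM BJ BM hs ht
  exact LinearMap.congr_fun₂ h s t

end Hom

/-! ## `TAG` on morphisms -/

section Map

variable {Y : JTernary.{u}} (φ : JTernary.Hom X Y)

theorem Hom.map_partM (m n r : X.M) :
    φ.onM (X.partM m n r) = Y.partM (φ.onM m) (φ.onM n) (φ.onM r) := by
  simp only [partM, map_sub, map_add, map_neg, map_smul, LinearMap.sub_apply, LinearMap.add_apply,
    LinearMap.neg_apply, LinearMap.smul_apply, smul_sub, smul_add, smul_neg, φ.map_bul, φ.map_star, φ.map_tri]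

/-- The map `J ⊗ J ⊕ M ⊗ M → B(J', M')` defined by a morphism. -/
noncomputable def preMapB : X.PreB →ₗ[ℂ] Y.B :=
  (TensorProduct.lift (Y.cJ.compl₁₂ φ.onJ φ.onJ)).coprod
    (TensorProduct.lift (Y.cM.compl₁₂ φ.onM φ.onM))

theorem preMapB_relator {t : X.PreB} (h : X.Relator t) : preMapB φ t = 0 := by
  cases h with
  | ab i j a b ha hb =>
    have h := cJ_skew (φ.evenJ _ _ ha) (φ.evenJ _ _ hb)
    simp only [preMapB, LinearMap.coprod_apply, map_sub, map_add, map_neg, map_smul,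
        LinearMap.sub_apply, LinearMap.add_apply,
    LinearMap.neg_apply, LinearMap.smul_apply, smul_sub, smul_add, smul_neg, map_zero, add_zero, TensorProduct.lift.tmul,
      LinearMap.compl₁₂_apply, h, neg_add_cancel]
  | mn i j m n hm hn =>
    have h := cM_symm (φ.evenM _ _ hm) (φ.evenM _ _ hn)
    simp only [preMapB, LinearMap.coprod_apply, map_sub, map_add, map_neg, map_smul,
        LinearMap.sub_apply, LinearMap.add_apply,
    LinearMap.neg_apply, LinearMap.smul_apply, smul_sub, smul_add, smul_neg, map_zero, zero_add, TensorProduct.lift.tmul,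
      LinearMap.compl₁₂_apply, h, sub_self]
  | abc i j k a b c ha hb hc =>
    have h := cJ_cyclic (φ.evenJ _ _ ha) (φ.evenJ _ _ hb) (φ.evenJ _ _ hc)
    simpa only [preMapB, LinearMap.coprod_apply, map_sub, map_add, map_neg, map_smul,
        LinearMap.sub_apply, LinearMap.add_apply,
    LinearMap.neg_apply, LinearMap.smul_apply, smul_sub, smul_add, smul_neg, map_zero, add_zero, TensorProduct.lift.tmul,
      LinearMap.compl₁₂_apply, φ.map_dot] using h
  | amn i j k a m n ha hm hn =>
    have h := cM_bul (φ.evenJ _ _ ha) (φ.evenM _ _ hm) (φ.evenM _ _ hn)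
    simp only [preMapB, LinearMap.coprod_apply, map_sub, map_add, map_neg, map_smul,
        LinearMap.sub_apply, LinearMap.add_apply,
    LinearMap.neg_apply, LinearMap.smul_apply, smul_sub, smul_add, smul_neg, TensorProduct.lift.tmul,
      LinearMap.compl₁₂_apply, φ.map_bul, φ.map_star]
    rw [← h]; abel
  | mnrs i j k l m n r s hm hn hr hs =>
    have h := cM_part (φ.evenM _ _ hm) (φ.evenM _ _ hn) (φ.evenM _ _ hr) (φ.evenM _ _ hs)
    simpa only [preMapB, LinearMap.coprod_apply, map_sub, map_add, map_neg, map_smul,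
        LinearMap.sub_apply, LinearMap.add_apply,
    LinearMap.neg_apply, LinearMap.smul_apply, smul_sub, smul_add, smul_neg, map_zero, zero_add, TensorProduct.lift.tmul,
      LinearMap.compl₁₂_apply, Hom.map_partM] using h

/-- The map `B(J, M) → B(J', M')` defined by a morphism. -/
noncomputable def mapB : X.B →ₗ[ℂ] Y.B :=
  X.relB.liftQ (preMapB φ) (relB_le_ker _ fun _ h => preMapB_relator φ h)

theorem mapB_cJ (a b : X.J) : mapB φ (X.cJ a b) = Y.cJ (φ.onJ a) (φ.onJ b) := by
  simp [mapB, cJ, preMapB]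

theorem mapB_cM (m n : X.M) : mapB φ (X.cM m n) = Y.cM (φ.onM m) (φ.onM n) := by
  simp [mapB, cM, preMapB]

theorem mapB_mem {i : ZMod 2} {b : X.B} (hb : b ∈ grOf X.bInv i) : mapB φ b ∈ grOf Y.bInv i := by
  refine B_induction (P := fun b => mapB φ b ∈ grOf Y.bInv i) ?_ ?_ ?_ ?_ hb
  · simp
  · intro b b' h h'
    rw [map_add]; exact add_mem h h'
  · rintro i j rfl a ha b hb
    rw [mapB_cJ]; exact cJ_mem (φ.evenJ _ _ ha) (φ.evenJ _ _ hb)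
  · rintro i j rfl a ha b hb
    rw [mapB_cM]; exact cM_mem (φ.evenM _ _ ha) (φ.evenM _ _ hb)

theorem map_delJ (b : X.B) (c : X.J) : φ.onJ (X.delJ b c) = Y.delJ (mapB φ b) (φ.onJ c) := by
  have h : X.delJ.compr₂ φ.onJ = (Y.delJ ∘ₗ mapB φ).compl₁₂ LinearMap.id φ.onJ := by
    refine B_ext (fun i j a ha b hb => LinearMap.ext fun c => ?_)
      (fun i j m hm n hn => SuperSpace.hom_ext fun k c hc => ?_)
    · simp only [LinearMap.compr₂_apply, LinearMap.compl₁₂_apply, LinearMap.comp_apply,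
        LinearMap.id_apply, mapB_cJ, delJ_cJ ha hb, delJ_cJ (φ.evenJ _ _ ha) (φ.evenJ _ _ hb),
        angJ_apply, angleJ, map_sub, map_add, map_neg, map_smul, LinearMap.sub_apply, LinearMap.add_apply,
    LinearMap.neg_apply, LinearMap.smul_apply, smul_sub, smul_add, smul_neg, φ.map_dot]
    · simp only [LinearMap.compr₂_apply, LinearMap.compl₁₂_apply, LinearMap.comp_apply,
        LinearMap.id_apply, mapB_cM, delJ_cM hm hn, delJ_cM (φ.evenM _ _ hm) (φ.evenM _ _ hn),
        parJ_apply _ _ _ _ hc, parJ_apply _ _ _ _ (φ.evenJ _ _ hc), partJ, map_sub, map_add, map_neg, map_smul, LinearMap.sub_apply, LinearMap.add_apply,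
    LinearMap.neg_apply, LinearMap.smul_apply, smul_sub, smul_add, smul_neg, φ.map_star,
        φ.map_bul]
  exact LinearMap.congr_fun₂ h b c

theorem map_delM (b : X.B) (m : X.M) : φ.onM (X.delM b m) = Y.delM (mapB φ b) (φ.onM m) := by
  have h : X.delM.compr₂ φ.onM = (Y.delM ∘ₗ mapB φ).compl₁₂ LinearMap.id φ.onM := by
    refine B_ext (fun i j a ha b hb => LinearMap.ext fun c => ?_)
      (fun i j m hm n hn => LinearMap.ext fun c => ?_)
    · simp only [LinearMap.compr₂_apply, LinearMap.compl₁₂_apply, LinearMap.comp_apply,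
        LinearMap.id_apply, mapB_cJ, delM_cJ ha hb, delM_cJ (φ.evenJ _ _ ha) (φ.evenJ _ _ hb),
        angM_apply, angleM, map_sub, map_add, map_neg, map_smul, LinearMap.sub_apply, LinearMap.add_apply,
    LinearMap.neg_apply, LinearMap.smul_apply, smul_sub, smul_add, smul_neg, φ.map_bul]
    · simp only [LinearMap.compr₂_apply, LinearMap.compl₁₂_apply, LinearMap.comp_apply,
        LinearMap.id_apply, mapB_cM, delM_cM, parM_apply, Hom.map_partM]
  exact LinearMap.congr_fun₂ h b m

/-- The linear map `TAG(J, M) → TAG(J', M')` defined by a morphism. -/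
noncomputable def tagLin : X.tagSp →ₗ[ℂ] Y.tagSp :=
  Y.inJ ∘ₗ φ.onJ.lTensor Sl2 ∘ₗ X.prJ + Y.inM ∘ₗ φ.onM.lTensor V2 ∘ₗ X.prM
    + Y.tB ∘ₗ mapB φ ∘ₗ X.prB

theorem tagLin_J (x : Sl2) (a : X.J) : tagLin φ (X.tJ x a) = Y.tJ x (φ.onJ a) := by
  simp [tagLin, prJ_tJ, prM_tJ, prB_tJ, inJ_tmul]

theorem tagLin_M (v : V2) (m : X.M) : tagLin φ (X.tM v m) = Y.tM v (φ.onM m) := by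
  simp [tagLin, prJ_tM, prM_tM, prB_tM, inM_tmul]

theorem tagLin_B (b : X.B) : tagLin φ (X.tB b) = Y.tB (mapB φ b) := by
  simp [tagLin, prJ_tB, prM_tB, prB_tB]

theorem tagLin_mem (i : ZMod 2) (t : X.tagSp) (ht : t ∈ X.tagSp.gr i) :
    tagLin φ t ∈ Y.tagSp.gr i := by
  refine tag_induction (P := fun t => tagLin φ t ∈ Y.tagSp.gr i) ?_ ?_ ?_ ?_ ?_ ht
  · simp
  · intro s s' h h'
    rw [map_add]; exact add_mem h h'
  · intro y a ha
    rw [tagLin_J]; exact tJ_mem _ (φ.evenJ _ _ ha)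
  · intro v m hm
    rw [tagLin_M]; exact tM_mem _ (φ.evenM _ _ hm)
  · intro b hb
    rw [tagLin_B]; exact tB_mem (mapB_mem φ hb)

theorem tagLin_br (s t : X.tagSp) : tagLin φ (X.tagBr s t) = Y.tagBr (tagLin φ s) (tagLin φ t) := by
  refine map_tagBr (isLieSuper_tag Y) (tagLin_mem φ) ?_ ?_ ?_ ?_ ?_ s t
  · intro x y a b
    simp only [tagLin_J, tagLin_B, tagBr_JJ, map_add, map_smul, mapB_cJ, φ.map_dot]
  · intro x v a m
    simp only [tagLin_J, tagLin_M, tagBr_JM, φ.map_bul]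
  · intro v w m n
    simp only [tagLin_J, tagLin_M, tagLin_B, tagBr_MM, map_add, map_smul, mapB_cM, φ.map_star]
  · intro b x a
    rw [tagLin_J, tagLin_J, tagLin_B, tagBr_BJ, map_delJ]
  · intro b v m
    rw [tagLin_M, tagLin_M, tagLin_B, tagBr_BM, map_delM]

theorem tagLin_act (x : Sl2) (t : X.tagSp) :
    tagLin φ (X.tagAct x t) = Y.tagAct x (tagLin φ t) := by
  have h : tagLin φ ∘ₗ X.tagAct x = Y.tagAct x ∘ₗ tagLin φ := by
    refine tag_ext ?_ ?_ ?_ <;> intros <;>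
    simp only [LinearMap.comp_apply, tagAct_J, tagAct_M, tagAct_B, tagLin_J, tagLin_M, tagLin_B,
      map_zero]
  exact LinearMap.congr_fun h t

/-- The morphism `TAG(J, M) → TAG(J', M')` defined by a morphism. -/
noncomputable def tagMap : ShortSL2.Hom X.tagObj Y.tagObj where
  lin := tagLin φ
  even := tagLin_mem φ
  map_br := tagLin_br φ
  map_act := tagLin_act φ

end Map

theorem tag_cls_ext {Z : Type*} [AddCommGroup Z] [Module ℂ Z] {f g : X.tagSp →ₗ[ℂ] Z}
    (hJ : ∀ x a, f (X.tJ x a) = g (X.tJ x a)) (hM : ∀ v m, f (X.tM v m) = g (X.tM v m))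
    (hcJ : ∀ a b, f (X.tB (X.cJ a b)) = g (X.tB (X.cJ a b)))
    (hcM : ∀ m n, f (X.tB (X.cM m n)) = g (X.tB (X.cM m n))) : f = g := by
  have h : f ∘ₗ X.tB = g ∘ₗ X.tB :=
    B_ext (fun _ _ a _ b _ => hcJ a b) (fun _ _ m _ n _ => hcM m n)
  exact tag_ext hJ hM fun b => LinearMap.congr_fun h b

/-- The functor `TAG`. -/
noncomputable def tagFunctor : JTernary.{u} ⥤ ShortSL2.{u} where
  obj X := X.tagObj
  map φ := tagMap φ
  map_id X := by
    refine ShortSL2.Hom.ext (tag_cls_ext (X := X) ?_ ?_ ?_ ?_)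
    · exact fun x a => tagLin_J _ x a
    · exact fun v m => tagLin_M _ v m
    · exact fun a b => (tagLin_B _ _).trans (congrArg X.tB (mapB_cJ _ a b))
    · exact fun m n => (tagLin_B _ _).trans (congrArg X.tB (mapB_cM _ m n))
  map_comp {X Y Z} φ ψ := by
    refine ShortSL2.Hom.ext ?_
    change tagLin (φ ≫ ψ) = tagLin ψ ∘ₗ tagLin φ
    refine tag_cls_ext (X := X) ?_ ?_ ?_ ?_ <;> intros <;>
    simp only [LinearMap.comp_apply, tagLin_J, tagLin_M, tagLin_B, mapB_cJ, mapB_cM] <;> rfl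

theorem isTagMap_tagFunctor {X Y : JTernary.{u}} (φ : X ⟶ Y) :
    IsTagMap X.tagE Y.tagE φ (tagFunctor.map φ) where
  map_J := tagLin_J φ
  map_M := tagLin_M φ
  map_clsJ a b := (tagLin_B φ _).trans (congrArg Y.tB (mapB_cJ φ a b))
  map_clsM m n := (tagLin_B φ _).trans (congrArg Y.tB (mapB_cM φ m n))

end JTernary

/-! ## Weights of a short `sl₂`-Lie superalgebra -/

theorem lie_H_E : ⁅sl2H, sl2E⁆ = (2 : ℂ) • sl2E := by
  apply Subtype.ext
  simp only [sl2_coe_smul, coe_lie, sl2H, sl2E]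
  ext i j
  fin_cases i <;> fin_cases j <;> simp [Matrix.mul_apply, Fin.sum_univ_two]
  norm_num

theorem lie_H_F : ⁅sl2H, sl2F⁆ = (-2 : ℂ) • sl2F := by
  apply Subtype.ext
  simp only [sl2_coe_smul, coe_lie, sl2H, sl2F]
  ext i j
  fin_cases i <;> fin_cases j <;> simp [Matrix.mul_apply, Fin.sum_univ_two]
  norm_num

theorem lie_E_F : ⁅sl2E, sl2F⁆ = sl2H := by
  apply Subtype.ext
  simp only [coe_lie, sl2H, sl2F, sl2E]
  ext i j
  fin_cases i <;> fin_cases j <;> simp [Matrix.mul_apply, Fin.sum_univ_two]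

theorem lie_H_lie_lie (y : Sl2) : ⁅sl2H, ⁅sl2H, ⁅sl2H, y⁆⁆⁆ = (4 : ℂ) • ⁅sl2H, y⁆ := by
  rw [lie_lie_right sl2H sl2H ⁅sl2H, y⁆, JTernary.kappa_sl2H, kappa_lie, lie_self, ← kappaL_apply,
      map_zero,
    LinearMap.zero_apply]
  module

theorem sl2H_mulVec_mulVec (v : V2) : sl2H.1 *ᵥ (sl2H.1 *ᵥ v) = v := by
  ext i
  fin_cases i <;> simp [sl2H, Matrix.mulVec, dotProduct, Fin.sum_univ_two]

namespace ShortSL2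

variable (g : ShortSL2.{u})

/-- The action of `e`. -/
def opE : Module.End ℂ g.space := g.act sl2E

/-- The action of `f`. -/
def opF : Module.End ℂ g.space := g.act sl2F

/-- The action of `h`. -/
def opH : Module.End ℂ g.space := g.act sl2H

variable {g}

theorem act_eq (s : Sl2) (x : g.space) :
    g.act s x = s.1 0 0 • g.opH x + s.1 0 1 • g.opE x + s.1 1 0 • g.opF x := by
  conv_lhs => rw [sl2_eq s]
  simp only [map_add, map_smul, LinearMap.add_apply, LinearMap.smul_apply, opH, opE, opF]

theorem opH_opE (x : g.space) : g.opH (g.opE x) = g.opE (g.opH x) + (2 : ℂ) • g.opE x := by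
  have h := g.act_lie sl2H sl2E x
  rw [lie_H_E, map_smul, LinearMap.smul_apply] at h
  exact (eq_add_of_sub_eq' h.symm)

theorem opH_opF (x : g.space) : g.opH (g.opF x) = g.opF (g.opH x) - (2 : ℂ) • g.opF x := by
  have h := g.act_lie sl2H sl2F x
  rw [lie_H_F, map_smul, LinearMap.smul_apply] at h
  rw [sub_eq_add_neg, ← neg_smul]
  exact (eq_add_of_sub_eq' h.symm)

theorem opE_opF (x : g.space) : g.opE (g.opF x) = g.opF (g.opE x) + g.opH x := by
  have h := g.act_lie sl2E sl2F x
  rw [lie_E_F] at h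
  exact (eq_add_of_sub_eq' h.symm)

theorem opE_br (x y : g.space) : g.opE (g.br x y) = g.br (g.opE x) y + g.br x (g.opE y) :=
  g.act_der sl2E x y

theorem opF_br (x y : g.space) : g.opF (g.br x y) = g.br (g.opF x) y + g.br x (g.opF y) :=
  g.act_der sl2F x y

theorem opH_br (x y : g.space) : g.opH (g.br x y) = g.br (g.opH x) y + g.br x (g.opH y) :=
  g.act_der sl2H x y

theorem opF_mem {i : ZMod 2} {x : g.space} (hx : x ∈ g.space.gr i) : g.opF x ∈ g.space.gr i :=
  g.act_even sl2F i x hx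

theorem opH_mem {i : ZMod 2} {x : g.space} (hx : x ∈ g.space.gr i) : g.opH x ∈ g.space.gr i :=
  g.act_even sl2H i x hx

/-- On the three summands `h` satisfies `h³ = 4h`, `h² = 1` and `h = 0`, and `t⁵ - 5t³ + 4t = t(t² -
1)(t² - 4)` is a common multiple. Shortness of `g` enters the construction of `T̂` and of the counit
only through this identity. -/
theorem opH_five (x : g.space) :
    g.opH (g.opH (g.opH (g.opH (g.opH x))))
      = (5 : ℂ) • g.opH (g.opH (g.opH x)) - (4 : ℂ) • g.opH x := by
  obtain ⟨J, M, D, Φ, -, -, -, hJ, hM, hD⟩ := g.short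
  have hJ' : ∀ s : Sl2 ⊗[ℂ] J, g.opH (g.opH (g.opH (Φ (s, 0, 0)))) = (4 : ℂ) • g.opH (Φ (s, 0, 0)) := by
    intro s
    have h : (g.opH ∘ₗ g.opH ∘ₗ g.opH) ∘ₗ Φ.toLinearMap ∘ₗ LinearMap.inl ℂ _ _
        = ((4 : ℂ) • g.opH) ∘ₗ Φ.toLinearMap ∘ₗ LinearMap.inl ℂ _ _ := by
      refine TensorProduct.ext' fun y a => ?_
      change g.opH (g.opH (g.opH (Φ (y ⊗ₜ a, 0, 0)))) = (4 : ℂ) • g.opH (Φ (y ⊗ₜ a, 0, 0))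
      simp only [opH, hJ, lie_H_lie_lie]
      rw [← map_smul]
      congr 1
      simp [TensorProduct.smul_tmul']
    exact LinearMap.congr_fun h s
  have hM' : ∀ s : V2 ⊗[ℂ] M, g.opH (g.opH (Φ (0, s, 0))) = Φ (0, s, 0) := by
    intro s
    have h : (g.opH ∘ₗ g.opH) ∘ₗ Φ.toLinearMap ∘ₗ LinearMap.inr ℂ _ _ ∘ₗ LinearMap.inl ℂ _ _
        = Φ.toLinearMap ∘ₗ LinearMap.inr ℂ _ _ ∘ₗ LinearMap.inl ℂ _ _ := by
      refine TensorProduct.ext' fun v m => ?_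
      change g.opH (g.opH (Φ (0, v ⊗ₜ m, 0))) = Φ (0, v ⊗ₜ m, 0)
      simp only [opH, hM, sl2H_mulVec_mulVec]
    exact LinearMap.congr_fun h s
  obtain ⟨⟨s, t, d⟩, rfl⟩ := Φ.surjective x
  have e : ((s, t, d) : (Sl2 ⊗[ℂ] J) × (V2 ⊗[ℂ] M) × D) = (s, 0, 0) + ((0, t, 0) + (0, 0, d)) := by
    simp
  have hd : g.opH (Φ (0, 0, d)) = 0 := hD _ _
  rw [e, map_add, map_add]
  simp only [map_add, hJ', hM', hd, map_smul, map_zero]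
  module

theorem mem_wt {c : ℂ} {x : g.space} : x ∈ wt g c ↔ g.opH x = c • x :=
  Module.End.mem_eigenspace_iff

theorem opE_wt {c d : ℂ} {x : g.space} (hx : x ∈ wt g c) (h : c + 2 = d := by norm_num) :
    g.opE x ∈ wt g d := by
  rw [mem_wt] at *
  rw [opH_opE, hx, map_smul, ← h]; module

theorem opF_wt {c d : ℂ} {x : g.space} (hx : x ∈ wt g c) (h : c - 2 = d := by norm_num) :
    g.opF x ∈ wt g d := by
  rw [mem_wt] at *
  rw [opH_opF, hx, map_smul, ← h]; module

theorem br_wt {c d e : ℂ} {x y : g.space} (hx : x ∈ wt g c) (hy : y ∈ wt g d)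
    (h : c + d = e := by norm_num) : g.br x y ∈ wt g e := by
  rw [mem_wt] at *
  rw [opH_br, hx, hy, map_smul, map_smul, LinearMap.smul_apply, ← h]; module

/-- All vanishing statements have this source: `[J, J]`, `[J, M]`, `f³ J` and `f² M` would have
weights 4, 3, -4 and -3. -/
theorem eq_zero_of_wt {c : ℂ} {x : g.space} (hx : x ∈ wt g c)
    (h : c ^ 5 - 5 * c ^ 3 + 4 * c ≠ 0 := by norm_num) : x = 0 := by
  rw [mem_wt] at hx
  have h5 := opH_five x
  simp only [hx, map_smul, smul_smul] at h5
  have : (c ^ 5 - 5 * c ^ 3 + 4 * c) • x = 0 := by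
    linear_combination (norm := module) h5
  exact (smul_eq_zero.1 this).resolve_left h

/-! ### Highest weight vectors -/

section Weights

variable {a b : g.space} (ha : a ∈ wt g 2) (hb : b ∈ wt g 2) {m n : g.space} (hm : m ∈ wt g 1)
  (hn : n ∈ wt g 1)

include ha

theorem opE_two : g.opE a = 0 := eq_zero_of_wt (opE_wt ha (d := 4))

theorem opH_two : g.opH a = (2 : ℂ) • a := mem_wt.1 ha

theorem opE_opF_two : g.opE (g.opF a) = (2 : ℂ) • a := by
  rw [opE_opF, opE_two ha, opH_two ha, map_zero, zero_add]

theorem opH_opF_two : g.opH (g.opF a) = 0 := by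
  rw [opH_opF, opH_two ha, map_smul, sub_self]

theorem opE_opF_opF_two : g.opE (g.opF (g.opF a)) = (2 : ℂ) • g.opF a := by
  rw [opE_opF, opE_opF_two ha, opH_opF_two ha, map_smul, add_zero]

theorem opH_opF_opF_two : g.opH (g.opF (g.opF a)) = (-2 : ℂ) • g.opF (g.opF a) := by
  rw [opH_opF, opH_opF_two ha, map_zero]; module

theorem opF_opF_opF_two : g.opF (g.opF (g.opF a)) = 0 :=
  eq_zero_of_wt (c := -4) (opF_wt (c := -2) (opF_wt (c := 0) (opF_wt ha)))

/-- Since `ef = 2` on vectors of weight 2, a vector of `f J` killed by `e` is zero. This separates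
`f J` from the invariants inside the space of weight 0. -/
theorem eq_zero_of_opF_two (h : g.opE (g.opF a) = 0) : a = 0 := by
  rw [opE_opF_two ha] at h
  exact (smul_eq_zero.1 h).resolve_left (by norm_num)

omit ha
include hm

theorem opE_one : g.opE m = 0 := eq_zero_of_wt (opE_wt hm (d := 3))

theorem opH_one : g.opH m = m := by rw [mem_wt.1 hm, one_smul]

theorem opE_opF_one : g.opE (g.opF m) = m := by
  rw [opE_opF, opE_one hm, opH_one hm, map_zero, zero_add]

theorem opH_opF_one : g.opH (g.opF m) = -g.opF m := by
  rw [opH_opF, opH_one hm]; module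

theorem opF_opF_one : g.opF (g.opF m) = 0 :=
  eq_zero_of_wt (c := -3) (opF_wt (c := -1) (opF_wt hm))

end Weights

/-- An element of `g` is invariant if `sl₂` annihilates it. -/
structure IsInv (x : g.space) : Prop where
  H : g.opH x = 0
  E : g.opE x = 0
  F : g.opF x = 0

/-- The vector `f²x` has weight -4 and vanishes. Hence `0 = e f (f x) = f e f x + h f x`, where `e f
x = f e x + h x = 0` and `h f x = -2 f x`. -/
theorem IsInv.of_wt {x : g.space} (hx : x ∈ wt g 0) (hE : g.opE x = 0) : IsInv x := by
  have hH : g.opH x = 0 := by rw [mem_wt.1 hx, zero_smul]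
  refine ⟨hH, hE, ?_⟩
  have hF : g.opF x ∈ wt g (-2) := opF_wt hx
  have hFF : g.opF (g.opF x) = 0 := eq_zero_of_wt (c := -4) (opF_wt hF)
  have h := opE_opF (g.opF x)
  rw [hFF, map_zero, opE_opF x, hE, hH, map_zero, add_zero, map_zero, zero_add, mem_wt.1 hF] at h
  exact (smul_eq_zero.1 h.symm).resolve_left (by norm_num)

theorem IsInv.act {x : g.space} (h : IsInv x) (s : Sl2) : g.act s x = 0 := by
  rw [act_eq, h.H, h.E, h.F]; simp

/-! ### The operations and the brackets of highest weight vectors -/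

section Operations

variable (g)

/-- `½ [a, fb]`. -/
noncomputable def oDot : g.space →ₗ[ℂ] g.space →ₗ[ℂ] g.space :=
  (1 / 2 : ℂ) • g.br.compl₁₂ LinearMap.id g.opF

/-- `[a, fm]`. -/
noncomputable def oBul : g.space →ₗ[ℂ] g.space →ₗ[ℂ] g.space := g.br.compl₁₂ LinearMap.id g.opF

/-- `-[[m, fn], r]`. -/
noncomputable def oTri : g.space →ₗ[ℂ] g.space →ₗ[ℂ] g.space →ₗ[ℂ] g.space :=
  -((g.br.compl₁₂ LinearMap.id g.opF).compr₂ g.br)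

/-- `¼ [fa, fb]`. -/
noncomputable def oJ : g.space →ₗ[ℂ] g.space →ₗ[ℂ] g.space :=
  (1 / 4 : ℂ) • g.br.compl₁₂ g.opF g.opF

/-- `½ ([m, fn] - [fm, n])`. -/
noncomputable def oM : g.space →ₗ[ℂ] g.space →ₗ[ℂ] g.space :=
  (1 / 2 : ℂ) • (g.br.compl₁₂ LinearMap.id g.opF - g.br ∘ₗ g.opF)

variable {g}

theorem oDot_apply (x y : g.space) : g.oDot x y = (1 / 2 : ℂ) • g.br x (g.opF y) := rfl
theorem oBul_apply (x y : g.space) : g.oBul x y = g.br x (g.opF y) := rfl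
theorem oTri_apply (x y z : g.space) : g.oTri x y z = -g.br (g.br x (g.opF y)) z := rfl
theorem oJ_apply (x y : g.space) : g.oJ x y = (1 / 4 : ℂ) • g.br (g.opF x) (g.opF y) := rfl
theorem oM_apply (x y : g.space) :
    g.oM x y = (1 / 2 : ℂ) • (g.br x (g.opF y) - g.br (g.opF x) y) := rfl

variable {a b : g.space} (ha : a ∈ wt g 2) (hb : b ∈ wt g 2) {m n r : g.space} (hm : m ∈ wt g 1)
  (hn : n ∈ wt g 1) (hr : r ∈ wt g 1)

include ha hb in
theorem oDot_wt : g.oDot a b ∈ wt g 2 :=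
  Submodule.smul_mem _ _ (br_wt (d := 0) ha (opF_wt hb))

include ha hm in
theorem oBul_wt : g.oBul a m ∈ wt g 1 := br_wt (d := -1) ha (opF_wt hm)

include hm hn in
theorem br_wt_one : g.br m n ∈ wt g 2 := br_wt hm hn

include hm hn hr in
theorem oTri_wt : g.oTri m n r ∈ wt g 1 :=
  neg_mem (br_wt (c := 0) (br_wt (d := -1) hm (opF_wt hn)) hr)

/-! ### Brackets between two strings of highest weight 2 -/

section JJ

include ha hb

theorem br_two_two : g.br a b = 0 := eq_zero_of_wt (br_wt ha hb (e := 4))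

omit ha hb in
theorem br_two_F : g.br a (g.opF b) = (2 : ℂ) • g.oDot a b := by rw [oDot_apply]; module

/-- The derivation `f` is applied to a known bracket, here `[a, b] = 0`. Repeating this gives much
of the table of brackets between the two strings. -/
theorem br_F_two : g.br (g.opF a) b = -((2 : ℂ) • g.oDot a b) := by
  have h := opF_br a b
  rw [br_two_two ha hb, map_zero, br_two_F] at h
  exact eq_neg_of_add_eq_zero_left h.symm

omit ha hb in
theorem br_F_F : g.br (g.opF a) (g.opF b) = (4 : ℂ) • g.oJ a b := by rw [oJ_apply]; module

omit ha hb in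
theorem br_two_FF : g.br a (g.opF (g.opF b)) = (2 : ℂ) • g.opF (g.oDot a b) - (4 : ℂ) • g.oJ a b := by
  have h := opF_br a (g.opF b)
  rw [br_two_F, br_F_F, map_smul] at h
  rw [h]; abel

theorem br_FF_two :
    g.br (g.opF (g.opF a)) b = -((2 : ℂ) • g.opF (g.oDot a b)) - (4 : ℂ) • g.oJ a b := by
  have h := opF_br (g.opF a) b
  rw [br_F_two ha hb, br_F_F, map_neg, map_smul] at h
  rw [h]; abel

/-- Applying `e` to `[fa, fb]` gives `2([a, fb] + [fa, b]) = 2 f[a, b] = 0`. -/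
theorem isInv_oJ : IsInv (g.oJ a b) := by
  refine .of_wt (Submodule.smul_mem _ _ (br_wt (c := 0) (d := 0) (opF_wt ha) (opF_wt hb))) ?_
  rw [oJ_apply, map_smul, opE_br, opE_opF_two ha, opE_opF_two hb, map_smul, map_smul,
    LinearMap.smul_apply, br_F_two ha hb, br_two_F]
  module

theorem br_F_FF : g.br (g.opF a) (g.opF (g.opF b)) = (2 : ℂ) • g.opF (g.opF (g.oDot a b)) := by
  have h := opF_br a (g.opF (g.opF b))
  rw [br_two_FF, map_sub, map_smul, map_smul, (isInv_oJ ha hb).F, opF_opF_opF_two hb, map_zero,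
    smul_zero, sub_zero, add_zero] at h
  exact h.symm

theorem br_FF_F : g.br (g.opF (g.opF a)) (g.opF b) = -((2 : ℂ) • g.opF (g.opF (g.oDot a b))) := by
  have h := opF_br (g.opF a) (g.opF b)
  rw [br_F_F, map_smul, (isInv_oJ ha hb).F, smul_zero, br_F_FF ha hb] at h
  exact eq_neg_of_add_eq_zero_left h.symm

theorem br_FF_FF : g.br (g.opF (g.opF a)) (g.opF (g.opF b)) = 0 :=
  eq_zero_of_wt (br_wt (e := -4) (c := -2) (d := -2) (opF_wt (c := 0) (opF_wt ha))
    (opF_wt (c := 0) (opF_wt hb)))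

end JJ

/-! ### Brackets between strings of highest weights 2 and 1 -/

section JM

include ha hm

theorem br_two_one : g.br a m = 0 := eq_zero_of_wt (br_wt ha hm (e := 3))

theorem br_F_one : g.br (g.opF a) m = -g.oBul a m := by
  have h := opF_br a m
  rw [br_two_one ha hm, map_zero, ← oBul_apply] at h
  exact eq_neg_of_add_eq_zero_left h.symm

omit ha in
theorem br_F_F_one : g.br (g.opF a) (g.opF m) = g.opF (g.oBul a m) := by
  rw [oBul_apply, opF_br, opF_opF_one hm, map_zero, add_zero]

theorem br_FF_one : g.br (g.opF (g.opF a)) m = -((2 : ℂ) • g.opF (g.oBul a m)) := by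
  have h := opF_br (g.opF a) m
  rw [br_F_one ha hm, br_F_F_one hm, map_neg] at h
  linear_combination (norm := module) -h

theorem br_FF_F_one : g.br (g.opF (g.opF a)) (g.opF m) = 0 := by
  have h := opF_br (g.opF a) (g.opF m)
  rw [br_F_F_one hm, opF_opF_one (oBul_wt ha hm), opF_opF_one hm, map_zero, add_zero] at h
  exact h.symm

end JM

/-! ### Brackets between two strings of highest weight 1 -/

section MM

/-- For vectors of weight 1 this is the splitting of a bracket of weight 0 into its part in `f J`
and its invariant part. -/
theorem br_one_F (m n : g.space) :
    g.br m (g.opF n) = (1 / 2 : ℂ) • g.opF (g.br m n) + g.oM m n := by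
  rw [oM_apply, opF_br]; module

theorem br_F_one_one (m n : g.space) :
    g.br (g.opF m) n = (1 / 2 : ℂ) • g.opF (g.br m n) - g.oM m n := by
  rw [oM_apply, opF_br]; module

include hm hn

theorem br_F_one_F : g.br (g.opF m) (g.opF n) = (1 / 2 : ℂ) • g.opF (g.opF (g.br m n)) := by
  simp only [opF_br, map_add, opF_opF_one hm, opF_opF_one hn, map_zero, LinearMap.zero_apply]
  module

theorem isInv_oM : IsInv (g.oM m n) := by
  refine .of_wt (Submodule.smul_mem _ _ (sub_mem (br_wt (d := -1) hm (opF_wt hn))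
    (br_wt (c := -1) (opF_wt hm) hn))) ?_
  rw [oM_apply, map_smul, map_sub, opE_br, opE_br, opE_one hm, opE_one hn, opE_opF_one hm,
    opE_opF_one hn, map_zero, map_zero, LinearMap.zero_apply]
  module

end MM

end Operations

variable {g : ShortSL2.{u}}

/-! ## The identities between highest weight vectors -/

variable (g) in
/-- `x` is homogeneous of weight `c` and parity `i`. -/
def IsHom (c : ℂ) (i : ZMod 2) (x : g.space) : Prop := x ∈ wt g c ∧ x ∈ g.space.gr i

section Identities

variable {i j k l p : ZMod 2} {x y z a b c D : g.space} {m n r s t : g.space}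

theorem skew (hx : x ∈ g.space.gr i) (hy : y ∈ g.space.gr j) :
    g.br x y = -(ksign (i * j) • g.br y x) := g.isLie.skew _ _ _ _ hx hy

theorem br_mem (hx : x ∈ g.space.gr i) (hy : y ∈ g.space.gr j) : g.br x y ∈ g.space.gr (i + j) :=
  g.isLie.br_mem _ _ _ _ hx hy

theorem br_br (hx : x ∈ g.space.gr i) (hy : y ∈ g.space.gr j) (hz : z ∈ g.space.gr k) :
    g.br (g.br x y) z = g.br x (g.br y z) - ksign (i * j) • g.br y (g.br x z) := by
  rw [g.isLie.leibniz hx hy hz, add_sub_cancel_right]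

theorem IsHom.dot (ha : g.IsHom 2 i a) (hb : g.IsHom 2 j b) : g.IsHom 2 (i + j) (g.oDot a b) :=
  ⟨oDot_wt ha.1 hb.1, Submodule.smul_mem _ _ (br_mem ha.2 (opF_mem hb.2))⟩

theorem IsHom.bul (ha : g.IsHom 2 i a) (hm : g.IsHom 1 j m) : g.IsHom 1 (i + j) (g.oBul a m) :=
  ⟨oBul_wt ha.1 hm.1, br_mem ha.2 (opF_mem hm.2)⟩

theorem IsHom.star (hm : g.IsHom 1 i m) (hn : g.IsHom 1 j n) : g.IsHom 2 (i + j) (g.br m n) :=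
  ⟨br_wt_one hm.1 hn.1, br_mem hm.2 hn.2⟩

theorem IsHom.tri (hm : g.IsHom 1 i m) (hn : g.IsHom 1 j n) (hr : g.IsHom 1 k r) :
    g.IsHom 1 (i + j + k) (g.oTri m n r) :=
  ⟨oTri_wt hm.1 hn.1 hr.1, neg_mem (br_mem (br_mem hm.2 (opF_mem hn.2)) hr.2)⟩

theorem oJ_mem (ha : a ∈ g.space.gr i) (hb : b ∈ g.space.gr j) : g.oJ a b ∈ g.space.gr (i + j) :=
  Submodule.smul_mem _ _ (br_mem (opF_mem ha) (opF_mem hb))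

theorem oM_mem (hm : m ∈ g.space.gr i) (hn : n ∈ g.space.gr j) : g.oM m n ∈ g.space.gr (i + j) :=
  Submodule.smul_mem _ _ (sub_mem (br_mem hm (opF_mem hn)) (br_mem (opF_mem hm) hn))

/-! ### Invariant elements -/

theorem IsInv.br_opF (hD : IsInv D) (x : g.space) : g.br D (g.opF x) = g.opF (g.br D x) := by
  rw [opF_br, hD.F, map_zero, LinearMap.zero_apply, zero_add]

theorem IsInv.br_wt (hD : IsInv D) {c : ℂ} (hx : x ∈ wt g c) : g.br D x ∈ wt g c := by
  rw [mem_wt] at *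
  rw [opH_br, hD.H, hx, map_zero, LinearMap.zero_apply, zero_add, map_smul]

theorem IsInv.oM (hD : IsInv D) (hp : D ∈ g.space.gr p) (hm : m ∈ g.space.gr i)
    (hn : n ∈ g.space.gr j) : g.br D (g.oM m n)
      = g.oM (g.br D m) n + ksign (p * i) • g.oM m (g.br D n) := by
  simp only [oM_apply, map_smul, map_sub, g.isLie.leibniz hp (opF_mem hm) hn,
    g.isLie.leibniz hp hm (opF_mem hn), hD.br_opF]
  module

theorem oJ_skew (ha : a ∈ g.space.gr i) (hb : b ∈ g.space.gr j) :
    g.oJ a b = -(ksign (i * j) • g.oJ b a) := by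
  rw [oJ_apply, oJ_apply, skew (opF_mem ha) (opF_mem hb)]; module

theorem oM_symm (hm : m ∈ g.space.gr i) (hn : n ∈ g.space.gr j) :
    g.oM m n = ksign (i * j) • g.oM n m := by
  rw [oM_apply, oM_apply, skew (opF_mem hm) hn, skew hm (opF_mem hn)]; module

/-- Bracketing with `fa` acts as `-2a·` on weight 2 and as `-a•` on weight 1. The commutator of two
such operators, times the `¼` of `oJ`, gives `⟨a, b⟩` with coefficient 1 on `J` and, in the next
lemma, `¼` on `M`. -/
theorem oJ_br_two (ha : g.IsHom 2 i a) (hb : g.IsHom 2 j b) (hc : g.IsHom 2 k c) :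
    g.br (g.oJ a b) c = g.oDot a (g.oDot b c) - ksign (i * j) • g.oDot b (g.oDot a c) := by
  simp only [oJ_apply, map_sub, map_add, map_neg, map_smul, LinearMap.sub_apply,
      LinearMap.add_apply,
    LinearMap.neg_apply, LinearMap.smul_apply, smul_sub, smul_add, smul_neg, br_br (opF_mem ha.2) (opF_mem hb.2) hc.2, br_F_two ha.1 hc.1,
    br_F_two hb.1 hc.1, br_F_two ha.1 (oDot_wt hb.1 hc.1), br_F_two hb.1 (oDot_wt ha.1 hc.1)]
  module

theorem oJ_br_one (ha : g.IsHom 2 i a) (hb : g.IsHom 2 j b) (hm : g.IsHom 1 k m) :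
    g.br (g.oJ a b) m = (1 / 4 : ℂ) •
      (g.oBul a (g.oBul b m) - ksign (i * j) • g.oBul b (g.oBul a m)) := by
  simp only [oJ_apply, map_sub, map_add, map_neg, map_smul, LinearMap.sub_apply,
      LinearMap.add_apply,
    LinearMap.neg_apply, LinearMap.smul_apply, smul_sub, smul_add, smul_neg, br_br (opF_mem ha.2) (opF_mem hb.2) hm.2, br_F_one ha.1 hm.1,
    br_F_one hb.1 hm.1, br_F_one ha.1 (oBul_wt hb.1 hm.1), br_F_one hb.1 (oBul_wt ha.1 hm.1)]
  module

/-- The element `oM m n` is `[m, fn]` minus half of `f(m ⋆ n)`, and bracketing with the latter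
vector acts as `-(m ⋆ n)•`; hence the shape of `∂_{m,n}`. -/
theorem oM_br_one (hm : m ∈ wt g 1) (hn : n ∈ wt g 1) (hr : r ∈ wt g 1) :
    g.br (g.oM m n) r = (1 / 2 : ℂ) • g.oBul (g.br m n) r - g.oTri m n r := by
  have h := br_one_F m n
  rw [oTri_apply, h]
  simp only [map_sub, map_add, map_neg, map_smul, LinearMap.sub_apply, LinearMap.add_apply,
    LinearMap.neg_apply, LinearMap.smul_apply, smul_sub, smul_add, smul_neg, br_F_one (br_wt_one hm hn) hr]
  module

theorem br_F_two' (hm : g.IsHom 1 i m) (ha : g.IsHom 2 j a) :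
    g.br (g.opF m) a = -(ksign (i * j) • g.oBul a m) := skew (opF_mem hm.2) ha.2

theorem br_one_two (hm : g.IsHom 1 i m) (ha : g.IsHom 2 j a) : g.br m a = 0 := by
  rw [skew hm.2 ha.2, br_two_one ha.1 hm.1, smul_zero, neg_zero]

theorem oM_br_two (hm : g.IsHom 1 i m) (hn : g.IsHom 1 j n) (ha : g.IsHom 2 k a) :
    g.br (g.oM m n) a = (1 / 2 : ℂ) • (ksign (k * (i + j)) • g.br (g.oBul a m) n
      - ksign (k * j) • g.br m (g.oBul a n)) := by
  simp only [oM_apply, map_sub, map_add, map_neg, map_smul, LinearMap.sub_apply,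
      LinearMap.add_apply,
    LinearMap.neg_apply, LinearMap.smul_apply, smul_sub, smul_add, smul_neg, br_br hm.2 (opF_mem hn.2) ha.2, br_br (opF_mem hm.2) hn.2 ha.2,
    br_F_two' hm ha, br_F_two' hn ha, br_one_two hm ha, br_one_two hn ha, map_zero,
    skew hn.2 (ha.bul hm).2]
  match_scalars
  all_goals
    rcases zmod2_cases i with h_i | h_i <;> rcases zmod2_cases j with h_j | h_j <;>
    rcases zmod2_cases k with h_k | h_k <;>
    (try simp only [h_i, h_j, h_k, mul_zero, zero_mul, mul_one, add_zero,
      zero_add, ksign_zero, ksign_one, zmod2_one_add_one]) <;> norm_num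

/-! ### The axioms of a `J`-ternary superalgebra -/

theorem oDot_comm (ha : g.IsHom 2 i a) (hb : g.IsHom 2 j b) :
    g.oDot a b = ksign (i * j) • g.oDot b a := by
  have h := skew ha.2 (opF_mem hb.2)
  rw [br_two_F, br_F_two hb.1 ha.1] at h
  linear_combination (norm := module) (1 / 2 : ℂ) • h

/-- The Leibniz rule for `a`, `fb`, `f²c` has total weight 0. Its invariant part is the cyclic
relation. -/
theorem oJ_cyclic (ha : g.IsHom 2 i a) (hb : g.IsHom 2 j b) (hc : g.IsHom 2 k c) :
    ksign (i * k) • g.oJ (g.oDot a b) c + ksign (i * j) • g.oJ (g.oDot b c) a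
      + ksign (j * k) • g.oJ (g.oDot c a) b = 0 := by
  have h := g.isLie.leibniz ha.2 (opF_mem hb.2) (opF_mem (opF_mem hc.2))
  have h1 := isInv_oJ ha.1 hc.1
  have h2 : g.br (g.opF b) (g.oJ a c) = -(ksign (j * (i + k)) • g.opF (g.br (g.oJ a c) b)) := by
    rw [skew (opF_mem hb.2) (oJ_mem ha.2 hc.2), h1.br_opF]
  simp only [br_F_FF hb.1 hc.1, br_two_FF (a := a) (b := c), br_two_FF (a := a) (b := g.oDot b c),
    br_two_F (a := a) (b := b), map_sub, map_add, map_neg, map_smul, LinearMap.sub_apply, LinearMap.add_apply,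
    LinearMap.neg_apply, LinearMap.smul_apply, smul_sub, smul_add, smul_neg, br_two_FF (a := g.oDot a b) (b := c),
    br_F_F (a := b) (b := g.oDot a c), h2] at h
  -- The identity equates a vector of `f J` with an invariant one. Applying `e` kills the right
  -- side, so the weight 2 vector on the left vanishes, and the right side with it.
  have hs : g.opF (g.oDot a (g.oDot b c) - g.oDot (g.oDot a b) c
        - (ksign (i * j) * ksign (j * (i + k))) • g.br (g.oJ a c) b)
      = (2 : ℂ) • (g.oJ a (g.oDot b c) - g.oJ (g.oDot a b) c
        + ksign (i * j) • g.oJ b (g.oDot a c)) := by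
    simp only [map_sub, map_add, map_neg, map_smul, LinearMap.sub_apply, LinearMap.add_apply,
    LinearMap.neg_apply, LinearMap.smul_apply, smul_sub, smul_add, smul_neg]
    linear_combination (norm := module) (1 / 4 : ℂ) • h
  have hw : g.oDot a (g.oDot b c) - g.oDot (g.oDot a b) c
      - (ksign (i * j) * ksign (j * (i + k))) • g.br (g.oJ a c) b ∈ wt g 2 :=
    sub_mem (sub_mem (oDot_wt ha.1 (oDot_wt hb.1 hc.1)) (oDot_wt (oDot_wt ha.1 hb.1) hc.1))
      (Submodule.smul_mem _ _ (h1.br_wt hb.1))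
  rw [eq_zero_of_opF_two hw, map_zero] at hs
  · rw [oJ_skew ha.2 (hb.dot hc).2, oJ_skew hb.2 (ha.dot hc).2, oDot_comm ha hc] at hs
    simp only [map_sub, map_add, map_neg, map_smul, LinearMap.sub_apply, LinearMap.add_apply,
    LinearMap.neg_apply, LinearMap.smul_apply, smul_sub, smul_add, smul_neg] at hs
    linear_combination (norm := skip) (1 / 2 * ksign (i * k)) • hs
    simp only [map_sub, map_add, map_neg, map_smul, LinearMap.sub_apply, LinearMap.add_apply,
    LinearMap.neg_apply, LinearMap.smul_apply, smul_sub, smul_add, smul_neg]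
    match_scalars
    all_goals
    rcases zmod2_cases i with h_i | h_i <;> rcases zmod2_cases j with h_j | h_j <;>
    rcases zmod2_cases k with h_k | h_k <;>
    (try simp only [h_i, h_j, h_k, mul_zero, zero_mul, mul_one, add_zero,
      zero_add, ksign_zero, ksign_one, zmod2_one_add_one]) <;> norm_num
  · rw [hs]
    simp only [map_sub, map_add, map_neg, map_smul, LinearMap.sub_apply, LinearMap.add_apply,
    LinearMap.neg_apply, LinearMap.smul_apply, smul_sub, smul_add, smul_neg, (isInv_oJ ha.1 (oDot_wt hb.1 hc.1)).E, (isInv_oJ (oDot_wt ha.1 hb.1) hc.1).E,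
      (isInv_oJ hb.1 (oDot_wt ha.1 hc.1)).E]
    module

theorem oBul_dot (ha : g.IsHom 2 i a) (hb : g.IsHom 2 j b) (hm : g.IsHom 1 k m) :
    g.oBul (g.oDot a b) m
      = (1 / 2 : ℂ) • (g.oBul a (g.oBul b m) + ksign (i * j) • g.oBul b (g.oBul a m)) := by
  rw [oBul_apply, oDot_apply, map_smul, LinearMap.smul_apply,
    br_br ha.2 (opF_mem hb.2) (opF_mem hm.2), br_F_F_one hm.1, ← oBul_apply a m,
    br_F_one hb.1 (oBul_wt ha.1 hm.1), ← oBul_apply]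
  module

theorem oDot_star (ha : g.IsHom 2 i a) (hm : g.IsHom 1 j m) (hn : g.IsHom 1 k n) :
    g.oDot a (g.br m n)
      = (1 / 2 : ℂ) • (g.br (g.oBul a m) n + ksign (i * j) • g.br m (g.oBul a n)) := by
  have h := br_F_two ha.1 (br_wt_one hm.1 hn.1)
  rw [g.isLie.leibniz (opF_mem ha.2) hm.2 hn.2, br_F_one ha.1 hm.1, br_F_one ha.1 hn.1] at h
  simp only [map_sub, map_add, map_neg, map_smul, LinearMap.sub_apply, LinearMap.add_apply,
    LinearMap.neg_apply, LinearMap.smul_apply, smul_sub, smul_add, smul_neg] at h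
  linear_combination (norm := module) (1 / 2 : ℂ) • h

/-- Bracketing with `fa` acts as `-a•` on `m` and `s`, but sends `fn` to `+f(a • n)`; this is why
the middle slot has the opposite sign. -/
theorem oBul_tri (ha : g.IsHom 2 i a) (hm : g.IsHom 1 j m) (hn : g.IsHom 1 k n)
    (hs : g.IsHom 1 l s) : g.oBul a (g.oTri m n s)
      = g.oTri (g.oBul a m) n s - ksign (i * j) • g.oTri m (g.oBul a n) s
        + ksign (i * (j + k)) • g.oTri m n (g.oBul a s) := by
  have h := br_F_one ha.1 (oTri_wt hm.1 hn.1 hs.1)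
  rw [oTri_apply, map_neg, g.isLie.leibniz (opF_mem ha.2) (br_mem hm.2 (opF_mem hn.2)) hs.2,
    g.isLie.leibniz (opF_mem ha.2) hm.2 (opF_mem hn.2), br_F_one ha.1 hm.1, br_F_one ha.1 hs.1,
    br_F_F_one hn.1] at h
  simp only [map_sub, map_add, map_neg, map_smul, LinearMap.sub_apply, LinearMap.add_apply,
    LinearMap.neg_apply, LinearMap.smul_apply, smul_sub, smul_add, smul_neg] at h
  simp only [oTri_apply, map_sub, map_add, map_neg, map_smul, LinearMap.sub_apply,
      LinearMap.add_apply,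
    LinearMap.neg_apply, LinearMap.smul_apply, smul_sub, smul_add, smul_neg] at h ⊢
  linear_combination (norm := module) h

theorem oTri_reverse (hm : g.IsHom 1 i m) (hn : g.IsHom 1 j n) (hs : g.IsHom 1 k s) :
    g.oTri m n s = ksign (i * (j + k) + j * k) • g.oTri s n m
      - ksign (j * k) • g.oBul (g.br m s) n := by
  simp only [oTri_apply, oBul_apply, br_br hm.2 (opF_mem hn.2) hs.2, skew (opF_mem hn.2) hs.2,
      map_sub, map_add, map_neg, map_smul, LinearMap.sub_apply, LinearMap.add_apply,
    LinearMap.neg_apply, LinearMap.smul_apply, smul_sub, smul_add, smul_neg,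
    skew hm.2 (br_mem hs.2 (opF_mem hn.2)), skew (opF_mem hn.2) (br_mem hm.2 hs.2)]
  match_scalars
  all_goals
    rcases zmod2_cases i with h_i | h_i <;> rcases zmod2_cases j with h_j | h_j <;>
    rcases zmod2_cases k with h_k | h_k <;>
    (try simp only [h_i, h_j, h_k, mul_zero, zero_mul, mul_one, add_zero,
      zero_add, ksign_zero, ksign_one, zmod2_one_add_one]) <;> norm_num

/-- Two evaluations of `[f(m ⋆ n), s]`: as `-(m ⋆ n) • s`, and by the derivation rule for `f`. -/
theorem oTri_swap (hm : g.IsHom 1 i m) (hn : g.IsHom 1 j n) (hs : g.IsHom 1 k s) :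
    g.oTri m n s = ksign (i * j) • g.oTri n m s + g.oBul (g.br m n) s := by
  have h := br_F_one (br_wt_one hm.1 hn.1) hs.1
  rw [opF_br, skew (opF_mem hm.2) hn.2] at h
  simp only [oTri_apply, map_sub, map_add, map_neg, map_smul, LinearMap.sub_apply,
      LinearMap.add_apply,
    LinearMap.neg_apply, LinearMap.smul_apply, smul_sub, smul_add, smul_neg] at h ⊢
  linear_combination (norm := module) -h

/-- Two expansions of the bracket of `[m, fn]` with `[r, s]`. The term containing `[m, r ⋆ s]`
vanishes, since `J` and `M` bracket to zero. -/
theorem oTri_star (hm : g.IsHom 1 i m) (hn : g.IsHom 1 j n) (hr : g.IsHom 1 k r)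
    (hs : g.IsHom 1 l s) :
    g.br (g.oTri m n r) s + ksign (k * (i + j)) • g.br r (g.oTri m n s)
      = ksign (j * (k + l)) • g.br m (g.oBul (g.br r s) n) := by
  have h := br_br hm.2 (opF_mem hn.2) (br_mem hr.2 hs.2)
  rw [g.isLie.leibniz (br_mem hm.2 (opF_mem hn.2)) hr.2 hs.2, br_F_two' hn (hr.star hs),
    br_one_two hm (hr.star hs)] at h
  simp only [oTri_apply, map_sub, map_add, map_neg, map_smul, LinearMap.sub_apply,
      LinearMap.add_apply,
    LinearMap.neg_apply, LinearMap.smul_apply, smul_sub, smul_add, smul_neg, map_zero] at h ⊢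
  rw [mul_comm k]
  linear_combination (norm := module) -h

/-- Both `[m, fn]` and `[fm, n]` split into half of `f(m ⋆ n)` and `± oM m n`; the invariant part
commutes with `f`. This explains the interchange of `m` and `n` in the middle slot of axiom 6. -/
theorem br_br_F (hm : m ∈ wt g 1) (hn : n ∈ wt g 1) (hs : s ∈ wt g 1) :
    g.br (g.br m (g.opF n)) (g.opF s) = -g.opF (g.br (g.br (g.opF m) n) s) := by
  have hD := isInv_oM hm hn
  rw [br_one_F m n, br_F_one_one m n]
  simp only [map_sub, map_add, map_neg, map_smul, LinearMap.sub_apply, LinearMap.add_apply,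
    LinearMap.neg_apply, LinearMap.smul_apply, smul_sub, smul_add, smul_neg, br_F_F_one hs, br_F_one (br_wt_one hm hn) hs, hD.br_opF]
  module

theorem oTri_tri (hm : g.IsHom 1 i m) (hn : g.IsHom 1 j n) (hr : g.IsHom 1 k r)
    (hs : g.IsHom 1 l s) (ht : g.IsHom 1 p t) : g.oTri m n (g.oTri r s t)
      = g.oTri (g.oTri m n r) s t + ksign (k * (i + j) + i * j) • g.oTri r (g.oTri n m s) t
        + ksign ((i + j) * (k + l)) • g.oTri r s (g.oTri m n t) := by
  have hT := br_mem hm.2 (opF_mem hn.2)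
  have h := g.isLie.leibniz hT (br_mem hr.2 (opF_mem hs.2)) ht.2
  rw [g.isLie.leibniz hT hr.2 (opF_mem hs.2), br_br_F hm.1 hn.1 hs.1, skew (opF_mem hm.2) hn.2] at h
  simp only [oTri_apply, map_sub, map_add, map_neg, map_smul, LinearMap.sub_apply,
      LinearMap.add_apply,
    LinearMap.neg_apply, LinearMap.smul_apply, smul_sub, smul_add, smul_neg] at h ⊢
  rw [h]
  match_scalars
  all_goals
    rcases zmod2_cases i with h_i | h_i <;> rcases zmod2_cases j with h_j | h_j <;>
    rcases zmod2_cases k with h_k | h_k <;> rcases zmod2_cases l with h_l | h_l <;>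
    (try simp only [h_i, h_j, h_k, h_l, mul_zero, zero_mul, mul_one, add_zero,
      zero_add, ksign_zero, ksign_one, zmod2_one_add_one]) <;> norm_num

/-! ### The relations in `B(J, M)` -/

/-- The method of `oJ_cyclic`, applied to the Leibniz rule for `fa`, `m`, `fn`. -/
theorem oM_bul (ha : g.IsHom 2 i a) (hm : g.IsHom 1 j m) (hn : g.IsHom 1 k n) :
    g.oM (g.oBul a m) n - ksign (i * j) • g.oM m (g.oBul a n)
      - (ksign (i * (j + k)) * 2) • g.oJ (g.br m n) a = 0 := by
  have hD := isInv_oM hm.1 hn.1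
  have h := g.isLie.leibniz (opF_mem ha.2) hm.2 (opF_mem hn.2)
  rw [br_F_one ha.1 hm.1, br_F_F_one hn.1, br_one_F m n, map_add,
    skew (opF_mem ha.2) (oM_mem hm.2 hn.2), hD.br_opF, map_smul, br_F_F,
    oJ_skew ha.2 (br_mem hm.2 hn.2), map_neg, LinearMap.neg_apply, br_one_F, br_one_F] at h
  have hs : g.opF ((1 / 2 : ℂ) • g.br (g.oBul a m) n
        - (ksign (i * j) * (1 / 2)) • g.br m (g.oBul a n)
        - ksign (i * (j + k)) • g.br (g.oM m n) a)
      = -(g.oM (g.oBul a m) n - ksign (i * j) • g.oM m (g.oBul a n)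
      - (ksign (i * (j + k)) * 2) • g.oJ (g.br m n) a) := by
    simp only [map_sub, map_add, map_neg, map_smul, LinearMap.sub_apply, LinearMap.add_apply,
    LinearMap.neg_apply, LinearMap.smul_apply, smul_sub, smul_add, smul_neg]
    linear_combination (norm := module) h
  have hw : (1 / 2 : ℂ) • g.br (g.oBul a m) n - (ksign (i * j) * (1 / 2)) • g.br m (g.oBul a n)
        - ksign (i * (j + k)) • g.br (g.oM m n) a ∈ wt g 2 :=
    sub_mem (sub_mem (Submodule.smul_mem _ _ (br_wt_one (oBul_wt ha.1 hm.1) hn.1))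
      (Submodule.smul_mem _ _ (br_wt_one hm.1 (oBul_wt ha.1 hn.1))))
      (Submodule.smul_mem _ _ (hD.br_wt ha.1))
  rw [eq_zero_of_opF_two hw, map_zero] at hs
  · exact neg_eq_zero.1 hs.symm
  · rw [hs]
    simp only [map_sub, map_add, map_neg, map_smul, LinearMap.sub_apply, LinearMap.add_apply,
    LinearMap.neg_apply, LinearMap.smul_apply, smul_sub, smul_add, smul_neg, (isInv_oM (oBul_wt ha.1 hm.1) hn.1).E, (isInv_oM hm.1 (oBul_wt ha.1 hn.1)).E,
      (isInv_oJ (br_wt_one hm.1 hn.1) ha.1).E]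
    module

/-- The bracket of `oM m n` and `oM r s` is super-antisymmetric; each side is expanded by letting an
invariant element act as a derivation. -/
theorem oM_part (hm : g.IsHom 1 i m) (hn : g.IsHom 1 j n) (hr : g.IsHom 1 k r)
    (hs : g.IsHom 1 l s) :
    g.oM (g.br (g.oM m n) r) s + ksign ((i + j) * k) • g.oM r (g.br (g.oM m n) s)
      + ksign ((i + j) * (k + l)) • g.oM (g.br (g.oM r s) m) n
      + ksign ((k + l) * j) • g.oM m (g.br (g.oM r s) n) = 0 := by
  have h := skew (oM_mem hm.2 hn.2) (oM_mem hr.2 hs.2)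
  rw [(isInv_oM hm.1 hn.1).oM (oM_mem hm.2 hn.2) hr.2 hs.2,
    (isInv_oM hr.1 hs.1).oM (oM_mem hr.2 hs.2) hm.2 hn.2] at h
  linear_combination (norm := skip) h
  match_scalars
  all_goals
    rcases zmod2_cases i with h_i | h_i <;> rcases zmod2_cases j with h_j | h_j <;>
    rcases zmod2_cases k with h_k | h_k <;> rcases zmod2_cases l with h_l | h_l <;>
    (try simp only [h_i, h_j, h_k, h_l, mul_zero, zero_mul, mul_one, add_zero,
      zero_add, ksign_zero, ksign_one, zmod2_one_add_one]) <;> norm_num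

end Identities

end ShortSL2

/-- The converse of `angleJ_cyclic`: the hypothesis `cyc` is the vanishing of the cyclic sum of the
operators `⟨ab, c⟩` at `d`, which is the Jordan identity after reordering by supercommutativity. -/
theorem isJordanSuper_of_cyclic {J : SuperSpace.{u}} {dot : J →ₗ[ℂ] J →ₗ[ℂ] J}
    (mem : ∀ (i j : ZMod 2) (a b : J), a ∈ J.gr i → b ∈ J.gr j → dot a b ∈ J.gr (i + j))
    (comm : ∀ (i j : ZMod 2) (a b : J), a ∈ J.gr i → b ∈ J.gr j →
      dot a b = ksign (i * j) • dot b a)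
    (cyc : ∀ (i j k l : ZMod 2) (a b c d : J), a ∈ J.gr i → b ∈ J.gr j → c ∈ J.gr k → d ∈ J.gr l →
      ksign (i * k) • (dot (dot a b) (dot c d) - ksign ((i + j) * k) • dot c (dot (dot a b) d))
        + ksign (i * j) • (dot (dot b c) (dot a d) - ksign ((j + k) * i) • dot a (dot (dot b c) d))
        + ksign (j * k) • (dot (dot c a) (dot b d) - ksign ((k + i) * j) • dot b (dot (dot c a) d))
        = 0) :
    IsJordanSuper J dot := by
  refine ⟨mem, comm, fun i j l k a b d c ha hb hd hc => ?_⟩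
  have h := cyc i j k l a b c d ha hb hc hd
  have c1 := congrArg (dot (dot a b)) (comm _ _ _ _ hc hd)
  have c2 := comm _ _ _ _ (mem _ _ _ _ hb hc) (mem _ _ _ _ ha hd)
  have c3 := congrArg (fun x => dot x (dot b d)) (comm _ _ _ _ hc ha)
  have c4 := comm _ _ _ _ hc (mem _ _ _ _ (mem _ _ _ _ ha hb) hd)
  have c5 := comm _ _ _ _ ha (mem _ _ _ _ (mem _ _ _ _ hb hc) hd)
  have c6 := comm _ _ _ _ hb (mem _ _ _ _ (mem _ _ _ _ hc ha) hd)
  have c7 := congrArg (fun x => dot (dot x d) b) (comm _ _ _ _ hc ha)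
  linear_combination (norm := skip) ksign (k * l) • (ksign (i * k) • h - c1
    - ksign (i * (j + k)) • c2 - ksign (k * (i + j)) • c3 + ksign ((i + j) * k) • c4 + c5
    + ksign (k * i + i * j) • c6 + ksign (k * i + i * j + j * (k + i + l)) • c7)
  simp only [map_sub, map_add, map_neg, map_smul, LinearMap.sub_apply, LinearMap.add_apply,
    LinearMap.neg_apply, LinearMap.smul_apply, smul_sub, smul_add, smul_neg]
  match_scalars
  all_goals
    rcases zmod2_cases i with h_i | h_i <;> rcases zmod2_cases j with h_j | h_j <;>
    rcases zmod2_cases k with h_k | h_k <;> rcases zmod2_cases l with h_l | h_l <;>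
    (try simp only [h_i, h_j, h_k, h_l, mul_zero, zero_mul, mul_one, add_zero,
      zero_add, ksign_zero, ksign_one, zmod2_one_add_one]) <;> norm_num

namespace ShortSL2

/-! ## The functor `T̂` -/

section WeightSpace

variable {g : ShortSL2.{u}}

/-- Since `h` is even, the parity involution preserves its eigenspaces; this provides their
gradings. -/
theorem par_opH (x : g.space) : g.space.par (g.opH x) = g.opH (g.space.par x) := by
  have h : g.space.par ∘ₗ g.opH = g.opH ∘ₗ g.space.par :=
    SuperSpace.hom_ext fun i x hx => by
      simp only [LinearMap.comp_apply, SuperSpace.par_of_mem hx, SuperSpace.par_of_mem (opH_mem hx),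
        map_smul]
  exact LinearMap.congr_fun h x

theorem par_wt {c : ℂ} {x : g.space} (hx : x ∈ wt g c) : g.space.par x ∈ wt g c := by
  rw [mem_wt] at *
  rw [← par_opH, hx, map_smul]

variable (g)

/-- The parity involution of a weight space. -/
noncomputable def wtPar (c : ℂ) : wt g c →ₗ[ℂ] wt g c := g.space.par.restrict fun _ => par_wt

/-- A weight space as a super vector space. -/
noncomputable def wtSp (c : ℂ) : SuperSpace.{u} :=
  ⟨wt g c, grOf (g.wtPar c), isInternal_grOf fun x => Subtype.ext (SuperSpace.par_par x.1)⟩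

/-- The identification of a weight space with its underlying space. -/
noncomputable def wtE (c : ℂ) : g.wtSp c ≃ₗ[ℂ] wt g c := LinearEquiv.refl ℂ (wt g c)

/-- The inclusion of a weight space. -/
noncomputable def val (c : ℂ) : g.wtSp c →ₗ[ℂ] g.space := (wt g c).subtype ∘ₗ (g.wtE c).toLinearMap

variable {g}

theorem val_wt {c : ℂ} (x : g.wtSp c) : g.val c x ∈ wt g c := (g.wtE c x).2

theorem val_wtE_symm {c : ℂ} (x : wt g c) : g.val c ((g.wtE c).symm x) = x := rfl

theorem val_injective {c : ℂ} {x y : g.wtSp c} (h : g.val c x = g.val c y) : x = y :=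
  (g.wtE c).injective (Subtype.ext h)

theorem mem_wtSp {c : ℂ} {i : ZMod 2} {x : g.wtSp c} :
    x ∈ (g.wtSp c).gr i ↔ g.val c x ∈ g.space.gr i := by
  rw [SuperSpace.mem_gr_iff (W := g.space)]
  exact mem_grOf.trans Subtype.ext_iff

theorem isHom_val {c : ℂ} {i : ZMod 2} {x : g.wtSp c} (hx : x ∈ (g.wtSp c).gr i) :
    g.IsHom c i (g.val c x) := ⟨val_wt x, mem_wtSp.1 hx⟩

/-- The restriction of a bilinear map to weight spaces. -/
noncomputable def restr₂ {c d e : ℂ} (f : g.space →ₗ[ℂ] g.space →ₗ[ℂ] g.space)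
    (h : ∀ x ∈ wt g c, ∀ y ∈ wt g d, f x y ∈ wt g e) : g.wtSp c →ₗ[ℂ] g.wtSp d →ₗ[ℂ] g.wtSp e :=
  LinearMap.mk₂ ℂ (fun x y => (g.wtE e).symm ⟨f (g.val c x) (g.val d y), h _ (val_wt x) _ (val_wt y)⟩)
    (fun x x' y => val_injective (by simp [val_wtE_symm])) (fun s x y => val_injective (by simp [val_wtE_symm]))
    (fun x y y' => val_injective (by simp [val_wtE_symm])) (fun s x y => val_injective (by simp [val_wtE_symm]))

theorem val_restr₂ {c d e : ℂ} (f : g.space →ₗ[ℂ] g.space →ₗ[ℂ] g.space)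
    (h : ∀ x ∈ wt g c, ∀ y ∈ wt g d, f x y ∈ wt g e) (x : g.wtSp c) (y : g.wtSp d) :
    g.val e (restr₂ f h x y) = f (g.val c x) (g.val d y) := rfl

end WeightSpace

section Obj

variable (g : ShortSL2.{u})

/-- The product on the weight space of weight 2. -/
noncomputable def tDot : g.wtSp 2 →ₗ[ℂ] g.wtSp 2 →ₗ[ℂ] g.wtSp 2 :=
  restr₂ g.oDot fun _ hx _ hy => oDot_wt hx hy

/-- The operation `•` between weight spaces. -/
noncomputable def tBul : g.wtSp 2 →ₗ[ℂ] g.wtSp 1 →ₗ[ℂ] g.wtSp 1 :=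
  restr₂ g.oBul fun _ hx _ hy => oBul_wt hx hy

/-- The operation `⋆` on the weight space of weight 1. -/
noncomputable def tStar : g.wtSp 1 →ₗ[ℂ] g.wtSp 1 →ₗ[ℂ] g.wtSp 2 :=
  restr₂ g.br fun _ hx _ hy => br_wt_one hx hy

/-- The triple product on the weight space of weight 1. -/
noncomputable def tTri : g.wtSp 1 →ₗ[ℂ] g.wtSp 1 →ₗ[ℂ] g.wtSp 1 →ₗ[ℂ] g.wtSp 1 where
  toFun m := restr₂ (g.oTri (g.val 1 m)) fun _ hx _ hy => oTri_wt (val_wt m) hx hy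
  map_add' m m' := by
    ext n r
    exact val_injective (by simp [val_restr₂])
  map_smul' s m := by
    ext n r
    exact val_injective (by simp [val_restr₂])

variable {g}

theorem val_tDot (a b : g.wtSp 2) : g.val 2 (g.tDot a b) = g.oDot (g.val 2 a) (g.val 2 b) := rfl

theorem isJordanSuper_tDot : IsJordanSuper (g.wtSp 2) g.tDot := by
  refine isJordanSuper_of_cyclic (fun i j a b ha hb => ?_) (fun i j a b ha hb => val_injective ?_)
    (fun i j k l a b c d ha hb hc hd => val_injective ?_)
  · rw [mem_wtSp, val_tDot]
    exact ((isHom_val ha).dot (isHom_val hb)).2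
  · rw [map_smul, val_tDot, val_tDot]
    exact oDot_comm (isHom_val ha) (isHom_val hb)
  · replace ha := isHom_val ha
    replace hb := isHom_val hb
    replace hc := isHom_val hc
    replace hd := isHom_val hd
    -- Bracketing with `d` turns the cyclic relation between invariant elements into one between the
    -- operators `⟨·,·⟩`.
    have h := congrArg (fun x => g.br x (g.val 2 d)) (oJ_cyclic ha hb hc)
    simp only [map_sub, map_add, map_neg, map_smul, LinearMap.sub_apply, LinearMap.add_apply,
    LinearMap.neg_apply, LinearMap.smul_apply, smul_sub, smul_add, smul_neg, map_zero, LinearMap.zero_apply, oJ_br_two (ha.dot hb) hc hd,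
      oJ_br_two (hb.dot hc) ha hd, oJ_br_two (hc.dot ha) hb hd] at h
    simpa only [map_sub, map_add, map_neg, map_smul, LinearMap.sub_apply, LinearMap.add_apply,
    LinearMap.neg_apply, LinearMap.smul_apply, smul_sub, smul_add, smul_neg, map_zero, val_tDot] using h

variable (g) in
/-- The `J`-ternary superalgebra `T̂(g)`. -/
noncomputable def titsObj : JTernary.{u} where
  J := g.wtSp 2
  M := g.wtSp 1
  dot := g.tDot
  bul := g.tBul
  star := g.tStar
  tri := g.tTri
  isJordan := isJordanSuper_tDot
  isSpecial :=
    { bul_mem := fun _ _ _ _ ha hm => mem_wtSp.2 ((isHom_val ha).bul (isHom_val hm)).2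
      bul_dot := fun _ _ _ _ ha hb => SuperSpace.hom_ext fun _ _ hm => val_injective
        (oBul_dot (isHom_val ha) (isHom_val hb) (isHom_val hm)) }
  isTernary :=
    { star_mem := fun _ _ _ _ hm hn => mem_wtSp.2 ((isHom_val hm).star (isHom_val hn)).2
      star_anticomm := fun _ _ _ _ hm hn => val_injective (skew (mem_wtSp.1 hm) (mem_wtSp.1 hn))
      tri_mem := fun _ _ _ _ _ _ hm hn hr => mem_wtSp.2
        ((isHom_val hm).tri (isHom_val hn) (isHom_val hr)).2
      sjt1 := fun _ _ _ _ _ _ ha hm hn => val_injective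
        (oDot_star (isHom_val ha) (isHom_val hm) (isHom_val hn))
      sjt2 := fun _ _ _ _ _ _ _ _ ha hm hn hs => val_injective
        (oBul_tri (isHom_val ha) (isHom_val hm) (isHom_val hn) (isHom_val hs))
      sjt3 := fun _ _ _ _ _ _ hm hn hs => val_injective
        (oTri_reverse (isHom_val hm) (isHom_val hn) (isHom_val hs))
      sjt4 := fun _ _ _ _ _ _ hm hn hs => val_injective
        (oTri_swap (isHom_val hm) (isHom_val hn) (isHom_val hs))
      sjt5 := fun _ _ _ _ _ _ _ _ hm hn hr hs => val_injective
        (oTri_star (isHom_val hm) (isHom_val hn) (isHom_val hr) (isHom_val hs))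
      sjt6 := fun _ _ _ _ _ _ _ _ _ _ hm hn hr hs ht => val_injective
        (oTri_tri (isHom_val hm) (isHom_val hn) (isHom_val hr) (isHom_val hs) (isHom_val ht)) }

theorem isTits_titsObj : IsTits g g.titsObj (g.wtE 2) (g.wtE 1) where
  gr_J _ _ := mem_wtSp
  gr_M _ _ := mem_wtSp
  dot_eq a b := by
    change (2 : ℂ) • g.oDot (g.val 2 a) (g.val 2 b) = g.br (g.val 2 a) (g.opF (g.val 2 b))
    rw [br_two_F]
  bul_eq _ _ := rfl
  star_eq _ _ := rfl
  tri_eq _ _ _ := rfl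

end Obj

section Map

variable {g k : ShortSL2.{u}} (φ : ShortSL2.Hom g k)

theorem map_opF (x : g.space) : φ.lin (g.opF x) = k.opF (φ.lin x) := φ.map_act _ _

theorem map_wt {c : ℂ} {x : g.space} (hx : x ∈ wt g c) : φ.lin x ∈ wt k c := by
  rw [mem_wt] at *
  have h := φ.map_act sl2H x
  change φ.lin (g.opH x) = k.opH (φ.lin x) at h
  rw [← h, hx, map_smul]

/-- The restriction of a morphism to a weight space. -/
noncomputable def wtMap (c : ℂ) : g.wtSp c →ₗ[ℂ] k.wtSp c :=
  (k.wtE c).symm.toLinearMap ∘ₗ φ.lin.restrict (fun _ => map_wt φ) ∘ₗ (g.wtE c).toLinearMap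

/-- The restriction of a morphism to the weight spaces of weights 2 and 1. -/
noncomputable def titsMap : JTernary.Hom g.titsObj k.titsObj where
  onJ := wtMap φ 2
  onM := wtMap φ 1
  evenJ i a ha := mem_wtSp.2 (φ.even i _ (mem_wtSp.1 ha))
  evenM i m hm := mem_wtSp.2 (φ.even i _ (mem_wtSp.1 hm))
  map_dot a b := val_injective (by
    change φ.lin (g.oDot (g.val 2 a) (g.val 2 b))
      = k.oDot (φ.lin (g.val 2 a)) (φ.lin (g.val 2 b))
    rw [oDot_apply, oDot_apply, map_smul, φ.map_br, map_opF])
  map_bul a m := val_injective (by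
    change φ.lin (g.oBul (g.val 2 a) (g.val 1 m)) = k.oBul (φ.lin (g.val 2 a)) (φ.lin (g.val 1 m))
    rw [oBul_apply, oBul_apply, φ.map_br, map_opF])
  map_star m n := val_injective (φ.map_br _ _)
  map_tri m n r := val_injective (by
    change φ.lin (g.oTri (g.val 1 m) (g.val 1 n) (g.val 1 r))
      = k.oTri (φ.lin (g.val 1 m)) (φ.lin (g.val 1 n)) (φ.lin (g.val 1 r))
    rw [oTri_apply, oTri_apply, map_neg, φ.map_br, φ.map_br, map_opF])

end Map

/-- The functor `T̂`. -/
noncomputable def titsFunctor : ShortSL2.{u} ⥤ JTernary.{u} where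
  obj g := g.titsObj
  map φ := titsMap φ
  map_id _ := rfl
  map_comp _ _ := rfl

theorem isTitsMap_titsFunctor {g k : ShortSL2.{u}} (φ : g ⟶ k) :
    IsTitsMap (g.wtE 2) (g.wtE 1) (k.wtE 2) (k.wtE 1) φ (titsFunctor.map φ) where
  map_J _ := rfl
  map_M _ := rfl

end ShortSL2

open JTernary ShortSL2

/-! ## The counit -/

section Counit

variable (g : ShortSL2.{u})

/-- The inclusion of the first component of `T̂(g)`. -/
noncomputable def valJ : g.titsObj.J →ₗ[ℂ] g.space := g.val 2

/-- The inclusion of the second component of `T̂(g)`. -/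
noncomputable def valM : g.titsObj.M →ₗ[ℂ] g.space := g.val 1

/-- The counit on `sl₂ ⊗ J`. -/
noncomputable def counitJ : Sl2 →ₗ[ℂ] g.titsObj.J →ₗ[ℂ] g.space :=
  -- The coefficients are forced by `e ⊗ a ↦ a` and `sl₂`-linearity: `[f, e] = -h` gives `h ⊗ a ↦
  -- -fa`, and `[f, h] = 2f` gives `f ⊗ a ↦ -½ f²a`.
  LinearMap.mk₂ ℂ (fun x a => x.1 0 1 • valJ g a - x.1 0 0 • g.opF (valJ g a)
      - (1 / 2 * x.1 1 0) • g.opF (g.opF (valJ g a)))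
    (fun x y a => by simp only [sl2_coe_add, Matrix.add_apply]; module)
    (fun s x a => by simp only [sl2_coe_smul, Matrix.smul_apply, smul_eq_mul]; module)
    (fun x a b => by simp only [map_add]; module)
    (fun s x a => by simp only [map_smul]; module)

/-- The counit on `V ⊗ M`. -/
noncomputable def counitM : V2 →ₗ[ℂ] g.titsObj.M →ₗ[ℂ] g.space :=
  LinearMap.mk₂ ℂ (fun v m => v 0 • valM g m + v 1 • g.opF (valM g m))
    (fun x y a => by simp only [Pi.add_apply]; module)
    (fun s x a => by simp only [Pi.smul_apply, smul_eq_mul]; module)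
    (fun x a b => by simp only [map_add]; module)
    (fun s x a => by simp only [map_smul]; module)

/-- The counit on `J ⊗ J ⊕ M ⊗ M`. -/
noncomputable def counitPre : g.titsObj.PreB →ₗ[ℂ] g.space :=
  (TensorProduct.lift (g.oJ.compl₁₂ (valJ g) (valJ g))).coprod
    (TensorProduct.lift (g.oM.compl₁₂ (valM g) (valM g)))

variable {g}

theorem valJ_wt (a : g.titsObj.J) : valJ g a ∈ wt g 2 := val_wt a

theorem valM_wt (m : g.titsObj.M) : valM g m ∈ wt g 1 := val_wt m

theorem isHom_valJ {i : ZMod 2} {a : g.titsObj.J} (ha : a ∈ g.titsObj.J.gr i) :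
    g.IsHom 2 i (valJ g a) := isHom_val ha

theorem isHom_valM {i : ZMod 2} {m : g.titsObj.M} (hm : m ∈ g.titsObj.M.gr i) :
    g.IsHom 1 i (valM g m) := isHom_val hm

theorem counitJ_apply (x : Sl2) (a : g.titsObj.J) : counitJ g x a = x.1 0 1 • valJ g a
    - x.1 0 0 • g.opF (valJ g a) - (1 / 2 * x.1 1 0) • g.opF (g.opF (valJ g a)) := rfl

theorem counitM_apply (v : V2) (m : g.titsObj.M) :
    counitM g v m = v 0 • valM g m + v 1 • g.opF (valM g m) := rfl

theorem val_dot (a b : g.titsObj.J) :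
    valJ g (g.titsObj.dot a b) = g.oDot (valJ g a) (valJ g b) := rfl

theorem val_bul (a : g.titsObj.J) (m : g.titsObj.M) :
    valM g (g.titsObj.bul a m) = g.oBul (valJ g a) (valM g m) := rfl

theorem val_star (m n : g.titsObj.M) :
    valJ g (g.titsObj.star m n) = g.br (valM g m) (valM g n) := rfl

theorem val_tri (m n r : g.titsObj.M) :
    valM g (g.titsObj.tri m n r) = g.oTri (valM g m) (valM g n) (valM g r) := rfl

theorem val_partM (m n r : g.titsObj.M) :
    valM g (g.titsObj.partM m n r) = g.br (g.oM (valM g m) (valM g n)) (valM g r) := by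
  rw [oM_br_one (valM_wt m) (valM_wt n) (valM_wt r), ← val_star, ← val_bul, ← val_tri, ← map_smul,
    ← map_sub]
  rfl

theorem counitPre_mk (s : g.titsObj.J ⊗[ℂ] g.titsObj.J) (t : g.titsObj.M ⊗[ℂ] g.titsObj.M) :
    counitPre g (s, t) = TensorProduct.lift (g.oJ.compl₁₂ (valJ g) (valJ g)) s
      + TensorProduct.lift (g.oM.compl₁₂ (valM g) (valM g)) t := rfl

theorem lift_oJ (a b : g.titsObj.J) :
    TensorProduct.lift (g.oJ.compl₁₂ (valJ g) (valJ g)) (a ⊗ₜ b)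
      = g.oJ (valJ g a) (valJ g b) := rfl

theorem lift_oM (m n : g.titsObj.M) :
    TensorProduct.lift (g.oM.compl₁₂ (valM g) (valM g)) (m ⊗ₜ n)
      = g.oM (valM g m) (valM g n) := rfl

theorem counitPre_relator {t : g.titsObj.PreB} (h : g.titsObj.Relator t) : counitPre g t = 0 := by
  cases h with
  | ab i j a b ha hb =>
    have h := oJ_skew (isHom_valJ ha).2 (isHom_valJ hb).2
    rw [counitPre_mk, map_zero, map_add, map_smul, lift_oJ, lift_oJ, h, neg_add_cancel, add_zero]
  | mn i j m n hm hn =>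
    have h := oM_symm (isHom_valM hm).2 (isHom_valM hn).2
    rw [counitPre_mk, map_zero, map_sub, map_smul, lift_oM, lift_oM, h, sub_self, add_zero]
  | abc i j k a b c ha hb hc =>
    have h := oJ_cyclic (isHom_valJ ha) (isHom_valJ hb) (isHom_valJ hc)
    rw [counitPre_mk, map_zero, map_add, map_add, map_smul, map_smul, map_smul, lift_oJ, lift_oJ,
      lift_oJ, add_zero]
    exact h
  | amn i j k a m n ha hm hn =>
    have h := oM_bul (isHom_valJ ha) (isHom_valM hm) (isHom_valM hn)
    rw [counitPre_mk, map_neg, map_smul, map_sub, map_smul, lift_oJ, lift_oM, lift_oM,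
      neg_add_eq_sub]
    exact h
  | mnrs i j k l m n r s hm hn hr hs =>
    have h := oM_part (isHom_valM hm) (isHom_valM hn) (isHom_valM hr) (isHom_valM hs)
    rw [counitPre_mk, map_zero, map_add, map_add, map_add, map_smul, map_smul, map_smul, lift_oM,
      lift_oM, lift_oM, lift_oM, zero_add, val_partM, val_partM, val_partM, val_partM]
    exact h

variable (g) in
/-- The counit on `B(J, M)`. -/
noncomputable def counitB : g.titsObj.B →ₗ[ℂ] g.space :=
  g.titsObj.relB.liftQ (counitPre g) (relB_le_ker _ fun _ h => counitPre_relator h)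

theorem counitB_cJ (a b : g.titsObj.J) :
    counitB g (g.titsObj.cJ a b) = g.oJ (valJ g a) (valJ g b) := by
  refine (counitPre_mk (a ⊗ₜ b) 0).trans ?_
  rw [map_zero, add_zero, lift_oJ]

theorem counitB_cM (m n : g.titsObj.M) :
    counitB g (g.titsObj.cM m n) = g.oM (valM g m) (valM g n) := by
  refine (counitPre_mk 0 (m ⊗ₜ n)).trans ?_
  rw [map_zero, zero_add, lift_oM]

variable (g) in
/-- The linear map underlying the counit. -/
noncomputable def counitLin : g.titsObj.tagSp →ₗ[ℂ] g.space :=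
  TensorProduct.lift (counitJ g) ∘ₗ g.titsObj.prJ + TensorProduct.lift (counitM g) ∘ₗ g.titsObj.prM
    + counitB g ∘ₗ g.titsObj.prB

theorem counitLin_J (x : Sl2) (a : g.titsObj.J) :
    counitLin g (g.titsObj.tJ x a) = counitJ g x a := by
  simp only [counitLin, LinearMap.add_apply, LinearMap.comp_apply, prJ_tJ, prM_tJ, prB_tJ, map_zero,
    add_zero]
  rfl

theorem counitLin_M (v : V2) (m : g.titsObj.M) :
    counitLin g (g.titsObj.tM v m) = counitM g v m := by
  simp only [counitLin, LinearMap.add_apply, LinearMap.comp_apply, prJ_tM, prM_tM, prB_tM, map_zero,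
    add_zero, zero_add]
  rfl

theorem counitLin_B (b : g.titsObj.B) : counitLin g (g.titsObj.tB b) = counitB g b := by
  simp only [counitLin, LinearMap.add_apply, LinearMap.comp_apply, prJ_tB, prM_tB, prB_tB, map_zero,
    zero_add]

theorem isInv_counitB (b : g.titsObj.B) : IsInv (counitB g b) := by
  have h : ∀ T : Module.End ℂ g.space, (∀ a ∈ wt g 2, ∀ b ∈ wt g 2, T (g.oJ a b) = 0) →
      (∀ m ∈ wt g 1, ∀ n ∈ wt g 1, T (g.oM m n) = 0) → T (counitB g b) = 0 := by
    intro T hJ hM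
    have e : T ∘ₗ counitB g = 0 := by
      refine B_ext (fun i j a _ b _ => ?_) (fun i j m _ n _ => ?_)
      · rw [LinearMap.comp_apply, counitB_cJ, hJ _ (valJ_wt a) _ (valJ_wt b), LinearMap.zero_apply]
      · rw [LinearMap.comp_apply, counitB_cM, hM _ (valM_wt m) _ (valM_wt n), LinearMap.zero_apply]
    exact LinearMap.congr_fun e b
  exact ⟨h _ (fun _ ha _ hb => (isInv_oJ ha hb).H) (fun _ ha _ hb => (isInv_oM ha hb).H),
    h _ (fun _ ha _ hb => (isInv_oJ ha hb).E) (fun _ ha _ hb => (isInv_oM ha hb).E),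
    h _ (fun _ ha _ hb => (isInv_oJ ha hb).F) (fun _ ha _ hb => (isInv_oM ha hb).F)⟩

theorem counitLin_mem (i : ZMod 2) (t : g.titsObj.tagSp) (ht : t ∈ g.titsObj.tagSp.gr i) :
    counitLin g t ∈ g.space.gr i := by
  refine tag_induction (P := fun t => counitLin g t ∈ g.space.gr i) ?_ ?_ ?_ ?_ ?_ ht
  · simp
  · intro s s' h h'
    rw [map_add]; exact add_mem h h'
  · intro x a ha
    have h := (isHom_valJ ha).2
    rw [counitLin_J, counitJ_apply]
    exact sub_mem (sub_mem (Submodule.smul_mem _ _ h) (Submodule.smul_mem _ _ (opF_mem h)))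
      (Submodule.smul_mem _ _ (opF_mem (opF_mem h)))
  · intro v m hm
    have h := (isHom_valM hm).2
    rw [counitLin_M, counitM_apply]
    exact add_mem (Submodule.smul_mem _ _ h) (Submodule.smul_mem _ _ (opF_mem h))
  · intro b hb
    rw [counitLin_B]
    refine B_induction (P := fun b => counitB g b ∈ g.space.gr i) ?_ ?_ ?_ ?_ hb
    · simp
    · intro s s' h h'
      rw [map_add]; exact add_mem h h'
    · rintro i j rfl a ha b hb
      rw [counitB_cJ]; exact oJ_mem (isHom_valJ ha).2 (isHom_valJ hb).2
    · rintro i j rfl m hm n hn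
      rw [counitB_cM]; exact oM_mem (isHom_valM hm).2 (isHom_valM hn).2

theorem val_delJ (b : g.titsObj.B) (c : g.titsObj.J) :
    valJ g (g.titsObj.delJ b c) = g.br (counitB g b) (valJ g c) := by
  have h : g.titsObj.delJ.compr₂ (valJ g)
      = (g.br ∘ₗ counitB g).compl₁₂ LinearMap.id (valJ g) := by
    refine B_ext (fun i j a ha b hb => SuperSpace.hom_ext fun k c hc => ?_)
      (fun i j m hm n hn => SuperSpace.hom_ext fun k c hc => ?_)
    · simp only [LinearMap.compr₂_apply, LinearMap.compl₁₂_apply, LinearMap.comp_apply,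
        LinearMap.id_apply, delJ_cJ ha hb, angJ_apply, angleJ, counitB_cJ, map_sub, map_smul]
      exact (oJ_br_two (isHom_valJ ha) (isHom_valJ hb) (isHom_valJ hc)).symm
    · simp only [LinearMap.compr₂_apply, LinearMap.compl₁₂_apply, LinearMap.comp_apply,
        LinearMap.id_apply, delJ_cM hm hn, parJ_apply _ _ _ _ hc, partJ, counitB_cM, map_sub,
        map_smul]
      exact (oM_br_two (isHom_valM hm) (isHom_valM hn) (isHom_valJ hc)).symm
  exact LinearMap.congr_fun₂ h b c

theorem val_delM (b : g.titsObj.B) (m : g.titsObj.M) :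
    valM g (g.titsObj.delM b m) = g.br (counitB g b) (valM g m) := by
  have h : g.titsObj.delM.compr₂ (valM g)
      = (g.br ∘ₗ counitB g).compl₁₂ LinearMap.id (valM g) := by
    refine B_ext (fun i j a ha b hb => SuperSpace.hom_ext fun k r hr => ?_)
      (fun i j m hm n hn => SuperSpace.hom_ext fun k r hr => ?_)
    · simp only [LinearMap.compr₂_apply, LinearMap.compl₁₂_apply, LinearMap.comp_apply,
        LinearMap.id_apply, delM_cJ ha hb, angM_apply, angleM, counitB_cJ, map_sub, map_smul]
      exact (oJ_br_one (isHom_valJ ha) (isHom_valJ hb) (isHom_valM hr)).symm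
    · simp only [LinearMap.compr₂_apply, LinearMap.compl₁₂_apply, LinearMap.comp_apply,
        LinearMap.id_apply, delM_cM, parM_apply, counitB_cM, val_partM]
  exact LinearMap.congr_fun₂ h b m

/-- In coordinates of `x` and `y` this is the table of the nine brackets between `a, fa, f²a` and
`b, fb, f²b`. -/
theorem counitJ_dot (x y : Sl2) (a b : g.titsObj.J) :
    counitJ g ⁅x, y⁆ (g.titsObj.dot a b) + (1 / 2 * kappa x y) • g.oJ (valJ g a) (valJ g b)
      = g.br (counitJ g x a) (counitJ g y b) := by
  have ha := valJ_wt a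
  have hb := valJ_wt b
  obtain ⟨p, q, r, hx⟩ := sl2_coords x
  obtain ⟨p', q', r', hy⟩ := sl2_coords y
  have h00 : (⁅x, y⁆ : Sl2).1 0 0 = q * r' - q' * r := by
    rw [coe_lie, hx, hy]; simp [Matrix.mul_apply, Fin.sum_univ_two]; ring
  have h01 : (⁅x, y⁆ : Sl2).1 0 1 = 2 * (p * q' - q * p') := by
    rw [coe_lie, hx, hy]; simp [Matrix.mul_apply, Fin.sum_univ_two]; ring
  have h10 : (⁅x, y⁆ : Sl2).1 1 0 = 2 * (r * p' - p * r') := by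
    rw [coe_lie, hx, hy]; simp [Matrix.mul_apply, Fin.sum_univ_two]; ring
  have hk : kappa x y = 4 * (2 * p * p' + q * r' + r * q') := by
    rw [kappa, hx, hy]
    simp [Matrix.mul_apply, Fin.sum_univ_two, Matrix.trace_fin_two]; ring
  have x00 : x.1 0 0 = p := by rw [hx]; rfl
  have x01 : x.1 0 1 = q := by rw [hx]; rfl
  have x10 : x.1 1 0 = r := by rw [hx]; rfl
  have y00 : y.1 0 0 = p' := by rw [hy]; rfl
  have y01 : y.1 0 1 = q' := by rw [hy]; rfl
  have y10 : y.1 1 0 = r' := by rw [hy]; rfl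
  rw [counitJ_apply, counitJ_apply, counitJ_apply, h00, h01, h10, hk, x00, x01, x10, y00, y01, y10]
  simp only [map_sub, map_add, map_neg, map_smul, LinearMap.sub_apply, LinearMap.add_apply,
    LinearMap.neg_apply, LinearMap.smul_apply, smul_sub, smul_add, smul_neg, br_two_two ha hb, br_two_FF (a := valJ g a) (b := valJ g b),
    br_FF_two ha hb, br_F_FF ha hb, br_FF_F ha hb, br_FF_FF ha hb,
    br_two_F (a := valJ g a) (b := valJ g b), br_F_two ha hb,
    br_F_F (a := valJ g a) (b := valJ g b), val_dot]
  match_scalars <;> ring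

theorem counitM_bul (x : Sl2) (v : V2) (a : g.titsObj.J) (m : g.titsObj.M) :
    counitM g (x.1 *ᵥ v) (g.titsObj.bul a m) = g.br (counitJ g x a) (counitM g v m) := by
  have ha := valJ_wt a
  have hm := valM_wt m
  obtain ⟨p, q, r, hx⟩ := sl2_coords x
  have h0 : (x.1 *ᵥ v) 0 = p * v 0 + q * v 1 := by
    rw [hx]; simp [Matrix.mulVec, dotProduct, Fin.sum_univ_two]
  have h1 : (x.1 *ᵥ v) 1 = r * v 0 - p * v 1 := by
    rw [hx]; simp [Matrix.mulVec, dotProduct, Fin.sum_univ_two]; ring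
  have x00 : x.1 0 0 = p := by rw [hx]; rfl
  have x01 : x.1 0 1 = q := by rw [hx]; rfl
  have x10 : x.1 1 0 = r := by rw [hx]; rfl
  rw [counitM_apply, counitM_apply, counitJ_apply, h0, h1, x00, x01, x10]
  simp only [map_sub, map_add, map_neg, map_smul, LinearMap.sub_apply, LinearMap.add_apply,
    LinearMap.neg_apply, LinearMap.smul_apply, smul_sub, smul_add, smul_neg, br_two_one ha hm, ← oBul_apply (valJ g a) (valM g m), br_F_one ha hm,
    br_F_F_one (a := valJ g a) hm, br_FF_one ha hm, br_FF_F_one ha hm, val_bul]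
  match_scalars <;> ring

theorem counitM_star (v w : V2) (m n : g.titsObj.M) :
    counitJ g (symz v w) (g.titsObj.star m n) + detForm v w • g.oM (valM g m) (valM g n)
      = g.br (counitM g v m) (counitM g w n) := by
  have hm := valM_wt m
  have hn := valM_wt n
  have h00 : (symz v w).1 0 0 = -((v 0 * w 1 + v 1 * w 0) / 2) := by
    simp [symz, sl2E, sl2F, sl2H]
  have h01 : (symz v w).1 0 1 = v 0 * w 0 := by
    simp [symz, sl2E, sl2F, sl2H]
  have h10 : (symz v w).1 1 0 = -(v 1 * w 1) := by
    simp [symz, sl2E, sl2F, sl2H]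
  rw [counitM_apply, counitM_apply, counitJ_apply, h00, h01, h10, detForm]
  simp only [map_sub, map_add, map_neg, map_smul, LinearMap.sub_apply, LinearMap.add_apply,
    LinearMap.neg_apply, LinearMap.smul_apply, smul_sub, smul_add, smul_neg, br_one_F (valM g m) (valM g n), br_F_one_one (valM g m) (valM g n),
    br_F_one_F hm hn, val_star]
  match_scalars <;> ring

theorem counitLin_br (s t : g.titsObj.tagSp) :
    counitLin g (g.titsObj.tagBr s t) = g.br (counitLin g s) (counitLin g t) := by
  refine map_tagBr g.isLie counitLin_mem ?_ ?_ ?_ ?_ ?_ s t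
  · intro x y a b
    rw [tagBr_JJ, map_add, map_smul, counitLin_J, counitLin_J, counitLin_J, counitLin_B, counitB_cJ,
      counitJ_dot]
  · intro x v a m
    rw [tagBr_JM, counitLin_M, counitLin_J, counitLin_M, counitM_bul]
  · intro v w m n
    rw [tagBr_MM, map_add, map_smul, counitLin_J, counitLin_M, counitLin_M, counitLin_B, counitB_cM,
      counitM_star]
  · intro b x a
    rw [counitLin_J, counitLin_J, counitLin_B, counitJ_apply, counitJ_apply]
    simp only [map_sub, map_add, map_neg, map_smul, LinearMap.sub_apply, LinearMap.add_apply,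
    LinearMap.neg_apply, LinearMap.smul_apply, smul_sub, smul_add, smul_neg, (isInv_counitB b).br_opF, val_delJ]
  · intro b v m
    rw [counitLin_M, counitLin_M, counitLin_B, counitM_apply, counitM_apply]
    simp only [map_sub, map_add, map_neg, map_smul, LinearMap.sub_apply, LinearMap.add_apply,
    LinearMap.neg_apply, LinearMap.smul_apply, smul_sub, smul_add, smul_neg, (isInv_counitB b).br_opF, val_delM]

theorem counitLin_act (x : Sl2) (t : g.titsObj.tagSp) :
    counitLin g (g.titsObj.tagAct x t) = g.act x (counitLin g t) := by
  have h : counitLin g ∘ₗ g.titsObj.tagAct x = g.act x ∘ₗ counitLin g := by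
    refine tag_ext ?_ ?_ ?_
    · intro y a
      have ha := valJ_wt a
      rw [LinearMap.comp_apply, LinearMap.comp_apply, tagAct_J, counitLin_J, counitLin_J,
        counitJ_apply, counitJ_apply, act_eq]
      obtain ⟨p, q, r, hx⟩ := sl2_coords x
      obtain ⟨p', q', r', hy⟩ := sl2_coords y
      have h00 : (⁅x, y⁆ : Sl2).1 0 0 = q * r' - q' * r := by
        rw [coe_lie, hx, hy]; simp [Matrix.mul_apply, Fin.sum_univ_two]; ring
      have h01 : (⁅x, y⁆ : Sl2).1 0 1 = 2 * (p * q' - q * p') := by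
        rw [coe_lie, hx, hy]; simp [Matrix.mul_apply, Fin.sum_univ_two]; ring
      have h10 : (⁅x, y⁆ : Sl2).1 1 0 = 2 * (r * p' - p * r') := by
        rw [coe_lie, hx, hy]; simp [Matrix.mul_apply, Fin.sum_univ_two]; ring
      have x00 : x.1 0 0 = p := by rw [hx]; rfl
      have x01 : x.1 0 1 = q := by rw [hx]; rfl
      have x10 : x.1 1 0 = r := by rw [hx]; rfl
      have y00 : y.1 0 0 = p' := by rw [hy]; rfl
      have y01 : y.1 0 1 = q' := by rw [hy]; rfl
      have y10 : y.1 1 0 = r' := by rw [hy]; rfl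
      rw [h00, h01, h10, x00, x01, x10, y00, y01, y10]
      simp only [map_sub, map_add, map_neg, map_smul, LinearMap.sub_apply, LinearMap.add_apply,
    LinearMap.neg_apply, LinearMap.smul_apply, smul_sub, smul_add, smul_neg, opH_two ha, opH_opF_two ha, opH_opF_opF_two ha, opE_two ha, opE_opF_two ha,
        opE_opF_opF_two ha, opF_opF_opF_two ha]
      match_scalars <;> ring
    · intro v m
      have hm := valM_wt m
      rw [LinearMap.comp_apply, LinearMap.comp_apply, tagAct_M, counitLin_M, counitLin_M,
        counitM_apply, counitM_apply, act_eq]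
      obtain ⟨p, q, r, hx⟩ := sl2_coords x
      have h0 : (x.1 *ᵥ v) 0 = p * v 0 + q * v 1 := by
        rw [hx]; simp [Matrix.mulVec, dotProduct, Fin.sum_univ_two]
      have h1 : (x.1 *ᵥ v) 1 = r * v 0 - p * v 1 := by
        rw [hx]; simp [Matrix.mulVec, dotProduct, Fin.sum_univ_two]; ring
      have x00 : x.1 0 0 = p := by rw [hx]; rfl
      have x01 : x.1 0 1 = q := by rw [hx]; rfl
      have x10 : x.1 1 0 = r := by rw [hx]; rfl
      rw [h0, h1, x00, x01, x10]
      simp only [map_sub, map_add, map_neg, map_smul, LinearMap.sub_apply, LinearMap.add_apply,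
    LinearMap.neg_apply, LinearMap.smul_apply, smul_sub, smul_add, smul_neg, opH_one hm, opH_opF_one hm, opE_one hm, opE_opF_one hm, opF_opF_one hm]
      match_scalars <;> ring
    · intro b
      rw [LinearMap.comp_apply, LinearMap.comp_apply, tagAct_B, counitLin_B, (isInv_counitB b).act,
        map_zero]
  exact LinearMap.congr_fun h t

variable (g) in
/-- The counit. -/
noncomputable def counitHom : ShortSL2.Hom g.titsObj.tagObj g where
  lin := counitLin g
  even := counitLin_mem
  map_br := counitLin_br
  map_act := counitLin_act

end Counit

open JTernary ShortSL2

/-! ## The unit -/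

section Unit

variable {X : JTernary.{u}}

theorem sl2F_mulVec_v1 : sl2F.1 *ᵥ v1 = v2 := by
  ext i
  fin_cases i <;> simp [sl2F, v1, v2, Matrix.mulVec, dotProduct, Fin.sum_univ_two]

theorem sl2E_mulVec_v2 : sl2E.1 *ᵥ v2 = v1 := by
  ext i
  fin_cases i <;> simp [sl2E, v1, v2, Matrix.mulVec, dotProduct, Fin.sum_univ_two]

theorem sl2H_mulVec_v1 : sl2H.1 *ᵥ v1 = v1 := by
  ext i
  fin_cases i <;> simp [sl2H, v1, Matrix.mulVec, dotProduct, Fin.sum_univ_two]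

theorem lie_F_E : ⁅sl2F, sl2E⁆ = -sl2H := by rw [← lie_skew, lie_E_F]

theorem lie_F_H : ⁅sl2F, sl2H⁆ = (2 : ℂ) • sl2F := by rw [← lie_skew, lie_H_F]; module

theorem lie_E_H : ⁅sl2E, sl2H⁆ = (-2 : ℂ) • sl2E := by rw [← lie_skew, lie_H_E]; module

theorem kappa_E_H : kappa sl2E sl2H = 0 := by
  simp [kappa, sl2E, sl2H, Matrix.trace_fin_two]

theorem symz_v1_v1 : symz v1 v1 = sl2E := by simp [symz, v1]

theorem detForm_v1_v1 : detForm v1 v1 = 0 := by simp [detForm, v1]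

theorem detForm_v2_v1 : detForm v2 v1 = -1 := by simp [detForm, v1, v2]

theorem symz_v1_v2_mulVec_v1 : (symz v1 v2).1 *ᵥ v1 = (-1 / 2 : ℂ) • v1 := by
  rw [symz_mulVec, detForm_v2_v1, detForm_v1_v1]; module

theorem tagF_J (a : X.J) : X.tagAct sl2F (X.tJ sl2E a) = -X.tJ sl2H a := by
  rw [tagAct_J, lie_F_E, map_neg, LinearMap.neg_apply]

theorem tagF_M (m : X.M) : X.tagAct sl2F (X.tM v1 m) = X.tM v2 m := by
  rw [tagAct_M, sl2F_mulVec_v1]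

theorem tJ_E_wt (a : X.J) : X.tJ sl2E a ∈ wt X.tagObj 2 := by
  refine mem_wt.2 ?_
  change X.tagAct sl2H (X.tJ sl2E a) = (2 : ℂ) • X.tJ sl2E a
  rw [tagAct_J, lie_H_E, map_smul, LinearMap.smul_apply]

theorem tM_v1_wt (m : X.M) : X.tM v1 m ∈ wt X.tagObj 1 := by
  refine mem_wt.2 ?_
  change X.tagAct sl2H (X.tM v1 m) = (1 : ℂ) • X.tM v1 m
  rw [tagAct_M, sl2H_mulVec_v1, one_smul]

variable (X) in
/-- The unit on `J`. -/
noncomputable def unitJ : X.J →ₗ[ℂ] X.tagObj.titsObj.J :=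
  (X.tagObj.wtE 2).symm.toLinearMap ∘ₗ (X.tJ sl2E).codRestrict (wt X.tagObj 2) tJ_E_wt

variable (X) in
/-- The unit on `M`. -/
noncomputable def unitM : X.M →ₗ[ℂ] X.tagObj.titsObj.M :=
  (X.tagObj.wtE 1).symm.toLinearMap ∘ₗ (X.tM v1).codRestrict (wt X.tagObj 1) tM_v1_wt

theorem valJ_unitJ (a : X.J) : valJ X.tagObj (unitJ X a) = X.tJ sl2E a := rfl

theorem valM_unitM (m : X.M) : valM X.tagObj (unitM X m) = X.tM v1 m := rfl

/-- Here `f(e ⊗ b) = -h ⊗ b`, while `[e, h] = -2e` and `κ(e, h) = 0`. The bracket is `2 e ⊗ ab`,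
whence the `½` in the product of `T̂`. -/
theorem tag_dot (a b : X.J) : X.tJ sl2E (X.dot a b)
    = (1 / 2 : ℂ) • X.tagBr (X.tJ sl2E a) (X.tagAct sl2F (X.tJ sl2E b)) := by
  rw [tagF_J, map_neg, tagBr_JJ, lie_E_H, kappa_E_H]
  simp only [map_smul, LinearMap.smul_apply]
  module

theorem tag_bul (a : X.J) (m : X.M) : X.tM v1 (X.bul a m)
    = X.tagBr (X.tJ sl2E a) (X.tagAct sl2F (X.tM v1 m)) := by
  rw [tagF_M, tagBr_JM, sl2E_mulVec_v2]

theorem tag_star (m n : X.M) : X.tJ sl2E (X.star m n) = X.tagBr (X.tM v1 m) (X.tM v1 n) := by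
  rw [tagBr_MM, symz_v1_v1, detForm_v1_v1, zero_smul, add_zero]

/-- Since `e₁ ⊙ e₂ = -½ h`, the `sl₂ ⊗ J` part contributes `-½ (m ⋆ n) • r`, which cancels the first
term of `∂_{m,n}(r)`. -/
theorem tag_tri (m n r : X.M) : X.tM v1 (X.tri m n r)
    = -X.tagBr (X.tagBr (X.tM v1 m) (X.tagAct sl2F (X.tM v1 n))) (X.tM v1 r) := by
  rw [tagF_M, tagBr_MM, detForm_v1_v2, one_smul, map_add, LinearMap.add_apply, tagBr_JM, tagBr_BM,
    delM_cM, parM_apply, partM, symz_v1_v2_mulVec_v1]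
  simp only [map_sub, map_add, map_neg, map_smul, LinearMap.sub_apply, LinearMap.add_apply,
    LinearMap.neg_apply, LinearMap.smul_apply, smul_sub, smul_add, smul_neg]
  module

theorem unit_dot (a b : X.J) :
    unitJ X (X.dot a b) = X.tagObj.titsObj.dot (unitJ X a) (unitJ X b) := by
  refine val_injective ?_
  change valJ X.tagObj _ = valJ X.tagObj _
  rw [val_dot, oDot_apply, opF, valJ_unitJ, valJ_unitJ, valJ_unitJ]
  with_reducible exact tag_dot a b

theorem unit_bul (a : X.J) (m : X.M) :
    unitM X (X.bul a m) = X.tagObj.titsObj.bul (unitJ X a) (unitM X m) := by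
  refine val_injective ?_
  change valM X.tagObj _ = valM X.tagObj _
  rw [val_bul, oBul_apply, opF, valJ_unitJ, valM_unitM, valM_unitM]
  with_reducible exact tag_bul a m

theorem unit_star (m n : X.M) :
    unitJ X (X.star m n) = X.tagObj.titsObj.star (unitM X m) (unitM X n) := by
  refine val_injective ?_
  change valJ X.tagObj _ = valJ X.tagObj _
  rw [val_star, valJ_unitJ, valM_unitM, valM_unitM]
  with_reducible exact tag_star m n

theorem unit_tri (m n r : X.M) :
    unitM X (X.tri m n r) = X.tagObj.titsObj.tri (unitM X m) (unitM X n) (unitM X r) := by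
  refine val_injective ?_
  change valM X.tagObj _ = valM X.tagObj _
  rw [val_tri, oTri_apply, opF, valM_unitM, valM_unitM, valM_unitM, valM_unitM]
  with_reducible exact tag_tri m n r

variable (X) in
/-- The unit. -/
noncomputable def unitHom : JTernary.Hom X X.tagObj.titsObj where
  onJ := unitJ X
  onM := unitM X
  evenJ _ _ ha := mem_wtSp.2 (tJ_mem sl2E ha)
  evenM _ _ hm := mem_wtSp.2 (tM_mem v1 hm)
  map_dot := unit_dot
  map_bul := unit_bul
  map_star := unit_star
  map_tri := unit_tri

theorem unitHom_onJ (a : X.J) : (unitHom X).onJ a = unitJ X a := rfl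

theorem unitHom_onM (m : X.M) : (unitHom X).onM m = unitM X m := rfl

end Unit

/-! ## The adjunction -/

section Triangle

theorem counitJ_sl2E {g : ShortSL2.{u}} (a : g.titsObj.J) : counitJ g sl2E a = valJ g a := by
  rw [counitJ_apply]; simp [sl2E]

theorem counitM_v1 {g : ShortSL2.{u}} (m : g.titsObj.M) : counitM g v1 m = valM g m := by
  rw [counitM_apply]; simp [v1]

variable {X : JTernary.{u}}

theorem counitJ_unitJ (x : Sl2) (a : X.J) : counitJ X.tagObj x (unitJ X a) = X.tJ x a := by
  rw [counitJ_apply, valJ_unitJ]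
  have h1 : X.tagObj.opF (X.tJ sl2E a) = -X.tJ sl2H a := tagF_J a
  have h2 : X.tagObj.opF (X.tJ sl2H a) = (2 : ℂ) • X.tJ sl2F a := by
    refine (tagAct_J sl2F sl2H a).trans ?_
    rw [lie_F_H, map_smul, LinearMap.smul_apply]
  have h3 := congrArg (fun t => X.tJ t a) (sl2_eq x)
  simp only [map_add, map_smul, LinearMap.add_apply, LinearMap.smul_apply] at h3
  rw [h1, map_neg, h2, h3]
  module

theorem counitM_unitM (v : V2) (m : X.M) : counitM X.tagObj v (unitM X m) = X.tM v m := by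
  rw [counitM_apply, valM_unitM]
  have h1 : X.tagObj.opF (X.tM v1 m) = X.tM v2 m := tagF_M m
  have h2 : v = v 0 • v1 + v 1 • v2 := by
    ext i
    fin_cases i <;> simp [v1, v2]
  have h3 := congrArg (fun t => X.tM t m) h2
  simp only [map_add, map_smul, LinearMap.add_apply, LinearMap.smul_apply] at h3
  rw [h1, h3]

theorem oJ_unit (a b : X.J) :
    X.tagObj.oJ (valJ X.tagObj (unitJ X a)) (valJ X.tagObj (unitJ X b)) = X.tB (X.cJ a b) := by
  change (1 / 4 : ℂ) • X.tagBr (X.tagAct sl2F (X.tJ sl2E a)) (X.tagAct sl2F (X.tJ sl2E b)) = _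
  rw [tagF_J, tagF_J, map_neg, map_neg, LinearMap.neg_apply, neg_neg, ← tB_cJ]

/-- Between the two brackets the symmetric part `⊙` cancels, while the alternating form doubles and
compensates the `½`. -/
theorem oM_unit (m n : X.M) :
    X.tagObj.oM (valM X.tagObj (unitM X m)) (valM X.tagObj (unitM X n)) = X.tB (X.cM m n) := by
  change (1 / 2 : ℂ) • (X.tagBr (X.tM v1 m) (X.tagAct sl2F (X.tM v1 n))
    - X.tagBr (X.tagAct sl2F (X.tM v1 m)) (X.tM v1 n)) = _
  rw [tagF_M, tagF_M, tagBr_MM, tagBr_MM, symz_comm v2 v1, detForm_v1_v2, detForm_v2_v1]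
  module

theorem counit_unit : counitLin X.tagObj ∘ₗ tagLin (unitHom X) = LinearMap.id := by
  refine tag_cls_ext (fun x a => ?_) (fun v m => ?_) (fun a b => ?_) (fun m n => ?_) <;>
  rw [LinearMap.comp_apply, LinearMap.id_apply]
  · rw [tagLin_J, counitLin_J]; rw [unitHom_onJ, counitJ_unitJ]
  · rw [tagLin_M, counitLin_M]; rw [unitHom_onM, counitM_unitM]
  · rw [tagLin_B, mapB_cJ, counitLin_B, counitB_cJ]; rw [unitHom_onJ,
      unitHom_onJ]; with_reducible exact oJ_unit a b
  · rw [tagLin_B, mapB_cM, counitLin_B, counitB_cM]; rw [unitHom_onM,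
      unitHom_onM]; with_reducible exact oM_unit m n

theorem comp_lin {g k l : ShortSL2.{u}} (φ : g ⟶ k) (ψ : k ⟶ l) :
    ShortSL2.Hom.lin (φ ≫ ψ) = ShortSL2.Hom.lin ψ ∘ₗ ShortSL2.Hom.lin φ := rfl

theorem id_lin (g : ShortSL2.{u}) : ShortSL2.Hom.lin (𝟙 g) = LinearMap.id := rfl

theorem tagMap_lin {Y : JTernary.{u}} (φ : JTernary.Hom X Y) : (tagMap φ).lin = tagLin φ := rfl

theorem counitHom_lin (g : ShortSL2.{u}) : (counitHom g).lin = counitLin g := rfl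

theorem tagMap_unitHom_comp_counitHom :
    (tagMap (unitHom X) ≫ counitHom X.tagObj : X.tagObj ⟶ X.tagObj) = 𝟙 X.tagObj := by
  refine ShortSL2.Hom.ext ?_
  rw [comp_lin, id_lin, tagMap_lin, counitHom_lin]
  with_reducible exact counit_unit

theorem counit_natural {g k : ShortSL2.{u}} (φ : ShortSL2.Hom g k) :
    counitLin k ∘ₗ tagLin (titsMap φ) = φ.lin ∘ₗ counitLin g := by
  have hJ : ∀ a, valJ k ((titsMap φ).onJ a) = φ.lin (valJ g a) := fun _ => rfl
  have hM : ∀ m, valM k ((titsMap φ).onM m) = φ.lin (valM g m) := fun _ => rfl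
  refine tag_cls_ext (fun x a => ?_) (fun v m => ?_) (fun a b => ?_) (fun m n => ?_) <;>
  rw [LinearMap.comp_apply, LinearMap.comp_apply]
  · rw [tagLin_J, counitLin_J, counitLin_J, counitJ_apply, counitJ_apply]
    simp only [hJ, map_sub, map_add, map_neg, map_smul, LinearMap.sub_apply, LinearMap.add_apply,
    LinearMap.neg_apply, LinearMap.smul_apply, smul_sub, smul_add, smul_neg, map_opF]
  · rw [tagLin_M, counitLin_M, counitLin_M, counitM_apply, counitM_apply]
    simp only [hM, map_sub, map_add, map_neg, map_smul, LinearMap.sub_apply, LinearMap.add_apply,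
    LinearMap.neg_apply, LinearMap.smul_apply, smul_sub, smul_add, smul_neg, map_opF]
  · rw [tagLin_B, mapB_cJ, counitLin_B, counitB_cJ, counitLin_B, counitB_cJ, oJ_apply, oJ_apply]
    simp only [hJ, map_sub, map_add, map_neg, map_smul, LinearMap.sub_apply, LinearMap.add_apply,
    LinearMap.neg_apply, LinearMap.smul_apply, smul_sub, smul_add, smul_neg, map_opF, φ.map_br]
  · rw [tagLin_B, mapB_cM, counitLin_B, counitB_cM, counitLin_B, counitB_cM, oM_apply, oM_apply]
    simp only [hM, map_sub, map_add, map_neg, map_smul, LinearMap.sub_apply, LinearMap.add_apply,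
    LinearMap.neg_apply, LinearMap.smul_apply, smul_sub, smul_add, smul_neg, map_opF, φ.map_br]

end Triangle

/-- The adjunction between `TAG` and `T̂`. -/
noncomputable def tagAdjunction : tagFunctor.{u} ⊣ titsFunctor.{u} where
  unit :=
    { app := fun X => unitHom X
      naturality := fun _ _ φ => JTernary.Hom.ext
        (LinearMap.ext fun a => val_injective (tagLin_J φ sl2E a).symm)
        (LinearMap.ext fun m => val_injective (tagLin_M φ v1 m).symm) }
  counit :=
    { app := fun g => counitHom g
      naturality := fun _ _ φ => ShortSL2.Hom.ext (counit_natural φ) }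
  left_triangle_components _ := tagMap_unitHom_comp_counitHom
  right_triangle_components g := JTernary.Hom.ext
    -- The composite sends a highest weight vector `a` to `e ⊗ a` and back to `a`; in weight 1 the
    -- vector `e₁` plays the role of `e`.
    (LinearMap.ext fun a => val_injective
      ((counitLin_J (g := g) sl2E a).trans (counitJ_sl2E a)))
    (LinearMap.ext fun m => val_injective
      ((counitLin_M (g := g) v1 m).trans (counitM_v1 m)))

theorem isCanonical_counit (g : ShortSL2.{u}) :
    IsCanonical g.titsObj.tagE (g.wtE 2) (g.wtE 1) (counitHom g) where
  map_J a := (counitLin_J (g := g) sl2E a).trans (counitJ_sl2E a)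
  map_M m := (counitLin_M (g := g) v1 m).trans (counitM_v1 m)
  map_clsJ a b := (counitLin_B _).trans (counitB_cJ a b)
  map_clsM m n := (counitLin_B _).trans (counitB_cM m n)

end SuperTAG

theorem theorem5p6 :
    ∃ (TAG : JTernary.{u} ⥤ ShortSL2.{u}) (T : ShortSL2.{u} ⥤ JTernary.{u})
      (e : ∀ X : JTernary.{u}, X.TagSpace ≃ₗ[ℂ] (TAG.obj X).space)
      (p : ∀ g : ShortSL2.{u}, (T.obj g).J ≃ₗ[ℂ] wt g 2)
      (q : ∀ g : ShortSL2.{u}, (T.obj g).M ≃ₗ[ℂ] wt g 1),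
      (∀ X : JTernary.{u}, IsTag X (TAG.obj X) (e X)) ∧
      (∀ (X Y : JTernary.{u}) (φ : X ⟶ Y), IsTagMap (e X) (e Y) φ (TAG.map φ)) ∧
      (∀ g : ShortSL2.{u}, IsTits g (T.obj g) (p g) (q g)) ∧
      (∀ (g k : ShortSL2.{u}) (φ : g ⟶ k), IsTitsMap (p g) (q g) (p k) (q k) φ (T.map φ)) ∧
      ∃ adj : TAG ⊣ T, ∀ g : ShortSL2.{u},
        IsCanonical (e (T.obj g)) (p g) (q g) (adj.counit.app g) :=
  ⟨JTernary.tagFunctor, ShortSL2.titsFunctor, fun X => X.tagE, fun g => g.wtE 2, fun g => g.wtE 1,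
    fun X => X.isTag_tagObj, fun _ _ φ => JTernary.isTagMap_tagFunctor φ,
    fun _ => ShortSL2.isTits_titsObj, fun _ _ φ => ShortSL2.isTitsMap_titsFunctor φ,
    tagAdjunction, isCanonical_counit⟩
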